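/- Let $k$ be a field. A weak bialgebra over $k$ is a $k$-vector space $A$ with a unital algebra structure (product by juxtaposition, unit $1$) and a counital coalgebra structure $(\Delta,\epsilon)$, $\Delta(h)=h_1\otimes h_2$, such that $\Delta(gh)=\Delta(g)\Delta(h)$, $\Delta^2(1)=(\Delta(1)\otimes 1)(1\otimes\Delta(1))=(1\otimes\Delta(1))(\Delta(1)\otimes 1)$ and $\epsilon(abc)=\epsilon(ab_1)\epsilon(b_2c)=\epsilon(ab_2)\epsilon(b_1c)$ for all $a,b,c,g,h\in A$. Put $$\sqcap^R(h)=1_1\epsilon(h1_2),\quad \overline\sqcap^R(h)=1_1\epsilon(1_2h),\quad \sqcap^L(h)=\epsilon(1_1h)1_2,\quad \overline\sqcap^L(h)=\epsilon(h1_1)1_2 .$$ A weak Hopf algebra is a weak bialgebra $A$ with a linear map $\sigma:A\to A$ (the antipode) such that $h_1\sigma(h_2)=\sqcap^L(h)$ and $\sigma(h_1)h_2=\sqcap^R(h)$ for all $h\in A$. The base algebra is the subalgebra $R=\sqcap^R(A)$ of $A$. It carries the separability element $\sum_i e_i\otimes f_i=1_1\otimes\sqcap^R(1_2)\in R\otimes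 R$ and the Frobenius functional $\psi=\epsilon|_R$. Let $\mathsf{bim}(R\otimes R^{\mathsf{op}})$ be the category of $R\otimes R^{\mathsf{op}}$-bimodules (with equal left and right actions of $k$). For bimodules $M,N$ let $M\circ N$ be the subspace $\sum_{i,j}(e_i\otimes 1)M(e_j\otimes 1)\otimes(1\otimes f_i)N(1\otimes f_j)$ of $M\otimes N$, i.e. the image of the idempotent $m\otimes n\mapsto \sum_{i,j}(e_i\otimes 1)m(e_j\otimes 1)\otimes(1\otimes f_i)n(1\otimes f_j)$; write $m\circ n$ for the image of $m\otimes n$ under the resulting canonical epimorphism $M\otimes N\twoheadrightarrow M\circ N$. It is a bimodule via $(x\otimes y)(m\circ n)(x'\otimes y')=(1\otimes y)m(1\otimes y')\circ(x\otimes 1)n(x'\otimes 1)$. With the evident associativity constraint, $\circ$ is a monoidal product on $\mathsf{bim}(R\otimes R^{\mathsf{op}})$. Its unit $i$ is the vector space $R\otimes R$ with actions $(x\otimes y)(p\otimes q)(x'\otimes y')=y'px'\otimes xq\sum_i\psi(yf_i)e_i$, and its unit constraints $i\circ M\cong M\cong M\circ i$ are the restrictions of $\psi\otimes\psi\otimes\mathrm{id}_M$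 and $\mathrm{id}_M\otimes\psi\otimes\psi$. Let $j$ be the vector space $R\otimes R$ with actions $(x\otimes y)(p\otimes q)(x'\otimes y')=xpx'\otimes y'qy$; it is a comonoid in $(\mathsf{bim}(R\otimes R^{\mathsf{op}}),\circ,i)$ with comultiplication $\xi^0:j\to j\circ j$, $p\otimes q\mapsto(1\otimes q)\circ(p\otimes 1)$, and counit $p\otimes q\mapsto\sum_{i} qe_i\otimes p\,\nu(f_i)$, where $\nu(y)=\sum_l\psi(yf_l)e_l$. Let $a$ be the vector space $A$ with actions $(x\otimes y)h(x'\otimes y')=x\overline\sqcap^L(y)\,h\,x'\overline\sqcap^L(y')$; it is a comonoid in $(\mathsf{bim}(R\otimes R^{\mathsf{op}}),\circ,i)$ with comultiplication $\delta:h\mapsto h_1\circ h_2$ and counit $\varepsilon:h\mapsto\sqcap^R(h_1)\otimes\overline\sqcap^R(h_2)$. Let $\eta:j\to a$ be the bimodule map $p\otimes q\mapsto p\,\overline\sqcap^L(q)$. A comonoid in a monoidal category, in particular a $k$-coalgebra, is called coseparable if its comultiplication has a retraction that is a bicomodule map. **Theorem.** For a weak Hopf algebra $A$ over a field $k$, with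 base algebra $R$, the following assertions are equivalent. 1. (i') $(A,\Delta,\epsilon)$ is a coseparable $k$-coalgebra. 2. (i) $(a,\delta,\varepsilon)$ is a coseparable comonoid in $(\mathsf{bim}(R\otimes R^{\mathsf{op}}),\circ,i)$. 3. (ii') There is a linear map $\tau':A\to k$ such that $h_1\tau'(h_2)=\sqcap^L(h_1)\tau'(h_2)$ for all $h\in A$, and $\tau'\circ\sqcap^L=\epsilon$ (composition of maps). 4. (ii, duoidal form) There is a normalized left cointegral $\theta$ for $a$: a morphism $\theta:a\circ j\to j$ in $\mathsf{bim}(R\otimes R^{\mathsf{op}})$ such that $(\eta\circ 1)\,\xi^0\,\theta=(1\circ\theta)(\delta\circ 1)$, $\xi^0\,\theta=(\theta\circ 1)(1\circ\xi^0)$ and $\theta\,(\eta\circ 1)\,\xi^0=\mathrm{id}_j$. 5. (ii, explicit form) There is a linear map $\tau:A\to k$ satisfying the conditions in 3 and also $\tau(xh)=\tau(h\,\sqcap^R\sqcap^L(x))$ for all $x\in R$ and $h\in A$. 6. (iii') There is a linear map $\tau':A\to k$ such that $\tau'(h_1)h_2=\tau'(h_1)\sqcap^R(h_2)$ for all $h\in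 A$, and $\tau'\circ\sqcap^R=\epsilon$ (composition of maps). 7. (iii, duoidal form) There is a normalized right cointegral $\theta$ for $a$: a morphism $\theta:j\circ a\to j$ in $\mathsf{bim}(R\otimes R^{\mathsf{op}})$ such that $(1\circ\eta)\,\xi^0\,\theta=(\theta\circ 1)(1\circ\delta)$, $\xi^0\,\theta=(1\circ\theta)(\xi^0\circ 1)$ and $\theta\,(1\circ\eta)\,\xi^0=\mathrm{id}_j$. 8. (iii, explicit form) There is a linear map $\tau:A\to k$ satisfying the conditions in 6 and also $\tau(h\,\overline\sqcap^L(x))=\tau(\sqcap^L(x)h)$ for all $x\in R$ and $h\in A$. -/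

import Mathlib

open scoped TensorProduct

universe u v

/-- A Frobenius-separability structure on a `k`-algebra `R`: a separability element
`elt = ∑ eᵢ ⊗ fᵢ` of `R ⊗ R` (so `∑ r eᵢ ⊗ fᵢ = ∑ eᵢ ⊗ fᵢ r` and `∑ eᵢ fᵢ = 1`) together with a
Frobenius functional `ψ : R → k` (so `∑ ψ(eᵢ) fᵢ = 1 = ∑ eᵢ ψ(fᵢ)`). -/
structure FrobeniusSeparability (k : Type u) (R : Type v) [Field k] [Ring R] [Algebra k R] where
  elt : R ⊗[k] R
  functional : R →ₗ[k] k
  comm : ∀ r : R, (r ⊗ₜ[k] 1) * elt = elt * (1 ⊗ₜ[k] r)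
  mul_elt : LinearMap.mul' k R elt = 1
  functional_left : TensorProduct.lid k R (functional.rTensor R elt) = 1
  functional_right : TensorProduct.rid k R (functional.lTensor R elt) = 1

namespace FrobeniusSeparability

variable {k : Type u} {R : Type v} [Field k] [Ring R] [Algebra k R]
  (F : FrobeniusSeparability k R)

/-- The Nakayama-type map `y ↦ ∑ ψ(y fᵢ) eᵢ`. -/
noncomputable def nakayama : R →ₗ[k] R where
  toFun y := TensorProduct.rid k R ((F.functional ∘ₗ LinearMap.mulLeft k y).lTensor R F.elt)
  map_add' x y := by
    have : F.functional ∘ₗ LinearMap.mulLeft k (x + y) =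
        F.functional ∘ₗ LinearMap.mulLeft k x + F.functional ∘ₗ LinearMap.mulLeft k y := by
      ext z; simp [add_mul]
    rw [this, LinearMap.lTensor_add]; simp
  map_smul' c y := by
    have : F.functional ∘ₗ LinearMap.mulLeft k (c • y) =
        c • (F.functional ∘ₗ LinearMap.mulLeft k y) := by
      ext z; simp
    rw [this, LinearMap.lTensor_smul]; simp

/-- The map `x ↦ ∑ ψ(eᵢ x) fᵢ` (it is the inverse of `nakayama`). -/
noncomputable def nakayamaInv : R →ₗ[k] R where
  toFun x := TensorProduct.lid k R ((F.functional ∘ₗ LinearMap.mulRight k x).rTensor R F.elt)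
  map_add' x y := by
    have : F.functional ∘ₗ LinearMap.mulRight k (x + y) =
        F.functional ∘ₗ LinearMap.mulRight k x + F.functional ∘ₗ LinearMap.mulRight k y := by
      ext z; simp [mul_add]
    rw [this, LinearMap.rTensor_add]; simp
  map_smul' c y := by
    have : F.functional ∘ₗ LinearMap.mulRight k (c • y) =
        c • (F.functional ∘ₗ LinearMap.mulRight k y) := by
      ext z; simp
    rw [this, LinearMap.rTensor_smul]; simp

/-- A finite set of pairs `(eᵢ, fᵢ)` with `elt = ∑ eᵢ ⊗ fᵢ`. -/
noncomputable def idx : Finset (R × R) := (TensorProduct.exists_finset F.elt).choose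

lemma elt_eq : F.elt = ∑ i ∈ F.idx, i.1 ⊗ₜ[k] i.2 :=
  (TensorProduct.exists_finset F.elt).choose_spec

variable {V : Type*} [AddCommGroup V] [Module k V]

lemma lift_elt (B : R →ₗ[k] R →ₗ[k] V) :
    TensorProduct.lift B F.elt = ∑ i ∈ F.idx, B i.1 i.2 := by
  rw [F.elt_eq]; simp

lemma sum_comm (B : R →ₗ[k] R →ₗ[k] V) (r : R) :
    ∑ i ∈ F.idx, B (r * i.1) i.2 = ∑ i ∈ F.idx, B i.1 (i.2 * r) := by
  have h := congrArg (TensorProduct.lift B) (F.comm r)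
  rw [F.elt_eq] at h
  simpa [Finset.mul_sum, Finset.sum_mul] using h

lemma sum_mul : ∑ i ∈ F.idx, i.1 * i.2 = 1 := by
  have h := F.mul_elt
  rw [F.elt_eq] at h
  simpa using h

lemma sum_left : ∑ i ∈ F.idx, F.functional i.1 • i.2 = 1 := by
  have h := F.functional_left
  rw [F.elt_eq] at h
  simpa using h

lemma sum_right : ∑ i ∈ F.idx, F.functional i.2 • i.1 = 1 := by
  have h := F.functional_right
  rw [F.elt_eq] at h
  simpa using h

lemma nakayama_apply (y : R) :
    F.nakayama y = ∑ i ∈ F.idx, F.functional (y * i.2) • i.1 := by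
  change TensorProduct.rid k R ((F.functional ∘ₗ LinearMap.mulLeft k y).lTensor R F.elt) = _
  rw [F.elt_eq]; simp

lemma nakayamaInv_apply (x : R) :
    F.nakayamaInv x = ∑ i ∈ F.idx, F.functional (i.1 * x) • i.2 := by
  change TensorProduct.lid k R ((F.functional ∘ₗ LinearMap.mulRight k x).rTensor R F.elt) = _
  rw [F.elt_eq]; simp

/-- `∑ ψ(x eᵢ) fᵢ = x`. -/
lemma sum_functional_mul_left (x : R) :
    ∑ i ∈ F.idx, F.functional (x * i.1) • i.2 = x := by
  have h := F.sum_comm ((LinearMap.lsmul k R).comp F.functional) x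
  have h2 : ∑ i ∈ F.idx, F.functional i.1 • (i.2 * x) = x := by
    simpa [Finset.sum_mul] using congrArg (· * x) F.sum_left
  simpa [h2] using h

/-- `∑ ψ(fᵢ x) eᵢ = x`. -/
lemma sum_functional_mul_right (x : R) :
    ∑ i ∈ F.idx, F.functional (i.2 * x) • i.1 = x := by
  have h := F.sum_comm ((LinearMap.lsmul k R).comp F.functional).flip x
  have h2 : ∑ i ∈ F.idx, F.functional i.2 • (x * i.1) = x := by
    simpa [Finset.mul_sum] using congrArg (x * ·) F.sum_right
  simpa [h2] using h.symm

lemma functional_mul_nakayama (f y : R) :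
    F.functional (f * F.nakayama y) = F.functional (y * f) := by
  have h := F.sum_comm
    ((LinearMap.mul k k).compl₁₂ F.functional (F.functional ∘ₗ LinearMap.mulLeft k y)) f
  simp only [LinearMap.compl₁₂_apply, LinearMap.mul_apply', LinearMap.comp_apply,
    LinearMap.mulLeft_apply] at h
  have h2 : ∑ i ∈ F.idx, F.functional i.1 * F.functional (y * (i.2 * f))
      = F.functional (y * f) := by
    have := congrArg (fun z => F.functional (y * (z * f))) F.sum_left
    simpa [Finset.sum_mul, Finset.mul_sum] using this
  rw [h2] at h
  rw [← h, nakayama_apply]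
  simp [Finset.mul_sum, mul_comm]

lemma functional_nondeg {a b : R} (h : ∀ f, F.functional (f * a) = F.functional (f * b)) :
    a = b := by
  rw [← F.sum_functional_mul_right a, ← F.sum_functional_mul_right b]
  simp [h]

lemma nakayama_mul (x y : R) : F.nakayama (x * y) = F.nakayama x * F.nakayama y := by
  apply F.functional_nondeg
  intro f
  rw [functional_mul_nakayama, ← mul_assoc, functional_mul_nakayama, ← mul_assoc,
    functional_mul_nakayama, mul_assoc]

lemma nakayama_one : F.nakayama 1 = 1 := by
  rw [nakayama_apply]; simpa using F.sum_right

lemma nakayamaInv_nakayama (y : R) : F.nakayamaInv (F.nakayama y) = y := by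
  rw [nakayamaInv_apply]
  simp only [functional_mul_nakayama]
  exact F.sum_functional_mul_left y

lemma nakayama_nakayamaInv (x : R) : F.nakayama (F.nakayamaInv x) = x := by
  apply F.functional_nondeg
  intro f
  rw [functional_mul_nakayama, nakayamaInv_apply]
  have := congrArg (fun z => F.functional (z * x)) (F.sum_functional_mul_right f)
  simp only [Finset.sum_mul, map_sum, smul_mul_assoc, map_smul, smul_eq_mul] at this ⊢
  rw [← this]
  simp [mul_comm]

lemma nakayamaInv_mul (x y : R) :
    F.nakayamaInv (x * y) = F.nakayamaInv x * F.nakayamaInv y := by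
  conv_lhs => rw [← F.nakayama_nakayamaInv x, ← F.nakayama_nakayamaInv y, ← nakayama_mul]
  rw [nakayamaInv_nakayama]

lemma nakayamaInv_one : F.nakayamaInv 1 = 1 := by
  rw [nakayamaInv_apply]; simpa using F.sum_left

/-- `∑ eᵢ x ⊗ fᵢ = ∑ eᵢ ⊗ x' fᵢ` with `x' = nakayamaInv x`. -/
lemma sum_nakayamaInv (B : R →ₗ[k] R →ₗ[k] V) (x : R) :
    ∑ i ∈ F.idx, B (i.1 * x) i.2 = ∑ i ∈ F.idx, B i.1 (F.nakayamaInv x * i.2) := by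
  have h1 : ∀ i : R × R, B (i.1 * x) i.2 =
      ∑ j ∈ F.idx, F.functional (j.2 * (i.1 * x)) • B j.1 i.2 := by
    intro i
    conv_lhs => rw [← F.sum_functional_mul_right (i.1 * x)]
    simp
  simp only [h1]
  rw [Finset.sum_comm]
  refine Finset.sum_congr rfl fun j _ => ?_
  have h2 := F.sum_comm
    ((LinearMap.lsmul k V).compl₁₂ (F.functional ∘ₗ LinearMap.mulRight k x) (B j.1)) j.2
  simp only [LinearMap.compl₁₂_apply, LinearMap.lsmul_apply, LinearMap.comp_apply,
    LinearMap.mulRight_apply] at h2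
  simp only [← mul_assoc, h2]
  rw [nakayamaInv_apply]
  simp [Finset.sum_mul]

lemma sum_snd_mul_nakayamaInv : ∑ i ∈ F.idx, i.2 * F.nakayamaInv i.1 = 1 := by
  simp only [nakayamaInv_apply, Finset.mul_sum]
  rw [Finset.sum_comm]
  rw [← F.sum_mul]
  refine Finset.sum_congr rfl fun j _ => ?_
  conv_rhs => rw [← F.sum_functional_mul_left j.1]
  simp [Finset.sum_mul]

end FrobeniusSeparability

/-- A bimodule over the enveloping algebra `R ⊗ Rᵒᵖ` (with the same action of `k` on both sides):
`lact s m` is `s · m` and `ract s m` is `m · s`. The Frobenius-separability structure `F` on `R` is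
recorded in the type since the monoidal structure below is formulated in terms of it. -/
structure EnvBimod {k : Type u} {R : Type v} [Field k] [Ring R] [Algebra k R]
    (F : FrobeniusSeparability k R) where
  carrier : Type v
  [addCommGroup : AddCommGroup carrier]
  [module : Module k carrier]
  lact : R ⊗[k] Rᵐᵒᵖ →ₗ[k] carrier →ₗ[k] carrier
  ract : R ⊗[k] Rᵐᵒᵖ →ₗ[k] carrier →ₗ[k] carrier
  lact_one : ∀ m, lact 1 m = m
  lact_mul : ∀ s t m, lact (s * t) m = lact s (lact t m)
  ract_one : ∀ m, ract 1 m = m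
  ract_mul : ∀ s t m, ract (s * t) m = ract t (ract s m)
  lact_ract : ∀ s t m, lact s (ract t m) = ract t (lact s m)

namespace EnvBimod

variable {k : Type u} {R : Type v} [Field k] [Ring R] [Algebra k R]
  {F : FrobeniusSeparability k R}

attribute [instance] EnvBimod.addCommGroup EnvBimod.module

/-- `m ↦ (x ⊗ 1) · m`. -/
def l₁ (M : EnvBimod F) (x : R) : M.carrier →ₗ[k] M.carrier := M.lact (x ⊗ₜ[k] 1)
/-- `m ↦ (1 ⊗ y) · m`. -/
def l₂ (M : EnvBimod F) (y : R) : M.carrier →ₗ[k] M.carrier :=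
  M.lact (1 ⊗ₜ[k] MulOpposite.op y)
/-- `m ↦ m · (x ⊗ 1)`. -/
def r₁ (M : EnvBimod F) (x : R) : M.carrier →ₗ[k] M.carrier := M.ract (x ⊗ₜ[k] 1)
/-- `m ↦ m · (1 ⊗ y)`. -/
def r₂ (M : EnvBimod F) (y : R) : M.carrier →ₗ[k] M.carrier :=
  M.ract (1 ⊗ₜ[k] MulOpposite.op y)

section basic

variable (M : EnvBimod F) (x y : R) (m : M.carrier)

lemma lact_tmul : M.lact (x ⊗ₜ[k] MulOpposite.op y) m = M.l₁ x (M.l₂ y m) := by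
  rw [l₁, l₂, ← M.lact_mul]; simp

lemma ract_tmul : M.ract (x ⊗ₜ[k] MulOpposite.op y) m = M.r₁ x (M.r₂ y m) := by
  rw [r₁, r₂, ← M.ract_mul]; simp

@[simp] lemma l₁_one : M.l₁ 1 m = m := M.lact_one m
@[simp] lemma l₂_one : M.l₂ 1 m = m := M.lact_one m
@[simp] lemma r₁_one : M.r₁ 1 m = m := M.ract_one m
@[simp] lemma r₂_one : M.r₂ 1 m = m := M.ract_one m

lemma l₁_mul : M.l₁ (x * y) m = M.l₁ x (M.l₁ y m) := by
  simp only [l₁, ← M.lact_mul]; simp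
lemma l₂_mul : M.l₂ (x * y) m = M.l₂ y (M.l₂ x m) := by
  simp only [l₂, ← M.lact_mul]; simp
lemma r₁_mul : M.r₁ (x * y) m = M.r₁ y (M.r₁ x m) := by
  simp only [r₁, ← M.ract_mul]; simp
lemma r₂_mul : M.r₂ (x * y) m = M.r₂ x (M.r₂ y m) := by
  simp only [r₂, ← M.ract_mul]; simp
lemma l₂_l₁ : M.l₂ y (M.l₁ x m) = M.l₁ x (M.l₂ y m) := by
  simp only [l₁, l₂, ← M.lact_mul]; simp
lemma r₂_r₁ : M.r₂ y (M.r₁ x m) = M.r₁ x (M.r₂ y m) := by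
  simp only [r₁, r₂, ← M.ract_mul]; simp
lemma r₁_l₁ : M.r₁ y (M.l₁ x m) = M.l₁ x (M.r₁ y m) := (M.lact_ract _ _ _).symm
lemma r₁_l₂ : M.r₁ y (M.l₂ x m) = M.l₂ x (M.r₁ y m) := (M.lact_ract _ _ _).symm
lemma r₂_l₁ : M.r₂ y (M.l₁ x m) = M.l₁ x (M.r₂ y m) := (M.lact_ract _ _ _).symm
lemma r₂_l₂ : M.r₂ y (M.l₂ x m) = M.l₂ x (M.r₂ y m) := (M.lact_ract _ _ _).symm

/-- `l₁`, `l₂`, `r₁`, `r₂` as linear functions of the ring element. -/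
def l₁Lin : R →ₗ[k] M.carrier →ₗ[k] M.carrier :=
  M.lact ∘ₗ (TensorProduct.mk k R Rᵐᵒᵖ).flip 1
/-- see `l₁Lin`. -/
def l₂Lin : R →ₗ[k] M.carrier →ₗ[k] M.carrier :=
  M.lact ∘ₗ TensorProduct.mk k R Rᵐᵒᵖ 1 ∘ₗ (MulOpposite.opLinearEquiv k).toLinearMap
/-- see `l₁Lin`. -/
def r₁Lin : R →ₗ[k] M.carrier →ₗ[k] M.carrier :=
  M.ract ∘ₗ (TensorProduct.mk k R Rᵐᵒᵖ).flip 1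
/-- see `l₁Lin`. -/
def r₂Lin : R →ₗ[k] M.carrier →ₗ[k] M.carrier :=
  M.ract ∘ₗ TensorProduct.mk k R Rᵐᵒᵖ 1 ∘ₗ (MulOpposite.opLinearEquiv k).toLinearMap

@[simp] lemma l₁Lin_apply : M.l₁Lin x = M.l₁ x := rfl
@[simp] lemma l₂Lin_apply : M.l₂Lin x = M.l₂ x := rfl
@[simp] lemma r₁Lin_apply : M.r₁Lin x = M.r₁ x := rfl
@[simp] lemma r₂Lin_apply : M.r₂Lin x = M.r₂ x := rfl

end basic

section ofActions

variable {V : Type v} [AddCommGroup V] [Module k V]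

/-- The linear extension of `x ⊗ y ↦ f x ∘ g y`. -/
def comboAct (f g : R →ₗ[k] V →ₗ[k] V) : R ⊗[k] Rᵐᵒᵖ →ₗ[k] V →ₗ[k] V :=
  TensorProduct.lift ((LinearMap.mul k (Module.End k V)).compl₁₂ f
    (g ∘ₗ (MulOpposite.opLinearEquiv k).symm.toLinearMap))

@[simp] lemma comboAct_tmul (f g : R →ₗ[k] V →ₗ[k] V) (x : R) (y : Rᵐᵒᵖ) (m : V) :
    comboAct f g (x ⊗ₜ y) m = f x (g y.unop m) := rfl

/-- A bimodule from four pairwise commuting actions: `f₁ x m = (x ⊗ 1) · m`,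
`f₂ y m = (1 ⊗ y) · m`, `g₁ x m = m · (x ⊗ 1)` and `g₂ y m = m · (1 ⊗ y)`. -/
def ofActions (f₁ f₂ g₁ g₂ : R →ₗ[k] V →ₗ[k] V)
    (f₁_one : ∀ m, f₁ 1 m = m) (f₂_one : ∀ m, f₂ 1 m = m)
    (g₁_one : ∀ m, g₁ 1 m = m) (g₂_one : ∀ m, g₂ 1 m = m)
    (f₁_mul : ∀ x y m, f₁ (x * y) m = f₁ x (f₁ y m))
    (f₂_mul : ∀ x y m, f₂ (x * y) m = f₂ y (f₂ x m))
    (g₁_mul : ∀ x y m, g₁ (x * y) m = g₁ y (g₁ x m))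
    (g₂_mul : ∀ x y m, g₂ (x * y) m = g₂ x (g₂ y m))
    (hff : ∀ x y m, f₂ y (f₁ x m) = f₁ x (f₂ y m))
    (hgg : ∀ x y m, g₂ y (g₁ x m) = g₁ x (g₂ y m))
    (h11 : ∀ x y m, g₁ y (f₁ x m) = f₁ x (g₁ y m))
    (h12 : ∀ x y m, g₁ y (f₂ x m) = f₂ x (g₁ y m))
    (h21 : ∀ x y m, g₂ y (f₁ x m) = f₁ x (g₂ y m))
    (h22 : ∀ x y m, g₂ y (f₂ x m) = f₂ x (g₂ y m)) : EnvBimod F where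
  carrier := V
  lact := comboAct f₁ f₂
  ract := comboAct g₁ g₂
  lact_one m := by rw [Algebra.TensorProduct.one_def]; simp [f₁_one, f₂_one]
  ract_one m := by rw [Algebra.TensorProduct.one_def]; simp [g₁_one, g₂_one]
  lact_mul s t m := by
    induction s with
    | zero => simp
    | add a b ha hb => simp [add_mul, ha, hb]
    | tmul x y =>
      induction t with
      | zero => simp
      | add a b ha hb => simp [mul_add, ha, hb]
      | tmul x' y' => simp [f₁_mul, f₂_mul, hff]
  ract_mul s t m := by
    induction s with
    | zero => simp
    | add a b ha hb => simp [add_mul, ha, hb]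
    | tmul x y =>
      induction t with
      | zero => simp
      | add a b ha hb => simp [mul_add, ha, hb]
      | tmul x' y' => simp [g₁_mul, g₂_mul, hgg]
  lact_ract s t m := by
    induction s with
    | zero => simp
    | add a b ha hb => simp [ha, hb]
    | tmul x y =>
      induction t with
      | zero => simp
      | add a b ha hb => simp only [map_add, LinearMap.add_apply, ha, hb]
      | tmul x' y' => simp [h11, h12, h21, h22]

end ofActions

/-- A homomorphism of `R ⊗ Rᵒᵖ`-bimodules. -/
@[ext] structure Hom (M N : EnvBimod F) where
  lin : M.carrier →ₗ[k] N.carrier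
  map_lact : ∀ s m, lin (M.lact s m) = N.lact s (lin m)
  map_ract : ∀ s m, lin (M.ract s m) = N.ract s (lin m)

open CategoryTheory

/-- The category of `R ⊗ Rᵒᵖ`-bimodules. -/
instance : Category (EnvBimod F) where
  Hom := Hom
  id M := ⟨LinearMap.id, fun _ _ => rfl, fun _ _ => rfl⟩
  comp f g := ⟨g.lin ∘ₗ f.lin, fun s m => by simp [f.map_lact, g.map_lact],
    fun s m => by simp [f.map_ract, g.map_ract]⟩

section hom

variable {M N P : EnvBimod F}

@[ext] lemma hom_ext {f g : M ⟶ N} (h : ∀ m, f.lin m = g.lin m) : f = g :=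
  Hom.ext (LinearMap.ext h)

@[simp] lemma id_lin (m : M.carrier) : (𝟙 M : M ⟶ M).lin m = m := rfl
@[simp] lemma comp_lin (f : M ⟶ N) (g : N ⟶ P) (m : M.carrier) :
    (f ≫ g).lin m = g.lin (f.lin m) := rfl

lemma map_l₁ (f : M ⟶ N) (x : R) (m : M.carrier) : f.lin (M.l₁ x m) = N.l₁ x (f.lin m) :=
  f.map_lact _ _
lemma map_l₂ (f : M ⟶ N) (x : R) (m : M.carrier) : f.lin (M.l₂ x m) = N.l₂ x (f.lin m) :=
  f.map_lact _ _
lemma map_r₁ (f : M ⟶ N) (x : R) (m : M.carrier) : f.lin (M.r₁ x m) = N.r₁ x (f.lin m) :=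
  f.map_ract _ _
lemma map_r₂ (f : M ⟶ N) (x : R) (m : M.carrier) : f.lin (M.r₂ x m) = N.r₂ x (f.lin m) :=
  f.map_ract _ _

/-- A linear map compatible with the four basic actions is a bimodule homomorphism. -/
def homMk (f : M.carrier →ₗ[k] N.carrier)
    (h₁ : ∀ x m, f (M.l₁ x m) = N.l₁ x (f m)) (h₂ : ∀ x m, f (M.l₂ x m) = N.l₂ x (f m))
    (h₃ : ∀ x m, f (M.r₁ x m) = N.r₁ x (f m)) (h₄ : ∀ x m, f (M.r₂ x m) = N.r₂ x (f m)) :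
    M ⟶ N :=
  Hom.mk f
    (fun s m => by
      induction s with
      | zero => simp
      | add a b ha hb => simp [ha, hb]
      | tmul x y =>
        obtain ⟨y, rfl⟩ := MulOpposite.op_surjective y
        rw [lact_tmul, lact_tmul, h₁, h₂])
    (fun s m => by
      induction s with
      | zero => simp
      | add a b ha hb => simp [ha, hb]
      | tmul x y =>
        obtain ⟨y, rfl⟩ := MulOpposite.op_surjective y
        rw [ract_tmul, ract_tmul, h₃, h₄])

@[simp] lemma homMk_lin (f : M.carrier →ₗ[k] N.carrier) (h₁ h₂ h₃ h₄) :
    Hom.lin (homMk (M := M) (N := N) f h₁ h₂ h₃ h₄) = f := rfl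

/-- An isomorphism from mutually inverse homomorphisms. -/
def isoMk (f : M ⟶ N) (g : N ⟶ M) (h₁ : ∀ m, g.lin (f.lin m) = m)
    (h₂ : ∀ n, f.lin (g.lin n) = n) : M ≅ N where
  hom := f
  inv := g
  hom_inv_id := hom_ext h₁
  inv_hom_id := hom_ext h₂

end hom

section circ

variable (M N : EnvBimod F)

/-- The idempotent `m ⊗ n ↦ ∑ (eᵢ ⊗ 1) m (eⱼ ⊗ 1) ⊗ (1 ⊗ fᵢ) n (1 ⊗ fⱼ)`
on the vector space `M ⊗ N`. -/
noncomputable def proj : M.carrier ⊗[k] N.carrier →ₗ[k] M.carrier ⊗[k] N.carrier :=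
  TensorProduct.homTensorHomMap (RingHom.id k) M.carrier N.carrier M.carrier N.carrier
      (TensorProduct.map M.l₁Lin N.l₂Lin F.elt) ∘ₗ
    TensorProduct.homTensorHomMap (RingHom.id k) M.carrier N.carrier M.carrier N.carrier
      (TensorProduct.map M.r₁Lin N.r₂Lin F.elt)

lemma proj_eq : proj M N = (∑ i ∈ F.idx, TensorProduct.map (M.l₁ i.1) (N.l₂ i.2)) ∘ₗ
    (∑ j ∈ F.idx, TensorProduct.map (M.r₁ j.1) (N.r₂ j.2)) := by
  rw [proj, F.elt_eq]
  simp [TensorProduct.homTensorHomMap_apply]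

lemma proj_tmul (m : M.carrier) (n : N.carrier) : proj M N (m ⊗ₜ n) =
    ∑ i ∈ F.idx, ∑ j ∈ F.idx,
      M.l₁ i.1 (M.r₁ j.1 m) ⊗ₜ[k] N.l₂ i.2 (N.r₂ j.2 n) := by
  rw [proj_eq]
  simp only [LinearMap.comp_apply, LinearMap.sum_apply, TensorProduct.map_tmul, map_sum]
  exact Finset.sum_comm

variable {M N}

lemma proj_l₁ (x : R) (m : M.carrier) (n : N.carrier) :
    proj M N (M.l₁ x m ⊗ₜ n) = proj M N (m ⊗ₜ N.l₂ (F.nakayamaInv x) n) := by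
  rw [proj_tmul, proj_tmul, Finset.sum_comm]
  conv_rhs => rw [Finset.sum_comm]
  refine Finset.sum_congr rfl fun j _ => ?_
  have h := F.sum_nakayamaInv ((TensorProduct.mk k M.carrier N.carrier).compl₁₂
    (M.l₁Lin.flip (M.r₁ j.1 m)) (N.l₂Lin.flip (N.r₂ j.2 n))) x
  simpa [l₁_mul, l₂_mul, r₁_l₁, r₂_l₂] using h

lemma proj_r₁ (x : R) (m : M.carrier) (n : N.carrier) :
    proj M N (M.r₁ x m ⊗ₜ n) = proj M N (m ⊗ₜ N.r₂ x n) := by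
  rw [proj_tmul, proj_tmul]
  refine Finset.sum_congr rfl fun i _ => ?_
  have h := F.sum_comm ((TensorProduct.mk k M.carrier N.carrier).compl₁₂
    (M.r₁Lin.flip (M.l₁ i.1 m)) (N.r₂Lin.flip (N.l₂ i.2 n))) x
  simpa [r₁_mul, r₂_mul, r₁_l₁, r₂_l₂] using h

lemma proj_avg (m : M.carrier) (n : N.carrier) :
    ∑ i ∈ F.idx, ∑ j ∈ F.idx, proj M N
      (M.l₁ i.1 (M.r₁ j.1 m) ⊗ₜ[k] N.l₂ i.2 (N.r₂ j.2 n)) = proj M N (m ⊗ₜ n) := by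
  have h1 : ∀ i j : R × R, proj M N (M.l₁ i.1 (M.r₁ j.1 m) ⊗ₜ[k] N.l₂ i.2 (N.r₂ j.2 n)) =
      proj M N (m ⊗ₜ[k] N.l₂Lin (i.2 * F.nakayamaInv i.1) (N.r₂Lin (j.1 * j.2) n)) := by
    intro i j
    rw [proj_l₁, proj_r₁]
    simp [l₂_mul, r₂_mul, r₂_l₂]
  simp only [h1]
  simp only [← map_sum, ← TensorProduct.tmul_sum, ← LinearMap.sum_apply, F.sum_mul,
    F.sum_snd_mul_nakayamaInv]
  simp

lemma proj_proj (t : M.carrier ⊗[k] N.carrier) : proj M N (proj M N t) = proj M N t := by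
  induction t with
  | zero => simp
  | add a b ha hb => simp [ha, hb]
  | tmul m n =>
    refine (congrArg _ (proj_tmul M N m n)).trans ?_
    simp only [map_sum]
    exact proj_avg m n

variable (M N) in
/-- The vector space of `M ∘ N`: the subspace of `M ⊗ N` that is the image of `proj`. -/
noncomputable abbrev circSpace : Submodule k (M.carrier ⊗[k] N.carrier) := LinearMap.range (proj M N)

/-- The class `m ∘ n` of `m ⊗ n` under the canonical epimorphism `M ⊗ N → M ∘ N`. -/
noncomputable def cmk (m : M.carrier) (n : N.carrier) : circSpace M N :=
  (proj M N).rangeRestrict (m ⊗ₜ n)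

lemma rangeRestrict_tmul (m : M.carrier) (n : N.carrier) :
    (proj M N).rangeRestrict (m ⊗ₜ n) = cmk m n := rfl

lemma cmk_val (m : M.carrier) (n : N.carrier) :
    (circSpace M N).subtype (cmk m n) = proj M N (m ⊗ₜ n) := rfl

lemma rangeRestrict_proj (t : M.carrier ⊗[k] N.carrier) :
    (proj M N).rangeRestrict (proj M N t) = (proj M N).rangeRestrict t :=
  Subtype.ext (proj_proj t)

lemma rangeRestrict_subtype (t : circSpace M N) :
    (proj M N).rangeRestrict ((circSpace M N).subtype t) = t := by
  obtain ⟨_, s, rfl⟩ := t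
  exact rangeRestrict_proj s

lemma subtype_eq (t : circSpace M N) :
    proj M N ((circSpace M N).subtype t) = (circSpace M N).subtype t :=
  congrArg (circSpace M N).subtype (rangeRestrict_subtype t)

lemma cmk_induction {p : circSpace M N → Prop} (t : circSpace M N) (h0 : p 0)
    (hadd : ∀ a b, p a → p b → p (a + b)) (hc : ∀ m n, p (cmk m n)) : p t := by
  rw [← rangeRestrict_subtype t]
  generalize (circSpace M N).subtype t = s
  induction s with
  | zero => simpa using h0
  | add a b ha hb => simpa using hadd _ _ ha hb
  | tmul m n => exact hc m n

lemma circ_ext {V : Type*} [AddCommGroup V] [Module k V] {f g : circSpace M N →ₗ[k] V}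
    (h : ∀ m n, f (cmk m n) = g (cmk m n)) : f = g := by
  ext1 t
  induction t using cmk_induction with
  | h0 => simp
  | hadd a b ha hb => simp [ha, hb]
  | hc m n => exact h m n

variable (M N) in
/-- `cmk` as a bilinear map. -/
noncomputable def cmkLin : M.carrier →ₗ[k] N.carrier →ₗ[k] circSpace M N :=
  (TensorProduct.mk k M.carrier N.carrier).compr₂ (proj M N).rangeRestrict

@[simp] lemma cmkLin_apply (m : M.carrier) (n : N.carrier) : cmkLin M N m n = cmk m n := rfl

lemma cmk_avg (m : M.carrier) (n : N.carrier) :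
    ∑ i ∈ F.idx, ∑ j ∈ F.idx, cmk (M.l₁ i.1 (M.r₁ j.1 m)) (N.l₂ i.2 (N.r₂ j.2 n)) = cmk m n := by
  apply Subtype.ext
  rw [AddSubmonoidClass.coe_finsetSum]
  simp only [AddSubmonoidClass.coe_finsetSum]
  exact proj_avg m n

lemma cmk_l₁ (x : R) (m : M.carrier) (n : N.carrier) :
    cmk (M.l₁ x m) n = cmk m (N.l₂ (F.nakayamaInv x) n) := Subtype.ext (proj_l₁ x m n)

lemma cmk_r₁ (x : R) (m : M.carrier) (n : N.carrier) :
    cmk (M.r₁ x m) n = cmk m (N.r₂ x n) := Subtype.ext (proj_r₁ x m n)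

/-- The map `M ∘ N → M' ∘ N'` induced by linear maps `f : M → M'` and `g : N → N'`. -/
noncomputable def circMap {M' N' : EnvBimod F} (f : M.carrier →ₗ[k] M'.carrier)
    (g : N.carrier →ₗ[k] N'.carrier) : circSpace M N →ₗ[k] circSpace M' N' :=
  (proj M' N').rangeRestrict ∘ₗ TensorProduct.map f g ∘ₗ (circSpace M N).subtype

lemma circMap_cmk {M' N' : EnvBimod F} (f : M.carrier →ₗ[k] M'.carrier)
    (g : N.carrier →ₗ[k] N'.carrier)
    (hf₁ : ∀ x m, f (M.l₁ x m) = M'.l₁ x (f m)) (hf₂ : ∀ x m, f (M.r₁ x m) = M'.r₁ x (f m))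
    (hg₁ : ∀ x n, g (N.l₂ x n) = N'.l₂ x (g n)) (hg₂ : ∀ x n, g (N.r₂ x n) = N'.r₂ x (g n))
    (m : M.carrier) (n : N.carrier) : circMap f g (cmk m n) = cmk (f m) (g n) := by
  rw [← cmk_avg (f m) (g n)]
  simp only [circMap, LinearMap.comp_apply, cmk_val, proj_tmul, map_sum, TensorProduct.map_tmul,
    hf₁, hf₂, hg₁, hg₂, rangeRestrict_tmul]

/-- The family of maps `id ∘ φ x` on `M ∘ N`. -/
noncomputable def actRight (φ : R →ₗ[k] N.carrier →ₗ[k] N.carrier) :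
    R →ₗ[k] circSpace M N →ₗ[k] circSpace M N where
  toFun x := circMap LinearMap.id (φ x)
  map_add' x y := by
    simp only [circMap, map_add, TensorProduct.map_add_right, LinearMap.add_comp,
      LinearMap.comp_add]
  map_smul' c x := by
    simp only [circMap, map_smul, TensorProduct.map_smul_right, LinearMap.smul_comp,
      LinearMap.comp_smul, RingHom.id_apply]

/-- The family of maps `φ x ∘ id` on `M ∘ N`. -/
noncomputable def actLeft (φ : R →ₗ[k] M.carrier →ₗ[k] M.carrier) :
    R →ₗ[k] circSpace M N →ₗ[k] circSpace M N where
  toFun x := circMap (φ x) LinearMap.id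
  map_add' x y := by
    simp only [circMap, map_add, TensorProduct.map_add_left, LinearMap.add_comp,
      LinearMap.comp_add]
  map_smul' c x := by
    simp only [circMap, map_smul, TensorProduct.map_smul_left, LinearMap.smul_comp,
      LinearMap.comp_smul, RingHom.id_apply]

lemma act_l₁ (x : R) (m : M.carrier) (n : N.carrier) :
    actRight N.l₁Lin x (cmk m n) = cmk m (N.l₁ x n) :=
  circMap_cmk _ _ (fun _ _ => rfl) (fun _ _ => rfl) (fun y n => (l₂_l₁ N x y n).symm)
    (fun y n => (r₂_l₁ N x y n).symm) m n

lemma act_r₁ (x : R) (m : M.carrier) (n : N.carrier) :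
    actRight N.r₁Lin x (cmk m n) = cmk m (N.r₁ x n) :=
  circMap_cmk _ _ (fun _ _ => rfl) (fun _ _ => rfl) (fun y n => (r₁_l₂ N y x n))
    (fun y n => (r₂_r₁ N x y n).symm) m n

lemma act_l₂ (x : R) (m : M.carrier) (n : N.carrier) :
    actLeft M.l₂Lin x (cmk m n) = cmk (M.l₂ x m) n :=
  circMap_cmk _ _ (fun y n => (l₂_l₁ M y x n)) (fun y n => (r₁_l₂ M x y n).symm)
    (fun _ _ => rfl) (fun _ _ => rfl) m n

lemma act_r₂ (x : R) (m : M.carrier) (n : N.carrier) :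
    actLeft M.r₂Lin x (cmk m n) = cmk (M.r₂ x m) n :=
  circMap_cmk _ _ (fun y n => (r₂_l₁ M y x n)) (fun y n => (r₂_r₁ M y x n))
    (fun _ _ => rfl) (fun _ _ => rfl) m n

section extLemmas

variable {V W : Type*} [AddCommGroup V] [Module k V] [AddCommGroup W] [Module k W]

lemma circ_ext₁ {f g : circSpace M N →ₗ[k] V} (h : ∀ m n, f (cmk m n) = g (cmk m n)) (t) :
    f t = g t := by rw [circ_ext h]

lemma circ_ext₂ {f : circSpace M N →ₗ[k] V} {g₁ : W →ₗ[k] V} {g₂ : circSpace M N →ₗ[k] W}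
    (h : ∀ m n, f (cmk m n) = g₁ (g₂ (cmk m n))) (t) : f t = g₁ (g₂ t) :=
  circ_ext₁ (f := f) (g := g₁ ∘ₗ g₂) h t

lemma circ_ext₃ {V' : Type*} [AddCommGroup V'] [Module k V']
    {f₁ : V' →ₗ[k] V} {f₂ : circSpace M N →ₗ[k] V'} {g₁ : W →ₗ[k] V}
    {g₂ : circSpace M N →ₗ[k] W}
    (h : ∀ m n, f₁ (f₂ (cmk m n)) = g₁ (g₂ (cmk m n))) (t) : f₁ (f₂ t) = g₁ (g₂ t) :=
  circ_ext₁ (f := f₁ ∘ₗ f₂) (g := g₁ ∘ₗ g₂) h t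

lemma circ_ext₀ {f : circSpace M N →ₗ[k] circSpace M N} (h : ∀ m n, f (cmk m n) = cmk m n) (t) :
    f t = t := circ_ext₁ (f := f) (g := LinearMap.id) h t

end extLemmas

variable (M N) in
/-- The bimodule `M ∘ N`, with actions
`(x ⊗ y) · (m ∘ n) · (x' ⊗ y') = (1 ⊗ y) m (1 ⊗ y') ∘ (x ⊗ 1) n (x' ⊗ 1)`. -/
noncomputable def circ : EnvBimod F :=
  ofActions (V := circSpace M N) (actRight N.l₁Lin) (actLeft M.l₂Lin) (actRight N.r₁Lin)
    (actLeft M.r₂Lin)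
    (circ_ext₀ fun m n => by rw [act_l₁, l₁_one])
    (circ_ext₀ fun m n => by rw [act_l₂, l₂_one])
    (circ_ext₀ fun m n => by rw [act_r₁, r₁_one])
    (circ_ext₀ fun m n => by rw [act_r₂, r₂_one])
    (fun x y => circ_ext₂ fun m n => by simp only [act_l₁, l₁_mul])
    (fun x y => circ_ext₂ fun m n => by simp only [act_l₂, l₂_mul])
    (fun x y => circ_ext₂ fun m n => by simp only [act_r₁, r₁_mul])
    (fun x y => circ_ext₂ fun m n => by simp only [act_r₂, r₂_mul])
    (fun x y => circ_ext₃ fun m n => by simp only [act_l₁, act_l₂])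
    (fun x y => circ_ext₃ fun m n => by simp only [act_r₁, act_r₂])
    (fun x y => circ_ext₃ fun m n => by simp only [act_l₁, act_r₁, r₁_l₁])
    (fun x y => circ_ext₃ fun m n => by simp only [act_l₂, act_r₁])
    (fun x y => circ_ext₃ fun m n => by simp only [act_l₁, act_r₂])
    (fun x y => circ_ext₃ fun m n => by simp only [act_l₂, act_r₂, r₂_l₂])

end circ

section ofActionsLemmas

variable {V : Type v} [AddCommGroup V] [Module k V] {f₁ f₂ g₁ g₂ : R →ₗ[k] V →ₗ[k] V}
  {a₁ a₂ a₃ a₄ a₅ a₆ a₇ a₈ a₉ a₁₀ a₁₁ a₁₂ a₁₃ a₁₄}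

lemma ofActions_l₁ (x : R) (m : V) :
    (ofActions (F := F) f₁ f₂ g₁ g₂ a₁ a₂ a₃ a₄ a₅ a₆ a₇ a₈ a₉ a₁₀ a₁₁ a₁₂ a₁₃ a₁₄).l₁ x m =
      f₁ x m := congrArg (f₁ x) (a₂ m)

lemma ofActions_l₂ (x : R) (m : V) :
    (ofActions (F := F) f₁ f₂ g₁ g₂ a₁ a₂ a₃ a₄ a₅ a₆ a₇ a₈ a₉ a₁₀ a₁₁ a₁₂ a₁₃ a₁₄).l₂ x m =
      f₂ x m := a₁ (f₂ x m)

lemma ofActions_r₁ (x : R) (m : V) :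
    (ofActions (F := F) f₁ f₂ g₁ g₂ a₁ a₂ a₃ a₄ a₅ a₆ a₇ a₈ a₉ a₁₀ a₁₁ a₁₂ a₁₃ a₁₄).r₁ x m =
      g₁ x m := congrArg (g₁ x) (a₄ m)

lemma ofActions_r₂ (x : R) (m : V) :
    (ofActions (F := F) f₁ f₂ g₁ g₂ a₁ a₂ a₃ a₄ a₅ a₆ a₇ a₈ a₉ a₁₀ a₁₁ a₁₂ a₁₃ a₁₄).r₂ x m =
      g₂ x m := a₃ (g₂ x m)

end ofActionsLemmas

section circAPI

variable (M N : EnvBimod F)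

/-- The inclusion `M ∘ N ↪ M ⊗ N`. -/
noncomputable def incl : (circ M N).carrier →ₗ[k] M.carrier ⊗[k] N.carrier :=
  (circSpace M N).subtype

/-- The canonical epimorphism `M ⊗ N ↠ M ∘ N`. -/
noncomputable def quot : M.carrier ⊗[k] N.carrier →ₗ[k] (circ M N).carrier :=
  (proj M N).rangeRestrict

variable {M N}

/-- The class `m ∘ n` of `m ⊗ n` in `M ∘ N`. -/
noncomputable def tm (m : M.carrier) (n : N.carrier) : (circ M N).carrier := quot M N (m ⊗ₜ n)

lemma quot_tmul (m : M.carrier) (n : N.carrier) : quot M N (m ⊗ₜ n) = tm m n := rfl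

lemma quot_incl (t : (circ M N).carrier) : quot M N (incl M N t) = t := rangeRestrict_subtype t

lemma incl_quot (t : M.carrier ⊗[k] N.carrier) : incl M N (quot M N t) = proj M N t := rfl

lemma incl_tm (m : M.carrier) (n : N.carrier) : incl M N (tm m n) =
    ∑ i ∈ F.idx, ∑ j ∈ F.idx,
      M.l₁ i.1 (M.r₁ j.1 m) ⊗ₜ[k] N.l₂ i.2 (N.r₂ j.2 n) := proj_tmul M N m n

lemma tm_avg (m : M.carrier) (n : N.carrier) :
    ∑ i ∈ F.idx, ∑ j ∈ F.idx, tm (M.l₁ i.1 (M.r₁ j.1 m)) (N.l₂ i.2 (N.r₂ j.2 n)) = tm m n :=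
  cmk_avg m n

lemma tm_l₁ (x : R) (m : M.carrier) (n : N.carrier) :
    tm (M.l₁ x m) n = tm m (N.l₂ (F.nakayamaInv x) n) := cmk_l₁ x m n

lemma tm_r₁ (x : R) (m : M.carrier) (n : N.carrier) :
    tm (M.r₁ x m) n = tm m (N.r₂ x n) := cmk_r₁ x m n

lemma tm_l₂ (x : R) (m : M.carrier) (n : N.carrier) :
    tm m (N.l₂ x n) = tm (M.l₁ (F.nakayama x) m) n := by
  rw [tm_l₁, F.nakayamaInv_nakayama]

lemma tm_add_left (m m' : M.carrier) (n : N.carrier) : tm (m + m') n = tm m n + tm m' n := by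
  simp [tm, TensorProduct.add_tmul]

lemma tm_add_right (m : M.carrier) (n n' : N.carrier) : tm m (n + n') = tm m n + tm m n' := by
  simp [tm, TensorProduct.tmul_add]

lemma tm_zero_left (n : N.carrier) : tm (0 : M.carrier) n = 0 := by simp [tm]

lemma tm_zero_right (m : M.carrier) : tm m (0 : N.carrier) = 0 := by simp [tm]

lemma tm_sum_left {ι : Type*} (s : Finset ι) (m : ι → M.carrier) (n : N.carrier) :
    tm (∑ i ∈ s, m i) n = ∑ i ∈ s, tm (m i) n := by
  simp [tm, TensorProduct.sum_tmul]

lemma tm_sum_right {ι : Type*} (s : Finset ι) (m : M.carrier) (n : ι → N.carrier) :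
    tm m (∑ i ∈ s, n i) = ∑ i ∈ s, tm m (n i) := by
  simp [tm, TensorProduct.tmul_sum]

lemma circ_l₁ (x : R) (m : M.carrier) (n : N.carrier) :
    (circ M N).l₁ x (tm m n) = tm m (N.l₁ x n) :=
  (ofActions_l₁ x _).trans (act_l₁ x m n)

lemma circ_l₂ (x : R) (m : M.carrier) (n : N.carrier) :
    (circ M N).l₂ x (tm m n) = tm (M.l₂ x m) n :=
  (ofActions_l₂ x _).trans (act_l₂ x m n)

lemma circ_r₁ (x : R) (m : M.carrier) (n : N.carrier) :
    (circ M N).r₁ x (tm m n) = tm m (N.r₁ x n) :=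
  (ofActions_r₁ x _).trans (act_r₁ x m n)

lemma circ_r₂ (x : R) (m : M.carrier) (n : N.carrier) :
    (circ M N).r₂ x (tm m n) = tm (M.r₂ x m) n :=
  (ofActions_r₂ x _).trans (act_r₂ x m n)

lemma tm_induction {p : (circ M N).carrier → Prop} (t : (circ M N).carrier) (h0 : p 0)
    (hadd : ∀ a b, p a → p b → p (a + b)) (hc : ∀ m n, p (tm m n)) : p t :=
  cmk_induction t h0 hadd hc

section ext

variable {V W V' : Type*} [AddCommGroup V] [Module k V] [AddCommGroup W] [Module k W]
  [AddCommGroup V'] [Module k V']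

lemma tm_ext₁ {f g : (circ M N).carrier →ₗ[k] V}
    (h : ∀ m n, f (tm m n) = g (tm m n)) (t) : f t = g t := by
  induction t using tm_induction with
  | h0 => simp
  | hadd a b ha hb => simp [ha, hb]
  | hc m n => exact h m n

lemma tm_ext₃ {f₁ : V' →ₗ[k] V} {f₂ : (circ M N).carrier →ₗ[k] V'} {g₁ : W →ₗ[k] V}
    {g₂ : (circ M N).carrier →ₗ[k] W}
    (h : ∀ m n, f₁ (f₂ (tm m n)) = g₁ (g₂ (tm m n))) (t) : f₁ (f₂ t) = g₁ (g₂ t) :=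
  tm_ext₁ (f := f₁ ∘ₗ f₂) (g := g₁ ∘ₗ g₂) h t

end ext

/-- Homomorphisms out of `M ∘ N` that agree on all `m ∘ n` are equal. -/
lemma circ_hom_ext {P : EnvBimod F} {f g : circ M N ⟶ P}
    (h : ∀ m n, f.lin (tm m n) = g.lin (tm m n)) : f = g :=
  hom_ext (tm_ext₁ h)

/-- Homomorphisms out of `(M ∘ N) ∘ P` that agree on all `(m ∘ n) ∘ p` are equal. -/
lemma circ_hom_ext₃ {P Q : EnvBimod F} {f g : circ (circ M N) P ⟶ Q}
    (h : ∀ m n p, f.lin (tm (tm m n) p) = g.lin (tm (tm m n) p)) : f = g :=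
  circ_hom_ext fun t p => by
    induction t using tm_induction with
    | h0 => simp [tm_zero_left]
    | hadd a b ha hb => simp only [tm_add_left, map_add, ha, hb]
    | hc m n => exact h m n p

/-- The linear map underlying `f ∘ g : M ∘ N → M' ∘ N'`: the restriction of `f ⊗ g`. -/
noncomputable def circHomLin {M' N' : EnvBimod F} (f : M ⟶ M') (g : N ⟶ N') :
    (circ M N).carrier →ₗ[k] (circ M' N').carrier :=
  quot M' N' ∘ₗ TensorProduct.map f.lin g.lin ∘ₗ incl M N

lemma circHomLin_tm {M' N' : EnvBimod F} (f : M ⟶ M') (g : N ⟶ N') (m : M.carrier)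
    (n : N.carrier) : circHomLin f g (tm m n) = tm (f.lin m) (g.lin n) := by
  rw [← tm_avg (f.lin m) (g.lin n)]
  simp only [circHomLin, LinearMap.comp_apply, incl_tm, map_sum, TensorProduct.map_tmul,
    map_l₁, map_l₂, map_r₁, map_r₂, quot_tmul]

/-- The homomorphism `f ∘ g : M ∘ N → M' ∘ N'`. -/
noncomputable def circHom {M' N' : EnvBimod F} (f : M ⟶ M') (g : N ⟶ N') :
    circ M N ⟶ circ M' N' :=
  homMk (circHomLin f g)
    (fun x => tm_ext₃ fun m n => by simp only [circ_l₁, circHomLin_tm, map_l₁])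
    (fun x => tm_ext₃ fun m n => by simp only [circ_l₂, circHomLin_tm, map_l₂])
    (fun x => tm_ext₃ fun m n => by simp only [circ_r₁, circHomLin_tm, map_r₁])
    (fun x => tm_ext₃ fun m n => by simp only [circ_r₂, circHomLin_tm, map_r₂])

lemma circHom_tm {M' N' : EnvBimod F} (f : M ⟶ M') (g : N ⟶ N') (m : M.carrier)
    (n : N.carrier) : (circHom f g).lin (tm m n) = tm (f.lin m) (g.lin n) :=
  circHomLin_tm f g m n

variable (M N) in
/-- The map underlying the associator: the restriction of `(M ⊗ N) ⊗ P ≅ M ⊗ (N ⊗ P)`. -/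
noncomputable def assocLin (P : EnvBimod F) :
    (circ (circ M N) P).carrier →ₗ[k] (circ M (circ N P)).carrier :=
  quot M (circ N P) ∘ₗ (quot N P).lTensor M.carrier ∘ₗ
    (TensorProduct.assoc k M.carrier N.carrier P.carrier).toLinearMap ∘ₗ
    (incl M N).rTensor P.carrier ∘ₗ incl (circ M N) P

lemma assocLin_tm {P : EnvBimod F} (m : M.carrier) (n : N.carrier) (p : P.carrier) :
    assocLin M N P (tm (tm m n) p) = tm m (tm n p) := by
  have h : ∀ (n : N.carrier) (p : P.carrier),
      quot M (circ N P) ((quot N P).lTensor M.carrier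
        (TensorProduct.assoc k M.carrier N.carrier P.carrier
          ((incl M N).rTensor P.carrier (tm m n ⊗ₜ p)))) = tm m (tm n p) := by
    intro n p
    rw [← tm_avg m (tm n p)]
    simp only [LinearMap.rTensor_tmul, incl_tm, TensorProduct.sum_tmul, map_sum,
      TensorProduct.assoc_tmul, LinearMap.lTensor_tmul, quot_tmul, circ_l₂, circ_r₂]
  simp only [assocLin, LinearMap.comp_apply, LinearEquiv.coe_coe]
  rw [incl_tm]
  simp only [map_sum, circ_l₁, circ_r₁, h]
  conv_rhs => rw [← tm_avg n p]
  simp only [tm_sum_right]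

variable (M N) in
/-- The map underlying the inverse of the associator. -/
noncomputable def assocInvLin (P : EnvBimod F) :
    (circ M (circ N P)).carrier →ₗ[k] (circ (circ M N) P).carrier :=
  quot (circ M N) P ∘ₗ (quot M N).rTensor P.carrier ∘ₗ
    (TensorProduct.assoc k M.carrier N.carrier P.carrier).symm.toLinearMap ∘ₗ
    (incl N P).lTensor M.carrier ∘ₗ incl M (circ N P)

lemma assocInvLin_tm {P : EnvBimod F} (m : M.carrier) (n : N.carrier) (p : P.carrier) :
    assocInvLin M N P (tm m (tm n p)) = tm (tm m n) p := by
  have h : ∀ (m : M.carrier) (n : N.carrier),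
      quot (circ M N) P ((quot M N).rTensor P.carrier
        ((TensorProduct.assoc k M.carrier N.carrier P.carrier).symm
          ((incl N P).lTensor M.carrier (m ⊗ₜ tm n p)))) = tm (tm m n) p := by
    intro m n
    rw [← tm_avg (tm m n) p]
    simp only [LinearMap.lTensor_tmul, incl_tm, TensorProduct.tmul_sum, map_sum,
      TensorProduct.assoc_symm_tmul, LinearMap.rTensor_tmul, quot_tmul, circ_l₁, circ_r₁]
  simp only [assocInvLin, LinearMap.comp_apply, LinearEquiv.coe_coe]
  rw [incl_tm]
  simp only [map_sum, circ_l₂, circ_r₂, h]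
  conv_rhs => rw [← tm_avg m n]
  simp only [tm_sum_left]

section ext

variable {P : EnvBimod F} {V W V' : Type*} [AddCommGroup V] [Module k V] [AddCommGroup W]
  [Module k W] [AddCommGroup V'] [Module k V']

lemma tm_ext_left {f₁ : V' →ₗ[k] V} {f₂ : (circ (circ M N) P).carrier →ₗ[k] V'} {g₁ : W →ₗ[k] V}
    {g₂ : (circ (circ M N) P).carrier →ₗ[k] W}
    (h : ∀ m n p, f₁ (f₂ (tm (tm m n) p)) = g₁ (g₂ (tm (tm m n) p))) (t) :
    f₁ (f₂ t) = g₁ (g₂ t) :=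
  tm_ext₃ (fun s p => by
    induction s using tm_induction with
    | h0 => simp only [tm_zero_left, map_zero]
    | hadd a b ha hb => simp only [tm_add_left, map_add, ha, hb]
    | hc m n => exact h m n p) t

lemma tm_ext_right {f₁ : V' →ₗ[k] V} {f₂ : (circ M (circ N P)).carrier →ₗ[k] V'}
    {g₁ : W →ₗ[k] V} {g₂ : (circ M (circ N P)).carrier →ₗ[k] W}
    (h : ∀ m n p, f₁ (f₂ (tm m (tm n p))) = g₁ (g₂ (tm m (tm n p)))) (t) :
    f₁ (f₂ t) = g₁ (g₂ t) :=
  tm_ext₃ (fun m s => by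
    induction s using tm_induction with
    | h0 => simp only [tm_zero_right, map_zero]
    | hadd a b ha hb => simp only [tm_add_right, map_add, ha, hb]
    | hc n p => exact h m n p) t

end ext

variable (M N) in
/-- The associator `(M ∘ N) ∘ P ≅ M ∘ (N ∘ P)`. -/
noncomputable def circAssoc (P : EnvBimod F) : circ (circ M N) P ≅ circ M (circ N P) :=
  isoMk
    (homMk (M := circ (circ M N) P) (N := circ M (circ N P)) (assocLin M N P)
      (fun x => tm_ext_left fun m n p => by simp only [circ_l₁, assocLin_tm])
      (fun x => tm_ext_left fun m n p => by simp only [circ_l₂, assocLin_tm])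
      (fun x => tm_ext_left fun m n p => by simp only [circ_r₁, assocLin_tm])
      (fun x => tm_ext_left fun m n p => by simp only [circ_r₂, assocLin_tm]))
    (homMk (M := circ M (circ N P)) (N := circ (circ M N) P) (assocInvLin M N P)
      (fun x => tm_ext_right fun m n p => by simp only [circ_l₁, assocInvLin_tm])
      (fun x => tm_ext_right fun m n p => by simp only [circ_l₂, assocInvLin_tm])
      (fun x => tm_ext_right fun m n p => by simp only [circ_r₁, assocInvLin_tm])
      (fun x => tm_ext_right fun m n p => by simp only [circ_r₂, assocInvLin_tm]))
    (tm_ext_left (g₁ := LinearMap.id) (g₂ := LinearMap.id) fun m n p => by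
      simp only [homMk_lin, assocLin_tm, assocInvLin_tm, LinearMap.id_apply])
    (tm_ext_right (g₁ := LinearMap.id) (g₂ := LinearMap.id) fun m n p => by
      simp only [homMk_lin, assocLin_tm, assocInvLin_tm, LinearMap.id_apply])

lemma circAssoc_hom_tm {P : EnvBimod F} (m : M.carrier) (n : N.carrier) (p : P.carrier) :
    (circAssoc M N P).hom.lin (tm (tm m n) p) = tm m (tm n p) := assocLin_tm m n p

lemma circAssoc_inv_tm {P : EnvBimod F} (m : M.carrier) (n : N.carrier) (p : P.carrier) :
    (circAssoc M N P).inv.lin (tm m (tm n p)) = tm (tm m n) p := assocInvLin_tm m n p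

end circAPI

section unit

/-- Both actions of `R` on a factor of `R ⊗ R`: `onFst f x` is `p ⊗ q ↦ f x p ⊗ q`. -/
noncomputable def onFst (f : R →ₗ[k] R →ₗ[k] R) : R →ₗ[k] (R ⊗[k] R) →ₗ[k] (R ⊗[k] R) :=
  LinearMap.rTensorHom R ∘ₗ f

/-- `onSnd f x` is `p ⊗ q ↦ p ⊗ f x q`. -/
noncomputable def onSnd (f : R →ₗ[k] R →ₗ[k] R) : R →ₗ[k] (R ⊗[k] R) →ₗ[k] (R ⊗[k] R) :=
  LinearMap.lTensorHom R ∘ₗ f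

@[simp] lemma onFst_tmul (f : R →ₗ[k] R →ₗ[k] R) (x p q : R) :
    onFst f x (p ⊗ₜ q) = f x p ⊗ₜ q := rfl
@[simp] lemma onSnd_tmul (f : R →ₗ[k] R →ₗ[k] R) (x p q : R) :
    onSnd f x (p ⊗ₜ q) = p ⊗ₜ f x q := rfl

section ext

variable {V W : Type*} [AddCommGroup V] [Module k V] [AddCommGroup W] [Module k W]

lemma tmul_ext₀ {f : R ⊗[k] R →ₗ[k] R ⊗[k] R} (h : ∀ p q, f (p ⊗ₜ q) = p ⊗ₜ q) (t) : f t = t :=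
  LinearMap.congr_fun (TensorProduct.ext' (h := LinearMap.id) h) t

lemma tmul_ext₂ {f : R ⊗[k] R →ₗ[k] V} {g₁ : W →ₗ[k] V} {g₂ : R ⊗[k] R →ₗ[k] W}
    (h : ∀ p q, f (p ⊗ₜ q) = g₁ (g₂ (p ⊗ₜ q))) (t) : f t = g₁ (g₂ t) :=
  LinearMap.congr_fun (TensorProduct.ext' (h := g₁ ∘ₗ g₂) h) t

lemma tmul_ext₃ {V' : Type*} [AddCommGroup V'] [Module k V'] {f₁ : V' →ₗ[k] V}
    {f₂ : R ⊗[k] R →ₗ[k] V'} {g₁ : W →ₗ[k] V} {g₂ : R ⊗[k] R →ₗ[k] W}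
    (h : ∀ p q, f₁ (f₂ (p ⊗ₜ q)) = g₁ (g₂ (p ⊗ₜ q))) (t) : f₁ (f₂ t) = g₁ (g₂ t) :=
  LinearMap.congr_fun (TensorProduct.ext' (g := f₁ ∘ₗ f₂) (h := g₁ ∘ₗ g₂) h) t

end ext

variable (F) in
/-- The unit `i` of the product `∘`: the vector space `R ⊗ R` with the actions
`(x ⊗ y) · (p ⊗ q) · (x' ⊗ y') = y' p x' ⊗ x q ∑ ψ(y fᵢ) eᵢ`. -/
noncomputable def circUnit : EnvBimod F :=
  ofActions (V := R ⊗[k] R) (onSnd (LinearMap.mul k R))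
    (onSnd ((LinearMap.mul k R).flip ∘ₗ F.nakayama))
    (onFst (LinearMap.mul k R).flip) (onFst (LinearMap.mul k R))
    (tmul_ext₀ fun p q => by simp)
    (tmul_ext₀ fun p q => by simp [F.nakayama_one])
    (tmul_ext₀ fun p q => by simp)
    (tmul_ext₀ fun p q => by simp)
    (fun x y => tmul_ext₂ fun p q => by simp [mul_assoc])
    (fun x y => tmul_ext₂ fun p q => by simp [F.nakayama_mul, mul_assoc])
    (fun x y => tmul_ext₂ fun p q => by simp [mul_assoc])
    (fun x y => tmul_ext₂ fun p q => by simp [mul_assoc])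
    (fun x y => tmul_ext₃ fun p q => by simp [mul_assoc])
    (fun x y => tmul_ext₃ fun p q => by simp [mul_assoc])
    (fun x y => tmul_ext₃ fun p q => by simp)
    (fun x y => tmul_ext₃ fun p q => by simp)
    (fun x y => tmul_ext₃ fun p q => by simp)
    (fun x y => tmul_ext₃ fun p q => by simp)

variable (F) in
/-- `p ⊗ q` as an element of the unit `i`. -/
noncomputable def ut (p q : R) : (circUnit F).carrier := (p ⊗ₜ[k] q : R ⊗[k] R)

lemma circUnit_l₁ (x p q : R) : (circUnit F).l₁ x (ut F p q) = ut F p (x * q) :=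
  ofActions_l₁ x _
lemma circUnit_l₂ (x p q : R) :
    (circUnit F).l₂ x (ut F p q) = ut F p (q * F.nakayama x) := ofActions_l₂ x _
lemma circUnit_r₁ (x p q : R) : (circUnit F).r₁ x (ut F p q) = ut F (p * x) q :=
  ofActions_r₁ x _
lemma circUnit_r₂ (x p q : R) : (circUnit F).r₂ x (ut F p q) = ut F (x * p) q :=
  ofActions_r₂ x _

variable (F) in
/-- The functional `ψ ⊗ ψ : i → k`. -/
noncomputable def unitFunctional : (circUnit F).carrier →ₗ[k] k :=
  (LinearMap.mul' k k ∘ₗ TensorProduct.map F.functional F.functional : R ⊗[k] R →ₗ[k] k)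

lemma unitFunctional_ut (p q : R) :
    unitFunctional F (ut F p q) = F.functional p * F.functional q := by
  exact rfl

lemma ut_induction {p : (circUnit F).carrier → Prop} (t) (h0 : p 0)
    (hadd : ∀ a b, p a → p b → p (a + b)) (hc : ∀ x y, p (ut F x y)) : p t :=
  TensorProduct.induction_on t h0 hc hadd

variable (M : EnvBimod F)

/-- The map underlying the left unitor: the restriction of `ψ ⊗ ψ ⊗ id`. -/
noncomputable def leftUnitLin : (circ (circUnit F) M).carrier →ₗ[k] M.carrier :=
  (TensorProduct.lid k M.carrier).toLinearMap ∘ₗ (unitFunctional F).rTensor M.carrier ∘ₗ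
    incl (circUnit F) M

/-- The map underlying the right unitor: the restriction of `id ⊗ ψ ⊗ ψ`. -/
noncomputable def rightUnitLin : (circ M (circUnit F)).carrier →ₗ[k] M.carrier :=
  (TensorProduct.rid k M.carrier).toLinearMap ∘ₗ (unitFunctional F).lTensor M.carrier ∘ₗ
    incl M (circUnit F)

variable {M}

lemma leftUnitLin_tm (p q : R) (m : M.carrier) :
    leftUnitLin M (tm (ut F p q) m) = M.l₂ (F.nakayamaInv q) (M.r₂ p m) := by
  have h1 : M.l₂ (F.nakayamaInv q) = ∑ i ∈ F.idx, F.functional (i.1 * q) • M.l₂ i.2 := by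
    rw [F.nakayamaInv_apply, ← l₂Lin_apply, map_sum]
    simp
  have h2 : M.r₂ p = ∑ j ∈ F.idx, F.functional (p * j.1) • M.r₂ j.2 := by
    conv_lhs => rw [← F.sum_functional_mul_left p, ← r₂Lin_apply, map_sum]
    simp
  rw [h1, h2]
  simp only [leftUnitLin, LinearMap.comp_apply, LinearEquiv.coe_coe, incl_tm, map_sum,
    LinearMap.rTensor_tmul, circUnit_l₁, circUnit_r₁, unitFunctional_ut,
    TensorProduct.lid_tmul, LinearMap.sum_apply, LinearMap.smul_apply, map_smul]
  rw [Finset.sum_comm]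
  refine Finset.sum_congr rfl fun j _ => ?_
  rw [Finset.smul_sum]
  refine Finset.sum_congr rfl fun i _ => ?_
  simp only [smul_smul]

lemma rightUnitLin_tm (p q : R) (m : M.carrier) :
    rightUnitLin M (tm m (ut F p q)) = M.l₁ q (M.r₁ p m) := by
  have h1 : M.l₁ q = ∑ i ∈ F.idx, F.functional (i.2 * q) • M.l₁ i.1 := by
    conv_lhs => rw [← F.sum_functional_mul_right q, ← l₁Lin_apply, map_sum]
    simp
  have h2 : M.r₁ p = ∑ j ∈ F.idx, F.functional (j.2 * p) • M.r₁ j.1 := by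
    conv_lhs => rw [← F.sum_functional_mul_right p, ← r₁Lin_apply, map_sum]
    simp
  rw [h1, h2]
  simp only [rightUnitLin, LinearMap.comp_apply, LinearEquiv.coe_coe, incl_tm, map_sum,
    LinearMap.lTensor_tmul, circUnit_l₂, circUnit_r₂, unitFunctional_ut,
    TensorProduct.rid_tmul, LinearMap.sum_apply, LinearMap.smul_apply, map_smul,
    F.functional_mul_nakayama]
  rw [Finset.sum_comm]
  refine Finset.sum_congr rfl fun j _ => ?_
  rw [Finset.smul_sum]
  refine Finset.sum_congr rfl fun i _ => ?_
  simp only [smul_smul]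

lemma tm_ext_unit_left {V W V' : Type*} [AddCommGroup V] [Module k V] [AddCommGroup W]
    [Module k W] [AddCommGroup V'] [Module k V'] {f₁ : V' →ₗ[k] V}
    {f₂ : (circ (circUnit F) M).carrier →ₗ[k] V'} {g₁ : W →ₗ[k] V}
    {g₂ : (circ (circUnit F) M).carrier →ₗ[k] W}
    (h : ∀ p q m, f₁ (f₂ (tm (ut F p q) m)) = g₁ (g₂ (tm (ut F p q) m))) (t) :
    f₁ (f₂ t) = g₁ (g₂ t) :=
  tm_ext₃ (fun s m => by
    induction s using ut_induction with
    | h0 => simp only [tm_zero_left, map_zero]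
    | hadd a b ha hb => simp only [tm_add_left, map_add, ha, hb]
    | hc p q => exact h p q m) t

lemma tm_ext_unit_right {V W V' : Type*} [AddCommGroup V] [Module k V] [AddCommGroup W]
    [Module k W] [AddCommGroup V'] [Module k V'] {f₁ : V' →ₗ[k] V}
    {f₂ : (circ M (circUnit F)).carrier →ₗ[k] V'} {g₁ : W →ₗ[k] V}
    {g₂ : (circ M (circUnit F)).carrier →ₗ[k] W}
    (h : ∀ p q m, f₁ (f₂ (tm m (ut F p q))) = g₁ (g₂ (tm m (ut F p q)))) (t) :
    f₁ (f₂ t) = g₁ (g₂ t) :=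
  tm_ext₃ (fun m s => by
    induction s using ut_induction with
    | h0 => simp only [tm_zero_right, map_zero]
    | hadd a b ha hb => simp only [tm_add_right, map_add, ha, hb]
    | hc p q => exact h p q m) t

/-- The homomorphism `i ∘ M → M`. -/
noncomputable def leftUnitHom (M : EnvBimod F) : circ (circUnit F) M ⟶ M :=
  homMk (leftUnitLin M)
    (fun x => tm_ext_unit_left fun p q m => by
      simp only [circ_l₁, leftUnitLin_tm, r₂_l₁, l₂_l₁])
    (fun x => tm_ext_unit_left fun p q m => by
      simp only [circ_l₂, circUnit_l₂, leftUnitLin_tm, F.nakayamaInv_mul,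
        F.nakayamaInv_nakayama, l₂_mul])
    (fun x => tm_ext_unit_left fun p q m => by
      simp only [circ_r₁, leftUnitLin_tm, r₂_r₁, r₁_l₂])
    (fun x => tm_ext_unit_left fun p q m => by
      simp only [circ_r₂, circUnit_r₂, leftUnitLin_tm, r₂_mul, r₂_l₂])

/-- The homomorphism `M ∘ i → M`. -/
noncomputable def rightUnitHom (M : EnvBimod F) : circ M (circUnit F) ⟶ M :=
  homMk (rightUnitLin M)
    (fun x => tm_ext_unit_right fun p q m => by
      simp only [circ_l₁, circUnit_l₁, rightUnitLin_tm, l₁_mul])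
    (fun x => tm_ext_unit_right fun p q m => by
      simp only [circ_l₂, rightUnitLin_tm, r₁_l₂, l₂_l₁])
    (fun x => tm_ext_unit_right fun p q m => by
      simp only [circ_r₁, circUnit_r₁, rightUnitLin_tm, r₁_mul, r₁_l₁])
    (fun x => tm_ext_unit_right fun p q m => by
      simp only [circ_r₂, rightUnitLin_tm, r₂_r₁, r₂_l₁])

lemma leftUnitHom_tm (p q : R) (m : M.carrier) :
    (leftUnitHom M).lin (tm (ut F p q) m) = M.l₂ (F.nakayamaInv q) (M.r₂ p m) :=
  leftUnitLin_tm p q m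

lemma rightUnitHom_tm (p q : R) (m : M.carrier) :
    (rightUnitHom M).lin (tm m (ut F p q)) = M.l₁ q (M.r₁ p m) := rightUnitLin_tm p q m

/-- The homomorphism `M → i ∘ M`, `m ↦ (1 ⊗ 1) ∘ m`. -/
noncomputable def leftUnitInv (M : EnvBimod F) : M ⟶ circ (circUnit F) M :=
  homMk (quot (circUnit F) M ∘ₗ TensorProduct.mk k (circUnit F).carrier M.carrier (ut F 1 1))
    (fun x m => (circ_l₁ x _ _).symm)
    (fun x m => by
      refine (tm_l₂ x _ m).trans (Eq.trans ?_ (circ_l₂ x _ _).symm)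
      simp only [circUnit_l₁, circUnit_l₂, one_mul, mul_one])
    (fun x m => (circ_r₁ x _ _).symm)
    (fun x m => by
      refine (tm_r₁ x _ m).symm.trans (Eq.trans ?_ (circ_r₂ x _ _).symm)
      simp only [circUnit_r₁, circUnit_r₂, one_mul, mul_one])

/-- The homomorphism `M → M ∘ i`, `m ↦ m ∘ (1 ⊗ 1)`. -/
noncomputable def rightUnitInv (M : EnvBimod F) : M ⟶ circ M (circUnit F) :=
  homMk (quot M (circUnit F) ∘ₗ
      (TensorProduct.mk k M.carrier (circUnit F).carrier).flip (ut F 1 1))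
    (fun x m => by
      refine (tm_l₁ x m _).trans (Eq.trans ?_ (circ_l₁ x _ _).symm)
      simp only [circUnit_l₁, circUnit_l₂, one_mul, mul_one, F.nakayama_nakayamaInv])
    (fun x m => (circ_l₂ x _ _).symm)
    (fun x m => by
      refine (tm_r₁ x m _).trans (Eq.trans ?_ (circ_r₁ x _ _).symm)
      simp only [circUnit_r₁, circUnit_r₂, one_mul, mul_one])
    (fun x m => (circ_r₂ x _ _).symm)

lemma leftUnitInv_lin (m : M.carrier) : (leftUnitInv M).lin m = tm (ut F 1 1) m := rfl
lemma rightUnitInv_lin (m : M.carrier) : (rightUnitInv M).lin m = tm m (ut F 1 1) := rfl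

/-- The left unitor `i ∘ M ≅ M`. -/
noncomputable def circLeftUnitor (M : EnvBimod F) : circ (circUnit F) M ≅ M :=
  isoMk (leftUnitHom M) (leftUnitInv M)
    (tm_ext_unit_left (g₁ := LinearMap.id) (g₂ := LinearMap.id) fun p q m => by
      rw [leftUnitHom_tm, leftUnitInv_lin, tm_l₂, F.nakayama_nakayamaInv, ← tm_r₁,
        r₁_l₁, circUnit_r₁, circUnit_l₁]
      simp)
    (fun m => by rw [leftUnitInv_lin, leftUnitHom_tm, F.nakayamaInv_one]; simp)

/-- The right unitor `M ∘ i ≅ M`. -/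
noncomputable def circRightUnitor (M : EnvBimod F) : circ M (circUnit F) ≅ M :=
  isoMk (rightUnitHom M) (rightUnitInv M)
    (tm_ext_unit_right (g₁ := LinearMap.id) (g₂ := LinearMap.id) fun p q m => by
      rw [rightUnitHom_tm, rightUnitInv_lin, tm_l₁, tm_r₁, r₂_l₂,
        circUnit_r₂, circUnit_l₂, F.nakayama_nakayamaInv]
      simp)
    (fun m => by rw [rightUnitInv_lin, rightUnitHom_tm]; simp)

end unit

/-- The monoidal category `(bim(R ⊗ Rᵒᵖ), ∘, i)`. -/
noncomputable instance : MonoidalCategory (EnvBimod F) where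
  tensorObj := circ
  whiskerLeft M _ _ g := circHom (𝟙 M) g
  whiskerRight f N := circHom f (𝟙 N)
  tensorHom f g := circHom f g
  tensorUnit := circUnit F
  associator M N P := circAssoc M N P
  leftUnitor := circLeftUnitor
  rightUnitor := circRightUnitor
  tensorHom_def f g := circ_hom_ext fun m n => by
    simp only [comp_lin, circHom_tm, id_lin]
  id_tensorHom_id M N := circ_hom_ext fun m n => by
    simp only [circHom_tm, id_lin]
  tensorHom_comp_tensorHom f g f' g' := circ_hom_ext fun m n => by
    simp only [comp_lin, circHom_tm]
  whiskerLeft_id M N := circ_hom_ext fun m n => by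
    simp only [circHom_tm, id_lin]
  id_whiskerRight M N := circ_hom_ext fun m n => by
    simp only [circHom_tm, id_lin]
  associator_naturality f g h := circ_hom_ext₃ fun m n p => by
    simp only [comp_lin, circHom_tm, circAssoc_hom_tm]
  leftUnitor_naturality f := circ_hom_ext fun t m => by
    induction t using ut_induction with
    | h0 => simp only [tm_zero_left, map_zero]
    | hadd a b ha hb => simp only [tm_add_left, map_add, ha, hb]
    | hc p q =>
      simp only [comp_lin, circHom_tm, id_lin]
      exact (leftUnitHom_tm p q _).trans ((by rw [map_l₂, map_r₂] : _ = _).trans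
        (congrArg f.lin (leftUnitHom_tm p q m)).symm)
  rightUnitor_naturality f := circ_hom_ext fun m t => by
    induction t using ut_induction with
    | h0 => simp only [tm_zero_right, map_zero]
    | hadd a b ha hb => simp only [tm_add_right, map_add, ha, hb]
    | hc p q =>
      simp only [comp_lin, circHom_tm, id_lin]
      exact (rightUnitHom_tm p q _).trans ((by rw [map_l₁, map_r₁] : _ = _).trans
        (congrArg f.lin (rightUnitHom_tm p q m)).symm)
  pentagon M N P Q := circ_hom_ext fun t q => by
    induction t using tm_induction with
    | h0 => simp only [tm_zero_left, map_zero]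
    | hadd a b ha hb => simp only [tm_add_left, map_add, ha, hb]
    | hc t p =>
      induction t using tm_induction with
      | h0 => simp only [tm_zero_left, map_zero]
      | hadd a b ha hb => simp only [tm_add_left, map_add, ha, hb]
      | hc m n => simp only [comp_lin, circHom_tm, circAssoc_hom_tm, id_lin]
  triangle M N := circ_hom_ext fun t n => by
    induction t using tm_induction with
    | h0 => simp only [tm_zero_left, map_zero]
    | hadd a b ha hb => simp only [tm_add_left, map_add, ha, hb]
    | hc m t =>
      induction t using ut_induction with
      | h0 => simp only [tm_zero_right, tm_zero_left, map_zero]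
      | hadd a b ha hb => simp only [tm_add_right, tm_add_left, map_add, ha, hb]
      | hc p q =>
        simp only [comp_lin, circHom_tm, circAssoc_hom_tm, id_lin]
        refine (congrArg (tm m) (leftUnitHom_tm p q n)).trans
          (Eq.trans ?_ (congrArg (tm · n) (rightUnitHom_tm p q m)).symm)
        rw [tm_l₁, tm_r₁, r₂_l₂]

section bulletUnit

variable (F) in
/-- The bimodule `j`: the algebra `R ⊗ Rᵒᵖ` with the actions given by multiplication,
`(x ⊗ y) · (p ⊗ q) · (x' ⊗ y') = x p x' ⊗ y' q y`. -/
noncomputable def bulletUnit : EnvBimod F :=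
  ofActions (V := R ⊗[k] R) (onFst (LinearMap.mul k R)) (onSnd (LinearMap.mul k R).flip)
    (onFst (LinearMap.mul k R).flip) (onSnd (LinearMap.mul k R))
    (tmul_ext₀ fun p q => by simp)
    (tmul_ext₀ fun p q => by simp)
    (tmul_ext₀ fun p q => by simp)
    (tmul_ext₀ fun p q => by simp)
    (fun x y => tmul_ext₂ fun p q => by simp [mul_assoc])
    (fun x y => tmul_ext₂ fun p q => by simp [mul_assoc])
    (fun x y => tmul_ext₂ fun p q => by simp [mul_assoc])
    (fun x y => tmul_ext₂ fun p q => by simp [mul_assoc])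
    (fun x y => tmul_ext₃ fun p q => by simp)
    (fun x y => tmul_ext₃ fun p q => by simp)
    (fun x y => tmul_ext₃ fun p q => by simp [mul_assoc])
    (fun x y => tmul_ext₃ fun p q => by simp)
    (fun x y => tmul_ext₃ fun p q => by simp)
    (fun x y => tmul_ext₃ fun p q => by simp [mul_assoc])

variable (F) in
/-- `p ⊗ q` as an element of `j`. -/
noncomputable def jt (p q : R) : (bulletUnit F).carrier := (p ⊗ₜ[k] q : R ⊗[k] R)

lemma bulletUnit_l₁ (x p q : R) : (bulletUnit F).l₁ x (jt F p q) = jt F (x * p) q :=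
  ofActions_l₁ x _
lemma bulletUnit_l₂ (x p q : R) : (bulletUnit F).l₂ x (jt F p q) = jt F p (q * x) :=
  ofActions_l₂ x _
lemma bulletUnit_r₁ (x p q : R) : (bulletUnit F).r₁ x (jt F p q) = jt F (p * x) q :=
  ofActions_r₁ x _
lemma bulletUnit_r₂ (x p q : R) : (bulletUnit F).r₂ x (jt F p q) = jt F p (x * q) :=
  ofActions_r₂ x _

lemma jt_induction {p : (bulletUnit F).carrier → Prop} (t) (h0 : p 0)
    (hadd : ∀ a b, p a → p b → p (a + b)) (hc : ∀ x y, p (jt F x y)) : p t :=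
  TensorProduct.induction_on t h0 hc hadd

variable (F) in
/-- `jt` as a bilinear map. -/
noncomputable def jtLin : R →ₗ[k] R →ₗ[k] (bulletUnit F).carrier := TensorProduct.mk k R R

variable (F) in
/-- `ut` as a bilinear map. -/
noncomputable def utLin : R →ₗ[k] R →ₗ[k] (circUnit F).carrier := TensorProduct.mk k R R

@[simp] lemma jtLin_apply (p q : R) : jtLin F p q = jt F p q := rfl
@[simp] lemma utLin_apply (p q : R) : utLin F p q = ut F p q := rfl

section lift

variable {V : Type*} [AddCommGroup V] [Module k V]

/-- The linear map `j → V` determined by a bilinear map. -/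
noncomputable def jLift (B : R →ₗ[k] R →ₗ[k] V) : (bulletUnit F).carrier →ₗ[k] V :=
  TensorProduct.lift B

@[simp] lemma jLift_jt (B : R →ₗ[k] R →ₗ[k] V) (p q : R) : jLift B (jt F p q) = B p q :=
  TensorProduct.lift.tmul p q

lemma jt_ext₃ {W V' : Type*} [AddCommGroup W] [Module k W] [AddCommGroup V'] [Module k V']
    {f₁ : V' →ₗ[k] V} {f₂ : (bulletUnit F).carrier →ₗ[k] V'} {g₁ : W →ₗ[k] V}
    {g₂ : (bulletUnit F).carrier →ₗ[k] W}
    (h : ∀ p q, f₁ (f₂ (jt F p q)) = g₁ (g₂ (jt F p q))) (t) : f₁ (f₂ t) = g₁ (g₂ t) := by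
  induction t using jt_induction with
  | h0 => simp only [map_zero]
  | hadd a b ha hb => simp only [map_add, ha, hb]
  | hc p q => exact h p q

end lift

/-- `tm` as a bilinear map. -/
noncomputable def tmLin (M N : EnvBimod F) :
    M.carrier →ₗ[k] N.carrier →ₗ[k] (circ M N).carrier :=
  (TensorProduct.mk k M.carrier N.carrier).compr₂ (quot M N)

@[simp] lemma tmLin_apply {M N : EnvBimod F} (m : M.carrier) (n : N.carrier) :
    tmLin M N m n = tm m n := rfl

variable (F) in
/-- The comultiplication `ξ⁰ : j → j ∘ j`, `p ⊗ q ↦ (1 ⊗ q) ∘ (p ⊗ 1)`. -/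
noncomputable def bulletUnitComul : bulletUnit F ⟶ circ (bulletUnit F) (bulletUnit F) :=
  homMk (jLift ((tmLin (bulletUnit F) (bulletUnit F)).compl₁₂ (jtLin F 1) ((jtLin F).flip 1)).flip)
    (fun x => jt_ext₃ fun p q => by
      simp only [bulletUnit_l₁, jLift_jt, LinearMap.flip_apply, LinearMap.compl₁₂_apply,
        jtLin_apply, tmLin_apply, circ_l₁])
    (fun x => jt_ext₃ fun p q => by
      simp only [bulletUnit_l₂, jLift_jt, LinearMap.flip_apply, LinearMap.compl₁₂_apply,
        jtLin_apply, tmLin_apply, circ_l₂])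
    (fun x => jt_ext₃ fun p q => by
      simp only [bulletUnit_r₁, jLift_jt, LinearMap.flip_apply, LinearMap.compl₁₂_apply,
        jtLin_apply, tmLin_apply, circ_r₁])
    (fun x => jt_ext₃ fun p q => by
      simp only [bulletUnit_r₂, jLift_jt, LinearMap.flip_apply, LinearMap.compl₁₂_apply,
        jtLin_apply, tmLin_apply, circ_r₂])

lemma bulletUnitComul_jt (p q : R) :
    (bulletUnitComul F).lin (jt F p q) = tm (jt F 1 q) (jt F p 1) :=
  jLift_jt _ p q

variable (F) in
/-- The bilinear map `(p, q) ↦ ∑ q eᵢ ⊗ p ν(fᵢ)`. -/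
noncomputable def bulletUnitCounitLin : R →ₗ[k] R →ₗ[k] (circUnit F).carrier :=
  ∑ i ∈ F.idx, ((utLin F).compl₁₂ (LinearMap.mulRight k i.1)
    (LinearMap.mulRight k (F.nakayama i.2))).flip

lemma bulletUnitCounitLin_apply (p q : R) :
    bulletUnitCounitLin F p q = ∑ i ∈ F.idx, ut F (q * i.1) (p * F.nakayama i.2) := by
  simp [bulletUnitCounitLin, LinearMap.sum_apply]

variable (F) in
/-- The counit `ξ⁰₀ : j → i`, `p ⊗ q ↦ ∑ q eᵢ ⊗ p ν(fᵢ)`, `ν` being the map `nakayama`. -/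
noncomputable def bulletUnitCounit : bulletUnit F ⟶ circUnit F :=
  homMk (jLift (bulletUnitCounitLin F))
    (fun x => jt_ext₃ fun p q => by
      simp only [bulletUnit_l₁, jLift_jt, bulletUnitCounitLin_apply, map_sum, circUnit_l₁,
        mul_assoc])
    (fun x => jt_ext₃ fun p q => by
      simp only [bulletUnit_l₂, jLift_jt, bulletUnitCounitLin_apply, map_sum, circUnit_l₂]
      have h := F.sum_comm ((utLin F).compl₁₂ (LinearMap.mulLeft k q)
        (LinearMap.mulLeft k p ∘ₗ F.nakayama)) x
      simpa [mul_assoc, F.nakayama_mul] using h)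
    (fun x => jt_ext₃ fun p q => by
      simp only [bulletUnit_r₁, jLift_jt, bulletUnitCounitLin_apply, map_sum, circUnit_r₁]
      have h := F.sum_nakayamaInv ((utLin F).compl₁₂ (LinearMap.mulLeft k q)
        (LinearMap.mulLeft k p ∘ₗ F.nakayama)) x
      simpa [mul_assoc, F.nakayama_mul, F.nakayama_nakayamaInv] using h.symm)
    (fun x => jt_ext₃ fun p q => by
      simp only [bulletUnit_r₂, jLift_jt, bulletUnitCounitLin_apply, map_sum, circUnit_r₂,
        mul_assoc])

lemma bulletUnitCounit_jt (p q : R) : (bulletUnitCounit F).lin (jt F p q) =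
    ∑ i ∈ F.idx, ut F (q * i.1) (p * F.nakayama i.2) :=
  (jLift_jt _ p q).trans (bulletUnitCounitLin_apply p q)

lemma jt_hom_ext {M : EnvBimod F} {f g : bulletUnit F ⟶ M}
    (h : ∀ p q, f.lin (jt F p q) = g.lin (jt F p q)) : f = g :=
  hom_ext fun t => by
    induction t using jt_induction with
    | h0 => simp only [map_zero]
    | hadd a b ha hb => simp only [map_add, ha, hb]
    | hc p q => exact h p q

open MonoidalCategory

lemma whiskerLeft_tm {M N N' : EnvBimod F} (g : N ⟶ N') (m : M.carrier) (n : N.carrier) :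
    (M ◁ g).lin (tm m n) = tm m (g.lin n) := circHom_tm (𝟙 M) g m n

lemma whiskerRight_tm {M M' N : EnvBimod F} (f : M ⟶ M') (m : M.carrier) (n : N.carrier) :
    (f ▷ N).lin (tm m n) = tm (f.lin m) n := circHom_tm f (𝟙 N) m n

lemma associator_hom_tm {M N P : EnvBimod F} (m : M.carrier) (n : N.carrier) (p : P.carrier) :
    (α_ M N P).hom.lin (tm (tm m n) p) = tm m (tm n p) := assocLin_tm m n p

lemma leftUnitor_inv_lin {M : EnvBimod F} (m : M.carrier) :
    (λ_ M).inv.lin m = tm (ut F 1 1) m := rfl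

lemma rightUnitor_inv_lin {M : EnvBimod F} (m : M.carrier) :
    (ρ_ M).inv.lin m = tm m (ut F 1 1) := rfl

/-- The comonoid `(j, ξ⁰, ξ⁰₀)` in `(bim(R ⊗ Rᵒᵖ), ∘, i)`. -/
noncomputable instance : ComonObj (bulletUnit F) where
  counit := bulletUnitCounit F
  comul := bulletUnitComul F
  counit_comul := jt_hom_ext fun p q => by
    refine (congrArg _ (bulletUnitComul_jt p q)).trans
      ((whiskerRight_tm _ _ _).trans (Eq.trans ?_ (leftUnitor_inv_lin _).symm))
    rw [bulletUnitCounit_jt, tm_sum_left]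
    have h : ∀ i : R × R, tm (ut F (q * i.1) (1 * F.nakayama i.2)) (jt F p 1) =
        tm (ut F 1 1) (jtLin F p (q * (i.1 * i.2))) := by
      intro i
      have : ut F (q * i.1) (1 * F.nakayama i.2) =
          (circUnit F).l₁ (F.nakayama i.2) ((circUnit F).r₁ (q * i.1) (ut F 1 1)) := by
        simp only [circUnit_l₁, circUnit_r₁, one_mul, mul_one]
      rw [this, tm_l₁, tm_r₁, r₂_l₂, F.nakayamaInv_nakayama, bulletUnit_r₂, bulletUnit_l₂]
      simp [mul_assoc]
    simp only [h]
    rw [← tm_sum_right, ← map_sum, ← Finset.mul_sum, F.sum_mul, mul_one, jtLin_apply]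
  comul_counit := jt_hom_ext fun p q => by
    refine (congrArg _ (bulletUnitComul_jt p q)).trans
      ((whiskerLeft_tm _ _ _).trans (Eq.trans ?_ (rightUnitor_inv_lin _).symm))
    rw [bulletUnitCounit_jt, tm_sum_right]
    have h : ∀ i : R × R, tm (jt F 1 q) (ut F (1 * i.1) (p * F.nakayama i.2)) =
        tm ((jtLin F).flip q (p * F.nakayama (i.2 * F.nakayamaInv i.1))) (ut F 1 1) := by
      intro i
      have : ut F (1 * i.1) (p * F.nakayama i.2) =
          (circUnit F).l₂ (F.nakayamaInv p * i.2) ((circUnit F).r₂ i.1 (ut F 1 1)) := by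
        simp only [circUnit_l₂, circUnit_r₂, one_mul, mul_one, F.nakayama_mul,
          F.nakayama_nakayamaInv]
      rw [this, tm_l₂, ← tm_r₁, bulletUnit_l₁, bulletUnit_r₁]
      simp [mul_assoc, F.nakayama_mul, F.nakayama_nakayamaInv]
    simp only [h]
    rw [← tm_sum_left, ← map_sum, ← Finset.mul_sum, ← map_sum, F.sum_snd_mul_nakayamaInv,
      F.nakayama_one, mul_one]
    exact rfl
  comul_assoc := jt_hom_ext fun p q => by
    simp only [comp_lin]
    rw [bulletUnitComul_jt, whiskerLeft_tm, whiskerRight_tm, bulletUnitComul_jt,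
      bulletUnitComul_jt, associator_hom_tm]

end bulletUnit

end EnvBimod

section cointegrals

open CategoryTheory MonoidalCategory

variable {C : Type*} [Category* C] [MonoidalCategory C]

/-- A comonoid `a` in a monoidal category is coseparable if its comultiplication admits a
retraction that is a homomorphism of `a`-bicomodules. -/
def IsCoseparableComonoid (a : C) [ComonObj a] : Prop :=
  ∃ r : a ⊗ a ⟶ a, ComonObj.comul ≫ r = 𝟙 a ∧
    r ≫ ComonObj.comul = ComonObj.comul ▷ a ≫ (α_ a a a).hom ≫ a ◁ r ∧
    r ≫ ComonObj.comul = a ◁ ComonObj.comul ≫ (α_ a a a).inv ≫ r ▷ a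

/-- Let `a` and `j` be comonoids and `η : j ⟶ a`. A morphism `θ : a ⊗ j ⟶ j` is a normalized left
cointegral if it is a homomorphism of left `a`-comodules and right `j`-comodules (`a` coacting on
`j` via `η`) and a retraction of the left `a`-coaction on `j`. -/
structure IsNormalizedLeftCointegral (a j : C) [ComonObj a] [ComonObj j] (η : j ⟶ a)
    (θ : a ⊗ j ⟶ j) : Prop where
  left_colinear : θ ≫ ComonObj.comul ≫ η ▷ j = ComonObj.comul ▷ j ≫ (α_ a a j).hom ≫ a ◁ θ
  right_colinear : θ ≫ ComonObj.comul = a ◁ ComonObj.comul ≫ (α_ a j j).inv ≫ θ ▷ j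
  normalized : ComonObj.comul ≫ η ▷ j ≫ θ = 𝟙 j

/-- Let `a` and `j` be comonoids and `η : j ⟶ a`. A morphism `θ : j ⊗ a ⟶ j` is a normalized right
cointegral if it is a homomorphism of right `a`-comodules and left `j`-comodules (`a` coacting on
`j` via `η`) and a retraction of the right `a`-coaction on `j`. -/
structure IsNormalizedRightCointegral (a j : C) [ComonObj a] [ComonObj j] (η : j ⟶ a)
    (θ : j ⊗ a ⟶ j) : Prop where
  right_colinear : θ ≫ ComonObj.comul ≫ j ◁ η = j ◁ ComonObj.comul ≫ (α_ j a a).inv ≫ θ ▷ a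
  left_colinear : θ ≫ ComonObj.comul = ComonObj.comul ▷ a ≫ (α_ j j a).hom ≫ j ◁ θ
  normalized : ComonObj.comul ≫ j ◁ η ≫ θ = 𝟙 j

end cointegrals

section weak

open Coalgebra

/-- A weak bialgebra over `k`: an algebra and coalgebra `A` whose comultiplication is
multiplicative and which satisfies the weakened compatibility axioms
`Δ²(1) = 1₁ ⊗ 1₂ 1'₁ ⊗ 1'₂ = 1₁ ⊗ 1'₁ 1₂ ⊗ 1'₂` for the unit and
`ε(abc) = ε(a b₁) ε(b₂ c) = ε(a b₂) ε(b₁ c)` for the counit. -/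
class WeakBialgebra (k : Type u) (A : Type v) [Field k] [Ring A] [Algebra k A]
    [Coalgebra k A] : Prop where
  comul_mul : ∀ a b : A, comul (R := k) (a * b) = comul (R := k) a * comul (R := k) b
  comul_one : (comul (R := k)).lTensor A (comul (R := k) (1 : A)) =
    TensorProduct.assoc k A A A (comul (R := k) (1 : A) ⊗ₜ[k] 1) *
      (1 ⊗ₜ[k] comul (R := k) (1 : A))
  comul_one' : (comul (R := k)).lTensor A (comul (R := k) (1 : A)) =
    (1 ⊗ₜ[k] comul (R := k) (1 : A)) *
      TensorProduct.assoc k A A A (comul (R := k) (1 : A) ⊗ₜ[k] 1)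
  counit_mul : ∀ a b c : A, counit (R := k) (a * b * c) =
    LinearMap.mul' k k (TensorProduct.map (counit (R := k)) (counit (R := k))
      ((a ⊗ₜ[k] 1) * comul (R := k) b * (1 ⊗ₜ[k] c)))
  counit_mul' : ∀ a b c : A, counit (R := k) (a * b * c) =
    LinearMap.mul' k k (TensorProduct.map (counit (R := k)) (counit (R := k))
      ((1 ⊗ₜ[k] a) * comul (R := k) b * (c ⊗ₜ[k] 1)))

variable (k : Type u) {A : Type v} [Field k] [Ring A] [Algebra k A] [Coalgebra k A]

/-- `⊓ᴿ : h ↦ 1₁ ε(h 1₂)`. -/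
noncomputable def piR : A →ₗ[k] A :=
  (TensorProduct.rid k A).toLinearMap ∘ₗ (counit (R := k)).lTensor A ∘ₗ
    LinearMap.mulRight k (comul (R := k) (1 : A)) ∘ₗ TensorProduct.mk k A A 1

/-- `⊓̅ᴿ : h ↦ 1₁ ε(1₂ h)`. -/
noncomputable def piRbar : A →ₗ[k] A :=
  (TensorProduct.rid k A).toLinearMap ∘ₗ (counit (R := k)).lTensor A ∘ₗ
    LinearMap.mulLeft k (comul (R := k) (1 : A)) ∘ₗ TensorProduct.mk k A A 1

/-- `⊓ᴸ : h ↦ ε(1₁ h) 1₂`. -/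
noncomputable def piL : A →ₗ[k] A :=
  (TensorProduct.lid k A).toLinearMap ∘ₗ (counit (R := k)).rTensor A ∘ₗ
    LinearMap.mulLeft k (comul (R := k) (1 : A)) ∘ₗ (TensorProduct.mk k A A).flip 1

/-- `⊓̅ᴸ : h ↦ ε(h 1₁) 1₂`. -/
noncomputable def piLbar : A →ₗ[k] A :=
  (TensorProduct.lid k A).toLinearMap ∘ₗ (counit (R := k)).rTensor A ∘ₗ
    LinearMap.mulRight k (comul (R := k) (1 : A)) ∘ₗ (TensorProduct.mk k A A).flip 1

/-- A weak Hopf algebra: a weak bialgebra with an antipode `σ`, a linear map satisfying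
`h₁ σ(h₂) = ⊓ᴸ(h)` and `σ(h₁) h₂ = ⊓ᴿ(h)`. -/
class WeakHopfAlgebra (k : Type u) (A : Type v) [Field k] [Ring A] [Algebra k A]
    [Coalgebra k A] extends WeakBialgebra k A where
  antipode : A →ₗ[k] A
  mul_lTensor_antipode : LinearMap.mul' k A ∘ₗ antipode.lTensor A ∘ₗ comul = piL k
  mul_rTensor_antipode : LinearMap.mul' k A ∘ₗ antipode.rTensor A ∘ₗ comul = piR k

namespace WeakBialgebra

variable (A) in
/-- A finite set of pairs `(uᵢ, vᵢ)` with `Δ(1) = ∑ uᵢ ⊗ vᵢ`. -/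
noncomputable def oneIdx : Finset (A × A) :=
  (TensorProduct.exists_finset (comul (R := k) (1 : A))).choose

variable (A) in
lemma comul_one_eq : comul (R := k) (1 : A) = ∑ i ∈ oneIdx k A, i.1 ⊗ₜ[k] i.2 :=
  (TensorProduct.exists_finset (comul (R := k) (1 : A))).choose_spec

lemma piR_apply (h : A) :
    piR k h = ∑ i ∈ oneIdx k A, counit (R := k) (h * i.2) • i.1 := by
  simp [piR, comul_one_eq, Finset.mul_sum]

lemma piRbar_apply (h : A) :
    piRbar k h = ∑ i ∈ oneIdx k A, counit (R := k) (i.2 * h) • i.1 := by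
  simp [piRbar, comul_one_eq, Finset.sum_mul]

lemma piL_apply (h : A) :
    piL k h = ∑ i ∈ oneIdx k A, counit (R := k) (i.1 * h) • i.2 := by
  simp [piL, comul_one_eq, Finset.sum_mul]

lemma piLbar_apply (h : A) :
    piLbar k h = ∑ i ∈ oneIdx k A, counit (R := k) (h * i.1) • i.2 := by
  simp [piLbar, comul_one_eq, Finset.mul_sum]

variable (A) in
lemma sum_counit_left : ∑ i ∈ oneIdx k A, counit (R := k) i.1 • i.2 = 1 := by
  have h := Coalgebra.rTensor_counit_comul (R := k) (1 : A)
  rw [comul_one_eq] at h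
  simpa using congrArg (TensorProduct.lid k A) h

variable (A) in
lemma sum_counit_right : ∑ i ∈ oneIdx k A, counit (R := k) i.2 • i.1 = 1 := by
  have h := Coalgebra.lTensor_counit_comul (R := k) (1 : A)
  rw [comul_one_eq] at h
  simpa using congrArg (TensorProduct.rid k A) h

section lemmas

variable {V : Type*} [AddCommGroup V] [Module k V]

/-- Coassociativity at `1`, in the form `1₁ ⊗ Δ(1₂) = Δ(1₁) ⊗ 1₂`. -/
lemma sum_coassoc (B : A →ₗ[k] A ⊗[k] A →ₗ[k] V) (B' : A ⊗[k] A →ₗ[k] A →ₗ[k] V)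
    (hB : ∀ a b c, B a (b ⊗ₜ c) = B' (a ⊗ₜ b) c) :
    ∑ i ∈ oneIdx k A, B i.1 (comul i.2) = ∑ i ∈ oneIdx k A, B' (comul i.1) i.2 := by
  have h := congrArg (TensorProduct.lift B) (Coalgebra.coassoc_apply (R := k) (1 : A))
  have h2 : ∀ t : (A ⊗[k] A) ⊗[k] A, TensorProduct.lift B (TensorProduct.assoc k A A A t) =
      TensorProduct.lift B' t := by
    intro t
    refine LinearMap.congr_fun (f := TensorProduct.lift B ∘ₗ
      (TensorProduct.assoc k A A A).toLinearMap) ?_ t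
    apply TensorProduct.ext_threefold
    intro a b c
    simpa using hB a b c
  rw [h2, comul_one_eq] at h
  simpa using h.symm

variable [WeakBialgebra k A]

lemma sum_comul_snd (B : A →ₗ[k] A ⊗[k] A →ₗ[k] V) :
    ∑ i ∈ oneIdx k A, B i.1 (comul i.2) =
      ∑ i ∈ oneIdx k A, ∑ j ∈ oneIdx k A, B i.1 ((i.2 * j.1) ⊗ₜ j.2) := by
  have h := congrArg (TensorProduct.lift B) (comul_one (k := k) (A := A))
  rw [comul_one_eq] at h
  rw [Finset.sum_comm]
  simpa [TensorProduct.sum_tmul, TensorProduct.tmul_sum, Finset.sum_mul, Finset.mul_sum] using h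

lemma sum_comul_snd' (B : A →ₗ[k] A ⊗[k] A →ₗ[k] V) :
    ∑ i ∈ oneIdx k A, B i.1 (comul i.2) =
      ∑ i ∈ oneIdx k A, ∑ j ∈ oneIdx k A, B i.1 ((j.1 * i.2) ⊗ₜ j.2) := by
  have h := congrArg (TensorProduct.lift B) (comul_one' (k := k) (A := A))
  rw [comul_one_eq] at h
  simpa [TensorProduct.sum_tmul, TensorProduct.tmul_sum, Finset.sum_mul, Finset.mul_sum] using h

lemma sum_comul_fst (B : A ⊗[k] A →ₗ[k] A →ₗ[k] V) :
    ∑ i ∈ oneIdx k A, B (comul i.1) i.2 =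
      ∑ i ∈ oneIdx k A, ∑ j ∈ oneIdx k A, B (i.1 ⊗ₜ (i.2 * j.1)) j.2 := by
  have h1 : ∀ a b c, TensorProduct.curry (TensorProduct.lift B ∘ₗ
      (TensorProduct.assoc k A A A).symm.toLinearMap) a (b ⊗ₜ c) = B (a ⊗ₜ b) c := by
    intro a b c; simp
  rw [← sum_coassoc k _ B h1, sum_comul_snd]
  simp only [h1]

lemma sum_comul_fst' (B : A ⊗[k] A →ₗ[k] A →ₗ[k] V) :
    ∑ i ∈ oneIdx k A, B (comul i.1) i.2 =
      ∑ i ∈ oneIdx k A, ∑ j ∈ oneIdx k A, B (i.1 ⊗ₜ (j.1 * i.2)) j.2 := by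
  have h1 : ∀ a b c, TensorProduct.curry (TensorProduct.lift B ∘ₗ
      (TensorProduct.assoc k A A A).symm.toLinearMap) a (b ⊗ₜ c) = B (a ⊗ₜ b) c := by
    intro a b c; simp
  rw [← sum_coassoc k _ B h1, sum_comul_snd']
  simp only [h1]

/-- `x = 1₁ f(1₂)` satisfies `Δ(x) = 1₁ ⊗ 1₂ x`. -/
lemma comul_fst (f : A →ₗ[k] k) :
    comul (R := k) (∑ i ∈ oneIdx k A, f i.2 • i.1) =
      comul (R := k) (1 : A) * (1 ⊗ₜ ∑ i ∈ oneIdx k A, f i.2 • i.1) := by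
  have h := sum_comul_fst k ((LinearMap.lsmul k (A ⊗[k] A)).comp f).flip
  simp only [LinearMap.flip_apply, LinearMap.comp_apply, LinearMap.lsmul_apply] at h
  simp only [map_sum, map_smul, h]
  rw [Finset.sum_comm]
  simp [comul_one_eq, Finset.sum_mul, TensorProduct.tmul_sum, Finset.mul_sum, Finset.smul_sum]

/-- `x = 1₁ f(1₂)` satisfies `Δ(x) = 1₁ ⊗ x 1₂`. -/
lemma comul_fst' (f : A →ₗ[k] k) :
    comul (R := k) (∑ i ∈ oneIdx k A, f i.2 • i.1) =
      (1 ⊗ₜ ∑ i ∈ oneIdx k A, f i.2 • i.1) * comul (R := k) (1 : A) := by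
  have h := sum_comul_fst' k ((LinearMap.lsmul k (A ⊗[k] A)).comp f).flip
  simp only [LinearMap.flip_apply, LinearMap.comp_apply, LinearMap.lsmul_apply] at h
  simp only [map_sum, map_smul, h]
  simp [comul_one_eq, Finset.sum_mul, TensorProduct.tmul_sum, Finset.mul_sum]

/-- `y = f(1₁) 1₂` satisfies `Δ(y) = y 1₁ ⊗ 1₂`. -/
lemma comul_snd (f : A →ₗ[k] k) :
    comul (R := k) (∑ i ∈ oneIdx k A, f i.1 • i.2) =
      ((∑ i ∈ oneIdx k A, f i.1 • i.2) ⊗ₜ 1) * comul (R := k) (1 : A) := by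
  have h := sum_comul_snd k ((LinearMap.lsmul k (A ⊗[k] A)).comp f)
  simp only [LinearMap.comp_apply, LinearMap.lsmul_apply] at h
  simp only [map_sum, map_smul, h]
  rw [Finset.sum_comm]
  simp [comul_one_eq, Finset.sum_mul, TensorProduct.sum_tmul, Finset.mul_sum,
    TensorProduct.smul_tmul']

/-- `y = f(1₁) 1₂` satisfies `Δ(y) = 1₁ y ⊗ 1₂`. -/
lemma comul_snd' (f : A →ₗ[k] k) :
    comul (R := k) (∑ i ∈ oneIdx k A, f i.1 • i.2) =
      comul (R := k) (1 : A) * ((∑ i ∈ oneIdx k A, f i.1 • i.2) ⊗ₜ 1) := by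
  have h := sum_comul_snd' k ((LinearMap.lsmul k (A ⊗[k] A)).comp f)
  simp only [LinearMap.comp_apply, LinearMap.lsmul_apply] at h
  simp only [map_sum, map_smul, h]
  simp [comul_one_eq, Finset.sum_mul, TensorProduct.sum_tmul, Finset.mul_sum,
    TensorProduct.smul_tmul']

lemma fst_snd_comm (f g : A →ₗ[k] k) :
    (∑ i ∈ oneIdx k A, f i.2 • i.1) * (∑ i ∈ oneIdx k A, g i.1 • i.2) =
      (∑ i ∈ oneIdx k A, g i.1 • i.2) * (∑ i ∈ oneIdx k A, f i.2 • i.1) := by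
  let B : A →ₗ[k] A ⊗[k] A →ₗ[k] A := (LinearMap.lsmul k (A ⊗[k] A →ₗ[k] A)).flip
    ((TensorProduct.rid k A).toLinearMap ∘ₗ f.lTensor A) ∘ₗ g
  have hB : ∀ a b c, B a (b ⊗ₜ c) = g a • f c • b := fun a b c => by simp [B]
  have h := (sum_comul_snd k B).symm.trans (sum_comul_snd' k B)
  simp only [hB] at h
  rw [Finset.sum_mul_sum, Finset.sum_mul_sum, Finset.sum_comm]
  simp only [smul_mul_smul_comm]
  simp only [smul_smul] at h
  rw [h]
  simp only [mul_comm]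

lemma comul_one_mul (h : A) : comul (R := k) (1 : A) * comul (R := k) h = comul (R := k) h := by
  rw [← comul_mul, one_mul]

lemma comul_mul_one (h : A) : comul (R := k) h * comul (R := k) (1 : A) = comul (R := k) h := by
  rw [← comul_mul, mul_one]

/-- `h₁ ⊗ ⊓̅ᴸ(h₂) = h 1₁ ⊗ 1₂`. -/
lemma lTensor_piLbar (h : A) :
    (piLbar k).lTensor A (comul (R := k) h) = (h ⊗ₜ 1) * comul (R := k) (1 : A) := by
  obtain ⟨S, hS⟩ := TensorProduct.exists_finset (comul (R := k) h)
  have e1 : ∀ a : A, h * a = TensorProduct.rid k A ((counit (R := k)).lTensor A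
      (comul (R := k) h * comul (R := k) a)) := by
    intro a; rw [← comul_mul, Coalgebra.lTensor_counit_comul]; simp
  have h1 := sum_comul_fst k ((TensorProduct.mk k A A).comp ((TensorProduct.rid k A).toLinearMap ∘ₗ
    (counit (R := k)).lTensor A ∘ₗ LinearMap.mulLeft k (comul (R := k) h)))
  simp only [LinearMap.comp_apply, LinearEquiv.coe_coe, LinearMap.mulLeft_apply, ← e1,
    TensorProduct.mk_apply] at h1
  have h2 : (h ⊗ₜ 1) * comul (R := k) (1 : A) = ∑ i ∈ oneIdx k A, (h * i.1) ⊗ₜ[k] i.2 := by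
    simp [comul_one_eq, Finset.mul_sum]
  rw [h2, h1]
  have h3 : ∀ j : A × A, ∑ i ∈ oneIdx k A, (TensorProduct.rid k A ((counit (R := k)).lTensor A
      (comul (R := k) h * (i.1 ⊗ₜ (i.2 * j.1))))) ⊗ₜ[k] j.2 =
      (TensorProduct.rid k A ((counit (R := k)).lTensor A
        (comul (R := k) h * (1 ⊗ₜ j.1)))) ⊗ₜ[k] j.2 := by
    intro j
    rw [← TensorProduct.sum_tmul]
    congr 1
    conv_rhs => rw [← comul_mul_one, comul_one_eq]
    simp [Finset.mul_sum, Finset.sum_mul, mul_assoc]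
  rw [Finset.sum_comm]
  simp only [h3]
  rw [hS]
  simp [piLbar_apply, Finset.sum_mul, TensorProduct.tmul_sum, TensorProduct.sum_tmul,
    TensorProduct.smul_tmul']
  rw [Finset.sum_comm]

/-- `⊓ᴿ(h₁) ⊗ h₂ = 1₁ ⊗ h 1₂`. -/
lemma rTensor_piR (h : A) :
    (piR k).rTensor A (comul (R := k) h) = (1 ⊗ₜ h) * comul (R := k) (1 : A) := by
  obtain ⟨S, hS⟩ := TensorProduct.exists_finset (comul (R := k) h)
  have e1 : ∀ a : A, h * a = TensorProduct.lid k A ((counit (R := k)).rTensor A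
      (comul (R := k) h * comul (R := k) a)) := by
    intro a; rw [← comul_mul, Coalgebra.rTensor_counit_comul]; simp
  have h1 := sum_comul_snd' k ((TensorProduct.mk k A A).compl₂
    ((TensorProduct.lid k A).toLinearMap ∘ₗ
    (counit (R := k)).rTensor A ∘ₗ LinearMap.mulLeft k (comul (R := k) h)))
  simp only [LinearMap.compl₂_apply, LinearMap.comp_apply, LinearEquiv.coe_coe,
    LinearMap.mulLeft_apply, ← e1, TensorProduct.mk_apply] at h1
  have h2 : (1 ⊗ₜ h) * comul (R := k) (1 : A) = ∑ i ∈ oneIdx k A, i.1 ⊗ₜ[k] (h * i.2) := by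
    simp [comul_one_eq, Finset.mul_sum]
  rw [h2, h1]
  have h3 : ∀ i : A × A, ∑ j ∈ oneIdx k A, i.1 ⊗ₜ[k] (TensorProduct.lid k A
      ((counit (R := k)).rTensor A (comul (R := k) h * ((j.1 * i.2) ⊗ₜ j.2)))) =
      i.1 ⊗ₜ[k] (TensorProduct.lid k A ((counit (R := k)).rTensor A
        (comul (R := k) h * (i.2 ⊗ₜ 1)))) := by
    intro i
    rw [← TensorProduct.tmul_sum]
    congr 1
    conv_rhs => rw [← comul_mul_one, comul_one_eq]
    simp [Finset.mul_sum, Finset.sum_mul, mul_assoc]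
  simp only [h3]
  rw [hS]
  simp [piR_apply, Finset.sum_mul, TensorProduct.tmul_sum, TensorProduct.sum_tmul,
    TensorProduct.smul_tmul']
  rw [Finset.sum_comm]

end lemmas

section base

variable [WeakBialgebra k A]

lemma counit_mul_one (a c : A) : counit (R := k) (a * c) =
    ∑ i ∈ oneIdx k A, counit (R := k) (a * i.1) * counit (R := k) (i.2 * c) := by
  have h := counit_mul (k := k) a 1 c
  simpa [comul_one_eq, Finset.mul_sum, Finset.sum_mul] using h

lemma counit_mul_one' (a c : A) : counit (R := k) (a * c) =
    ∑ i ∈ oneIdx k A, counit (R := k) (a * i.2) * counit (R := k) (i.1 * c) := by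
  have h := counit_mul' (k := k) a 1 c
  simpa [comul_one_eq, Finset.mul_sum, Finset.sum_mul, mul_comm] using h

variable (A) in
lemma one_lTensor_piLbar :
    (piLbar k).lTensor A (comul (R := k) (1 : A)) = comul (R := k) (1 : A) := by
  rw [lTensor_piLbar, ← Algebra.TensorProduct.one_def, one_mul]

variable (A) in
lemma one_rTensor_piR :
    (piR k).rTensor A (comul (R := k) (1 : A)) = comul (R := k) (1 : A) := by
  rw [rTensor_piR, ← Algebra.TensorProduct.one_def, one_mul]

section transfer

variable {V : Type*} [AddCommGroup V] [Module k V]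

/-- Replace `1₂` by `⊓̅ᴸ(1₂)`. -/
lemma sum_piLbar (B : A →ₗ[k] A →ₗ[k] V) :
    ∑ i ∈ oneIdx k A, B i.1 (piLbar k i.2) = ∑ i ∈ oneIdx k A, B i.1 i.2 := by
  have h := congrArg (TensorProduct.lift B) (one_lTensor_piLbar k A)
  rw [comul_one_eq] at h
  simpa using h

/-- Replace `1₁` by `⊓ᴿ(1₁)`. -/
lemma sum_piR (B : A →ₗ[k] A →ₗ[k] V) :
    ∑ i ∈ oneIdx k A, B (piR k i.1) i.2 = ∑ i ∈ oneIdx k A, B i.1 i.2 := by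
  have h := congrArg (TensorProduct.lift B) (one_rTensor_piR k A)
  rw [comul_one_eq] at h
  simpa using h

end transfer

lemma comul_piR (h : A) : comul (R := k) (piR k h) = comul (R := k) (1 : A) * (1 ⊗ₜ piR k h) := by
  rw [piR_apply]; exact comul_fst k (counit (R := k) ∘ₗ LinearMap.mulLeft k h)

lemma comul_piR' (h : A) :
    comul (R := k) (piR k h) = (1 ⊗ₜ piR k h) * comul (R := k) (1 : A) := by
  rw [piR_apply]; exact comul_fst' k (counit (R := k) ∘ₗ LinearMap.mulLeft k h)

lemma comul_piRbar' (h : A) :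
    comul (R := k) (piRbar k h) = (1 ⊗ₜ piRbar k h) * comul (R := k) (1 : A) := by
  rw [piRbar_apply]; exact comul_fst' k (counit (R := k) ∘ₗ LinearMap.mulRight k h)

lemma comul_piLbar (h : A) :
    comul (R := k) (piLbar k h) = (piLbar k h ⊗ₜ 1) * comul (R := k) (1 : A) := by
  rw [piLbar_apply]; exact comul_snd k (counit (R := k) ∘ₗ LinearMap.mulLeft k h)

lemma comul_piLbar' (h : A) :
    comul (R := k) (piLbar k h) = comul (R := k) (1 : A) * (piLbar k h ⊗ₜ 1) := by
  rw [piLbar_apply]; exact comul_snd' k (counit (R := k) ∘ₗ LinearMap.mulLeft k h)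

lemma comul_piL (h : A) :
    comul (R := k) (piL k h) = (piL k h ⊗ₜ 1) * comul (R := k) (1 : A) := by
  rw [piL_apply]; exact comul_snd k (counit (R := k) ∘ₗ LinearMap.mulRight k h)

lemma piR_mul_piLbar (g h : A) : piR k g * piLbar k h = piLbar k h * piR k g := by
  rw [piR_apply, piLbar_apply]
  exact fst_snd_comm k (counit (R := k) ∘ₗ LinearMap.mulLeft k g)
    (counit (R := k) ∘ₗ LinearMap.mulLeft k h)

variable {k}

/-- Elements `x` with `Δ(x) = 1₁ ⊗ x 1₂` are fixed by `⊓ᴿ`. -/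
lemma piR_eq_self {x : A} (hx : comul (R := k) x = (1 ⊗ₜ x) * comul (R := k) (1 : A)) :
    piR k x = x := by
  change TensorProduct.rid k A ((counit (R := k)).lTensor A
    ((1 ⊗ₜ x) * comul (R := k) (1 : A))) = x
  rw [← hx, Coalgebra.lTensor_counit_comul]; simp

variable (k)

lemma piR_piR (h : A) : piR k (piR k h) = piR k h := piR_eq_self (comul_piR' k h)

lemma piR_piRbar (h : A) : piR k (piRbar k h) = piRbar k h := piR_eq_self (comul_piRbar' k h)

lemma piR_one : piR k (1 : A) = 1 := by
  rw [piR_apply]; simpa using sum_counit_right k A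

lemma piR_piR_mul_piR (g h : A) : piR k (piR k g * piR k h) = piR k g * piR k h := by
  apply piR_eq_self
  have e : (1 : A) ⊗ₜ[k] (piR k g * piR k h) = (1 ⊗ₜ piR k g) * (1 ⊗ₜ piR k h) := by simp
  rw [e, comul_mul, comul_piR', comul_piR', mul_assoc, ← mul_assoc (comul 1), ← comul_piR,
    comul_piR', mul_assoc, comul_one_mul, mul_assoc]

variable (A) in
/-- The base algebra of a weak bialgebra: the image of `⊓ᴿ`. -/
noncomputable def baseAlgebra : Subalgebra k A where
  carrier := Set.range (piR k)
  mul_mem' := by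
    rintro _ _ ⟨g, rfl⟩ ⟨h, rfl⟩
    exact ⟨_, piR_piR_mul_piR k g h⟩
  add_mem' := by
    rintro _ _ ⟨g, rfl⟩ ⟨h, rfl⟩
    exact ⟨g + h, map_add _ _ _⟩
  algebraMap_mem' c := ⟨c • 1, by rw [map_smul, piR_one, Algebra.algebraMap_eq_smul_one]⟩

lemma piR_mem (h : A) : piR k h ∈ baseAlgebra k A := ⟨h, rfl⟩

lemma piRbar_mem (h : A) : piRbar k h ∈ baseAlgebra k A := ⟨_, piR_piRbar k h⟩

variable {k}

lemma piR_base (x : baseAlgebra k A) : piR k (x : A) = x := by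
  obtain ⟨_, h, rfl⟩ := x
  exact piR_piR k h

lemma comul_base (x : baseAlgebra k A) :
    comul (R := k) (x : A) = comul (R := k) (1 : A) * (1 ⊗ₜ (x : A)) := by
  rw [← piR_base x]; exact comul_piR k _

lemma comul_base' (x : baseAlgebra k A) :
    comul (R := k) (x : A) = (1 ⊗ₜ (x : A)) * comul (R := k) (1 : A) := by
  rw [← piR_base x]; exact comul_piR' k _

lemma base_mul_piLbar (x : baseAlgebra k A) (h : A) : (x : A) * piLbar k h = piLbar k h * x := by
  rw [← piR_base x]; exact piR_mul_piLbar k _ h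

variable (k)

/-- `ε(h g₁) g₂ = ⊓̅ᴸ(h) g`. -/
lemma piLbar_mul (h g : A) :
    TensorProduct.lid k A ((counit (R := k) ∘ₗ LinearMap.mulLeft k h).rTensor A
      (comul (R := k) g)) = piLbar k h * g := by
  obtain ⟨S, hS⟩ := TensorProduct.exists_finset (comul (R := k) g)
  have e1 : ∀ a : A, TensorProduct.lid k A ((counit (R := k)).rTensor A
      (comul (R := k) a * comul (R := k) g)) = a * g := by
    intro a; rw [← comul_mul, Coalgebra.rTensor_counit_comul]; simp
  have e2 : piLbar k h * g = ∑ i ∈ oneIdx k A, counit (R := k) (h * i.1) •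
      TensorProduct.lid k A ((counit (R := k)).rTensor A
        (comul (R := k) i.2 * comul (R := k) g)) := by
    simp only [e1, piLbar_apply, Finset.sum_mul, smul_mul_assoc]
  let f : A ⊗[k] A →ₗ[k] A := (TensorProduct.lid k A).toLinearMap ∘ₗ
    (counit (R := k)).rTensor A ∘ₗ LinearMap.mulRight k (comul (R := k) g)
  have hf : ∀ b c, f (b ⊗ₜ c) = ∑ s ∈ S, counit (R := k) (b * s.1) • (c * s.2) := by
    intro b c; simp [f, hS, Finset.mul_sum]
  let B : A →ₗ[k] A ⊗[k] A →ₗ[k] A := (LinearMap.lsmul k (A ⊗[k] A →ₗ[k] A)).flip f ∘ₗ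
    (counit (R := k) ∘ₗ LinearMap.mulLeft k h)
  let B' : A ⊗[k] A →ₗ[k] A →ₗ[k] A := ∑ s ∈ S,
    ((LinearMap.lsmul k A).compl₁₂ (LinearMap.mul' k k ∘ₗ TensorProduct.map
      (counit (R := k) ∘ₗ LinearMap.mulLeft k h) (counit (R := k) ∘ₗ LinearMap.mulRight k s.1))
      (LinearMap.mulRight k s.2))
  have hB : ∀ a b c, B a (b ⊗ₜ c) = B' (a ⊗ₜ b) c := by
    intro a b c
    simp [B, B', hf, Finset.smul_sum, smul_smul, LinearMap.sum_apply]
  have h3 := sum_coassoc k B B' hB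
  have hB1 : ∀ a t, B a t = counit (R := k) (h * a) • TensorProduct.lid k A
      ((counit (R := k)).rTensor A (t * comul (R := k) g)) := fun a t => rfl
  simp only [hB1] at h3
  rw [e2, h3]
  have hB2 : ∀ i : A × A, B' (comul i.1) i.2 =
      ∑ s ∈ S, counit (R := k) (h * i.1 * s.1) • (i.2 * s.2) := by
    intro i
    simp only [B', LinearMap.sum_apply, LinearMap.compl₁₂_apply, LinearMap.lsmul_apply,
      LinearMap.mulRight_apply]
    refine Finset.sum_congr rfl fun s _ => ?_
    congr 1
    rw [counit_mul (k := k) h i.1 s.1]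
    obtain ⟨T, hT⟩ := TensorProduct.exists_finset (comul (R := k) i.1)
    rw [hT]
    simp [Finset.mul_sum, Finset.sum_mul]
  simp only [hB2]
  conv_lhs => rw [← comul_one_mul, comul_one_eq, hS]
  simp [Finset.sum_mul, Finset.mul_sum, mul_assoc]
  rw [Finset.sum_comm]

/-- `g₁ ε(h g₂) = ⊓ᴿ(h) g`. -/
lemma piR_mul (h g : A) :
    TensorProduct.rid k A ((counit (R := k) ∘ₗ LinearMap.mulLeft k h).lTensor A
      (comul (R := k) g)) = piR k h * g := by
  obtain ⟨S, hS⟩ := TensorProduct.exists_finset (comul (R := k) g)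
  have e1 : ∀ a : A, TensorProduct.rid k A ((counit (R := k)).lTensor A
      (comul (R := k) a * comul (R := k) g)) = a * g := by
    intro a; rw [← comul_mul, Coalgebra.lTensor_counit_comul]; simp
  have e2 : piR k h * g = ∑ i ∈ oneIdx k A, counit (R := k) (h * i.2) •
      TensorProduct.rid k A ((counit (R := k)).lTensor A
        (comul (R := k) i.1 * comul (R := k) g)) := by
    simp only [e1, piR_apply, Finset.sum_mul, smul_mul_assoc]
  let f : A ⊗[k] A →ₗ[k] A := (TensorProduct.rid k A).toLinearMap ∘ₗ
    (counit (R := k)).lTensor A ∘ₗ LinearMap.mulRight k (comul (R := k) g)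
  have hf : ∀ b c, f (b ⊗ₜ c) = ∑ s ∈ S, counit (R := k) (c * s.2) • (b * s.1) := by
    intro b c; simp [f, hS, Finset.mul_sum]
  let B' : A ⊗[k] A →ₗ[k] A →ₗ[k] A := ((LinearMap.lsmul k (A ⊗[k] A →ₗ[k] A)).flip f ∘ₗ
    (counit (R := k) ∘ₗ LinearMap.mulLeft k h)).flip
  let B : A →ₗ[k] A ⊗[k] A →ₗ[k] A := ∑ s ∈ S,
    ((LinearMap.lsmul k A).compl₁₂ (LinearMap.mul' k k ∘ₗ TensorProduct.map
      (counit (R := k) ∘ₗ LinearMap.mulRight k s.2) (counit (R := k) ∘ₗ LinearMap.mulLeft k h))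
      (LinearMap.mulRight k s.1)).flip
  have hB : ∀ a b c, B a (b ⊗ₜ c) = B' (a ⊗ₜ b) c := by
    intro a b c
    simp [B, B', hf, Finset.smul_sum, smul_smul, LinearMap.sum_apply, mul_comm]
  have h3 := sum_coassoc k B B' hB
  have hB1 : ∀ t a, B' t a = counit (R := k) (h * a) • TensorProduct.rid k A
      ((counit (R := k)).lTensor A (t * comul (R := k) g)) := fun a t => rfl
  simp only [hB1] at h3
  rw [e2, ← h3]
  have hB2 : ∀ i : A × A, B i.1 (comul i.2) =
      ∑ s ∈ S, counit (R := k) (h * i.2 * s.2) • (i.1 * s.1) := by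
    intro i
    simp only [B, LinearMap.sum_apply, LinearMap.compl₁₂_apply, LinearMap.lsmul_apply,
      LinearMap.mulRight_apply, LinearMap.flip_apply]
    refine Finset.sum_congr rfl fun s _ => ?_
    congr 1
    rw [counit_mul' (k := k) h i.2 s.2]
    obtain ⟨T, hT⟩ := TensorProduct.exists_finset (comul (R := k) i.2)
    rw [hT]
    simp [Finset.mul_sum, Finset.sum_mul]
  simp only [hB2]
  conv_lhs => rw [← comul_one_mul, comul_one_eq, hS]
  simp [Finset.sum_mul, Finset.mul_sum, mul_assoc]
  rw [Finset.sum_comm]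

/-- `g₁ ε(g₂ h) = g ⊓̅ᴿ(h)`. -/
lemma mul_piRbar (g h : A) :
    TensorProduct.rid k A ((counit (R := k) ∘ₗ LinearMap.mulRight k h).lTensor A
      (comul (R := k) g)) = g * piRbar k h := by
  obtain ⟨S, hS⟩ := TensorProduct.exists_finset (comul (R := k) g)
  have e1 : ∀ a : A, TensorProduct.rid k A ((counit (R := k)).lTensor A
      (comul (R := k) g * comul (R := k) a)) = g * a := by
    intro a; rw [← comul_mul, Coalgebra.lTensor_counit_comul]; simp
  have e2 : g * piRbar k h = ∑ i ∈ oneIdx k A, counit (R := k) (i.2 * h) •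
      TensorProduct.rid k A ((counit (R := k)).lTensor A
        (comul (R := k) g * comul (R := k) i.1)) := by
    simp only [e1, piRbar_apply, Finset.mul_sum, mul_smul_comm]
  let f : A ⊗[k] A →ₗ[k] A := (TensorProduct.rid k A).toLinearMap ∘ₗ
    (counit (R := k)).lTensor A ∘ₗ LinearMap.mulLeft k (comul (R := k) g)
  have hf : ∀ b c, f (b ⊗ₜ c) = ∑ s ∈ S, counit (R := k) (s.2 * c) • (s.1 * b) := by
    intro b c; simp [f, hS, Finset.sum_mul]
  let B' : A ⊗[k] A →ₗ[k] A →ₗ[k] A := ((LinearMap.lsmul k (A ⊗[k] A →ₗ[k] A)).flip f ∘ₗ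
    (counit (R := k) ∘ₗ LinearMap.mulRight k h)).flip
  let B : A →ₗ[k] A ⊗[k] A →ₗ[k] A := ∑ s ∈ S,
    ((LinearMap.lsmul k A).compl₁₂ (LinearMap.mul' k k ∘ₗ TensorProduct.map
      (counit (R := k) ∘ₗ LinearMap.mulLeft k s.2) (counit (R := k) ∘ₗ LinearMap.mulRight k h))
      (LinearMap.mulLeft k s.1)).flip
  have hB : ∀ a b c, B a (b ⊗ₜ c) = B' (a ⊗ₜ b) c := by
    intro a b c
    simp [B, B', hf, Finset.smul_sum, smul_smul, LinearMap.sum_apply, mul_comm]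
  have h3 := sum_coassoc k B B' hB
  have hB1 : ∀ t a, B' t a = counit (R := k) (a * h) • TensorProduct.rid k A
      ((counit (R := k)).lTensor A (comul (R := k) g * t)) := fun a t => rfl
  simp only [hB1] at h3
  rw [e2, ← h3]
  have hB2 : ∀ i : A × A, B i.1 (comul i.2) =
      ∑ s ∈ S, counit (R := k) (s.2 * i.2 * h) • (s.1 * i.1) := by
    intro i
    simp only [B, LinearMap.sum_apply, LinearMap.compl₁₂_apply, LinearMap.lsmul_apply,
      LinearMap.mulLeft_apply, LinearMap.flip_apply]
    refine Finset.sum_congr rfl fun s _ => ?_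
    congr 1
    rw [counit_mul (k := k) s.2 i.2 h]
    obtain ⟨T, hT⟩ := TensorProduct.exists_finset (comul (R := k) i.2)
    rw [hT]
    simp [Finset.mul_sum, Finset.sum_mul]
  simp only [hB2]
  conv_lhs => rw [← comul_mul_one, comul_one_eq, hS]
  simp [Finset.sum_mul, Finset.mul_sum, mul_assoc]

lemma piLbar_mul_of (x : A) {y : A} (hy : comul (R := k) y = (y ⊗ₜ 1) * comul (R := k) (1 : A)) :
    piLbar k (x * y) = piLbar k x * y := by
  rw [← piLbar_mul, hy, comul_one_eq, piLbar_apply]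
  simp [Finset.mul_sum, mul_assoc]

lemma piR_mul_base (h : A) (x : baseAlgebra k A) : piR k (h * x) = piR k h * x := by
  rw [← piR_mul, comul_base' x, comul_one_eq, piR_apply]
  simp [Finset.mul_sum, mul_assoc]

lemma piRbar_base_mul (x : baseAlgebra k A) (h : A) : piRbar k (x * h) = x * piRbar k h := by
  rw [← mul_piRbar, comul_base x, comul_one_eq, piRbar_apply]
  simp [Finset.sum_mul, mul_assoc]

/-- `x 1₁ ⊗ 1₂ = 1₁ ⊗ ⊓̅ᴸ(x) 1₂` for `x` in the base algebra. -/
lemma base_tmul_mul (x : baseAlgebra k A) : ((x : A) ⊗ₜ 1) * comul (R := k) (1 : A) =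
    (1 ⊗ₜ piLbar k (x : A)) * comul (R := k) (1 : A) := by
  have h1 := sum_piLbar k ((TensorProduct.mk k A A).compl₂ (piLbar k ∘ₗ
    LinearMap.mulLeft k (x : A)))
  simp only [LinearMap.compl₂_apply, LinearMap.comp_apply, LinearMap.mulLeft_apply,
    TensorProduct.mk_apply, fun z => piLbar_mul_of k (x : A) (comul_piLbar k z)] at h1
  have h2 := sum_piLbar k ((TensorProduct.mk k A A).compl₂
    (LinearMap.mulLeft k (piLbar k (x : A))))
  simp only [LinearMap.compl₂_apply, LinearMap.mulLeft_apply, TensorProduct.mk_apply] at h2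
  rw [← lTensor_piLbar, comul_base' x, comul_one_eq]
  simp only [Finset.mul_sum, map_sum, Algebra.TensorProduct.tmul_mul_tmul, one_mul,
    LinearMap.lTensor_tmul]
  rw [← h1, h2]

lemma sum_base_mul {V : Type*} [AddCommGroup V] [Module k V] (B : A →ₗ[k] A →ₗ[k] V)
    (x : baseAlgebra k A) : ∑ i ∈ oneIdx k A, B (x * i.1) i.2 =
      ∑ i ∈ oneIdx k A, B i.1 (piLbar k (x : A) * i.2) := by
  have h := congrArg (TensorProduct.lift B) (base_tmul_mul k x)
  rw [comul_one_eq] at h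
  simpa [Finset.mul_sum] using h

lemma piLbar_mul_base (x y : baseAlgebra k A) :
    piLbar k ((x : A) * y) = piLbar k (y : A) * piLbar k (x : A) := by
  have e : ∀ z : A, piLbar k z = TensorProduct.lid k A ((counit (R := k)).rTensor A
    ((z ⊗ₜ 1) * comul (R := k) (1 : A))) := fun z => rfl
  have e2 : (((x : A) * y) ⊗ₜ[k] (1 : A)) = ((x : A) ⊗ₜ 1) * ((y : A) ⊗ₜ 1) := by simp
  have e3 : ((x : A) ⊗ₜ[k] (1 : A)) * (1 ⊗ₜ piLbar k (y : A)) =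
      (1 ⊗ₜ piLbar k (y : A)) * ((x : A) ⊗ₜ 1) := by simp
  rw [e, e2, mul_assoc, base_tmul_mul, ← mul_assoc, e3, mul_assoc, base_tmul_mul, comul_one_eq]
  have := sum_counit_left k A
  simp only [Finset.mul_sum, map_sum, Algebra.TensorProduct.tmul_mul_tmul, one_mul,
    LinearMap.rTensor_tmul, TensorProduct.lid_tmul]
  simp only [← mul_smul_comm, ← Finset.mul_sum, this, mul_one]

lemma piLbar_one : piLbar k (1 : A) = 1 := by
  rw [piLbar_apply]; simpa using sum_counit_left k A

lemma piR_mul_piLbar_base (h : A) (x : baseAlgebra k A) :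
    piR k (h * piLbar k (x : A)) = x * piR k h := by
  have := sum_base_mul k ((LinearMap.lsmul k A).comp
    (counit (R := k) ∘ₗ LinearMap.mulLeft k h)).flip x
  simp only [LinearMap.flip_apply, LinearMap.comp_apply, LinearMap.lsmul_apply,
    LinearMap.mulLeft_apply] at this
  rw [piR_apply, piR_apply, Finset.mul_sum]
  simp only [mul_smul_comm, mul_assoc, this]

lemma piR_piLbar_base (x : baseAlgebra k A) : piR k (piLbar k (x : A)) = x := by
  have := piR_mul_piLbar_base k 1 x
  rwa [one_mul, piR_one, mul_one] at this

/-- `⊓̅ᴸ ⊓ᴿ` fixes every `y` with `Δ(y) = y 1₁ ⊗ 1₂`. -/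
lemma piLbar_piR_of {y : A} (hy : comul (R := k) y = (y ⊗ₜ 1) * comul (R := k) (1 : A)) :
    piLbar k (piR k y) = y := by
  -- `1₁ ε(y 1₂)` with `Δ(y) = y 1₁ ⊗ 1₂`
  have h1 : piLbar k y = y := by
    change TensorProduct.lid k A ((counit (R := k)).rTensor A
      ((y ⊗ₜ 1) * comul (R := k) (1 : A))) = y
    rw [← hy, Coalgebra.rTensor_counit_comul]; simp
  rw [piR_apply, map_sum]
  simp only [map_smul]
  rw [← h1]
  conv_rhs => rw [piLbar_apply]
  have := counit_mul_one' (k := k) (A := A) y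
  conv_rhs =>
    enter [2, i]
    rw [this]
  simp only [piLbar_apply, Finset.smul_sum, Finset.sum_smul, smul_smul, h1]
  rw [Finset.sum_comm]

end base

end WeakBialgebra
end weak

section coseparability

open Coalgebra

namespace WeakBialgebra

variable (k : Type u) (A : Type v) [Field k] [Ring A] [Algebra k A] [Coalgebra k A]
  [WeakBialgebra k A]

/-- `⊓ᴿ` with values in the base algebra. -/
noncomputable def toBase : A →ₗ[k] baseAlgebra k A :=
  (piR k).codRestrict (Subalgebra.toSubmodule (baseAlgebra k A)) (piR_mem k)

/-- `⊓̅ᴿ` with values in the base algebra. -/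
noncomputable def toBaseBar : A →ₗ[k] baseAlgebra k A :=
  (piRbar k).codRestrict (Subalgebra.toSubmodule (baseAlgebra k A)) (piRbar_mem k)

variable {A}

@[simp] lemma coe_toBase (h : A) : (toBase k A h : A) = piR k h := rfl
@[simp] lemma coe_toBaseBar (h : A) : (toBaseBar k A h : A) = piRbar k h := rfl

lemma counit_piR (h : A) : counit (R := k) (piR k h) = counit (R := k) h := by
  have := congrArg (fun z => counit (R := k) (h * z)) (sum_counit_left k A)
  simp only [Finset.mul_sum, mul_smul_comm, map_sum, map_smul, smul_eq_mul, mul_one] at this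
  rw [piR_apply, ← this]
  simp [mul_comm]

lemma counit_piRbar (h : A) : counit (R := k) (piRbar k h) = counit (R := k) h := by
  have := congrArg (fun z => counit (R := k) (z * h)) (sum_counit_left k A)
  simp only [Finset.sum_mul, smul_mul_assoc, map_sum, map_smul, smul_eq_mul, one_mul] at this
  rw [piRbar_apply, ← this]
  simp [mul_comm]

lemma piR_piLbar_mul (r : baseAlgebra k A) (g : A) :
    piR k (piLbar k (r : A) * piLbar k g) = piR k (piLbar k g) * r := by
  have h1 := piLbar_piR_of k (comul_piLbar k g)
  have h2 := piLbar_mul_base k (toBase k A (piLbar k g)) r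
  rw [coe_toBase, h1] at h2
  rw [← h2]
  exact piR_piLbar_base k (toBase k A (piLbar k g) * r)

variable (A) in
/-- The Frobenius-separability structure of the base algebra: the separability element
`1₁ ⊗ ⊓ᴿ(1₂)` and the restriction of the counit. -/
noncomputable def baseFrobenius : FrobeniusSeparability k (baseAlgebra k A) where
  elt := TensorProduct.map (toBase k A) (toBase k A) (comul (R := k) (1 : A))
  functional := counit (R := k) ∘ₗ (baseAlgebra k A).val.toLinearMap
  comm r := by
    have hinj : Function.Injective (TensorProduct.map (baseAlgebra k A).val.toLinearMap
        (baseAlgebra k A).val.toLinearMap) :=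
      TensorProduct.map_injective_of_flat_flat _ _ Subtype.val_injective Subtype.val_injective
    apply hinj
    have h1 := sum_piR k ((TensorProduct.mk k A A).compl₁₂ (LinearMap.mulLeft k (r : A)) (piR k))
    have h2 := sum_base_mul k ((TensorProduct.mk k A A).compl₂ (piR k)) r
    have h3 := sum_piLbar k ((TensorProduct.mk k A A).compl₂
      (piR k ∘ₗ LinearMap.mulLeft k (piLbar k (r : A))))
    have h4 := sum_piLbar k ((TensorProduct.mk k A A).compl₂
      (LinearMap.mulRight k (r : A) ∘ₗ piR k))
    have h5 := sum_piR k ((TensorProduct.mk k A A).compl₂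
      (LinearMap.mulRight k (r : A) ∘ₗ piR k))
    simp only [LinearMap.compl₁₂_apply, LinearMap.compl₂_apply, LinearMap.comp_apply,
      LinearMap.mulLeft_apply, LinearMap.mulRight_apply, TensorProduct.mk_apply,
      piR_piLbar_mul] at h1 h2 h3 h4 h5
    rw [comul_one_eq]
    simp only [map_sum, Finset.mul_sum, Finset.sum_mul, TensorProduct.map_tmul,
      Algebra.TensorProduct.tmul_mul_tmul, one_mul, mul_one, AlgHom.toLinearMap_apply,
      map_mul, Subalgebra.coe_val, coe_toBase]
    rw [h1, h2, ← h3, h4, h5]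
  mul_elt := by
    apply Subtype.val_injective
    have h1 := sum_piR k ((LinearMap.mul k A).compl₂ (piR k))
    simp only [LinearMap.compl₂_apply, LinearMap.mul_apply'] at h1
    rw [comul_one_eq]
    simp only [map_sum, TensorProduct.map_tmul, LinearMap.mul'_apply,
      AddSubmonoidClass.coe_finsetSum, MulMemClass.coe_mul, coe_toBase, OneMemClass.coe_one, h1]
    have h2 := sum_counit_right k A
    have h3 := congrArg (TensorProduct.rid k A ∘ (counit (R := k)).lTensor A)
      (comul_one_mul k (1 : A))
    rw [comul_one_eq] at h3
    simp only [Function.comp_apply, Finset.mul_sum, Finset.sum_mul, map_sum,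
      Algebra.TensorProduct.tmul_mul_tmul, LinearMap.lTensor_tmul, TensorProduct.rid_tmul, h2] at h3
    simp only [piR_apply, Finset.mul_sum, mul_smul_comm]
    rw [Finset.sum_comm]
    exact h3
  functional_left := by
    apply Subtype.val_injective
    have h := congrArg (piR k) (sum_counit_left k A)
    simp only [map_sum, map_smul, piR_one] at h
    rw [comul_one_eq]
    simpa [counit_piR] using h
  functional_right := by
    apply Subtype.val_injective
    have h := congrArg (piR k) (sum_counit_right k A)
    simp only [map_sum, map_smul, piR_one] at h
    rw [comul_one_eq]
    simpa [counit_piR] using h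

/-- Summation over the separability element of the base algebra. -/
lemma sum_baseFrobenius {V : Type*} [AddCommGroup V] [Module k V]
    (B : baseAlgebra k A →ₗ[k] baseAlgebra k A →ₗ[k] V) :
    ∑ i ∈ (baseFrobenius k A).idx, B i.1 i.2 =
      ∑ i ∈ oneIdx k A, B (toBase k A i.1) (toBase k A i.2) := by
  have e : (baseFrobenius k A).elt =
    TensorProduct.map (toBase k A) (toBase k A) (comul (R := k) (1 : A)) := rfl
  rw [← FrobeniusSeparability.lift_elt, e, comul_one_eq]
  simp

lemma piLbar_nakayamaInv (x : baseAlgebra k A) :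
    piLbar k ((baseFrobenius k A).nakayamaInv x : A) = piL k (x : A) := by
  have e : ∀ y, (baseFrobenius k A).functional y = counit (R := k) (y : A) := fun _ => rfl
  rw [FrobeniusSeparability.nakayamaInv_apply]
  have h := sum_baseFrobenius k ((LinearMap.lsmul k A).compl₁₂
    ((baseFrobenius k A).functional ∘ₗ LinearMap.mulRight k x)
    (piLbar k ∘ₗ (baseAlgebra k A).val.toLinearMap))
  simp only [LinearMap.compl₁₂_apply, LinearMap.comp_apply, LinearMap.mulRight_apply, e,
    LinearMap.lsmul_apply, AlgHom.toLinearMap_apply, Subalgebra.coe_val, coe_toBase,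
    MulMemClass.coe_mul] at h
  simp only [AddSubmonoidClass.coe_finsetSum, Subalgebra.coe_smul, map_sum, map_smul, e,
    MulMemClass.coe_mul]
  have h1 := sum_piR k ((LinearMap.lsmul k A).compl₁₂
    (counit (R := k) ∘ₗ LinearMap.mulRight k (x : A)) (piLbar k ∘ₗ piR k))
  have h2 := sum_piLbar k ((LinearMap.lsmul k A).compl₁₂
    (counit (R := k) ∘ₗ LinearMap.mulRight k (x : A)) (piLbar k ∘ₗ piR k))
  have h3 := sum_piLbar k ((LinearMap.lsmul k A).compl₁₂
    (counit (R := k) ∘ₗ LinearMap.mulRight k (x : A)) LinearMap.id)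
  simp only [LinearMap.compl₁₂_apply, LinearMap.comp_apply, LinearMap.mulRight_apply,
    LinearMap.lsmul_apply, LinearMap.id_apply,
    fun g => piLbar_piR_of k (comul_piLbar k g)] at h1 h2 h3
  rw [h, h1, ← h2, h3, piL_apply]

/-- `∑ uᵢ x ⊗ vᵢ = ∑ uᵢ ⊗ vᵢ ⊓̅ᴸ(ν⁻¹(x))`. -/
lemma sum_mul_base {V : Type*} [AddCommGroup V] [Module k V] (B : A →ₗ[k] A →ₗ[k] V)
    (x : baseAlgebra k A) : ∑ i ∈ oneIdx k A, B (i.1 * x) i.2 =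
      ∑ i ∈ oneIdx k A, B i.1 (i.2 * piLbar k ((baseFrobenius k A).nakayamaInv x : A)) := by
  let C : baseAlgebra k A →ₗ[k] baseAlgebra k A →ₗ[k] V := B.compl₁₂
    (baseAlgebra k A).val.toLinearMap (piLbar k ∘ₗ (baseAlgebra k A).val.toLinearMap)
  have hC : ∀ y z, C y z = B y (piLbar k (z : A)) := fun _ _ => rfl
  set x' := (baseFrobenius k A).nakayamaInv x with hx'
  have h := (baseFrobenius k A).sum_nakayamaInv C x
  have h1 := sum_baseFrobenius k (C ∘ₗ LinearMap.mulRight k x)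
  have h2 := sum_baseFrobenius k (C.compl₂ (LinearMap.mulLeft k x'))
  simp only [LinearMap.comp_apply, LinearMap.compl₂_apply, LinearMap.mulRight_apply,
    LinearMap.mulLeft_apply] at h1 h2
  rw [← hx', h1, h2] at h
  have hm : ∀ y : baseAlgebra k A, piLbar k ((x' * y : baseAlgebra k A) : A) =
    piLbar k (y : A) * piLbar k (x' : A) := fun y => piLbar_mul_base k x' y
  simp only [hC, hm] at h
  simp only [MulMemClass.coe_mul, coe_toBase] at h
  have s1 := sum_piR k (B.compl₁₂ (LinearMap.mulRight k (x : A)) (piLbar k ∘ₗ piR k))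
  have s2 := sum_piLbar k (B.compl₁₂ (LinearMap.mulRight k (x : A)) (piLbar k ∘ₗ piR k))
  have s3 := sum_piLbar k (B.compl₁₂ (LinearMap.mulRight k (x : A)) LinearMap.id)
  have t1 := sum_piR k (B.compl₂ (LinearMap.mulRight k (piLbar k (x' : A)) ∘ₗ piLbar k ∘ₗ piR k))
  have t2 := sum_piLbar k (B.compl₂
    (LinearMap.mulRight k (piLbar k (x' : A)) ∘ₗ piLbar k ∘ₗ piR k))
  have t3 := sum_piLbar k (B.compl₂ (LinearMap.mulRight k (piLbar k (x' : A))))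
  simp only [LinearMap.compl₁₂_apply, LinearMap.compl₂_apply, LinearMap.comp_apply,
    LinearMap.mulRight_apply, LinearMap.id_apply,
    fun g => piLbar_piR_of k (comul_piLbar k g)] at s1 s2 s3 t1 t2 t3
  rw [← s3, s2, ← s1, h, t1, ← t2, t3]

lemma counit_mul_piL (a c : A) : counit (R := k) (a * piL k c) = counit (R := k) (a * c) := by
  rw [counit_mul_one' k a c, piL_apply]
  simp [Finset.mul_sum, mul_comm]

lemma piRbar_mul_base (g : A) (x : baseAlgebra k A) : piRbar k (g * x) =
    piRbar k (g * piLbar k ((baseFrobenius k A).nakayamaInv x : A)) := by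
  rw [piLbar_nakayamaInv, piRbar_apply, piRbar_apply]
  simp only [← mul_assoc, counit_mul_piL]

lemma piRbar_piLbar_mul (x : baseAlgebra k A) (g : A) : piRbar k (piLbar k (x : A) * g) =
    piRbar k g * ((baseFrobenius k A).nakayama x : A) := by
  have h := sum_mul_base k ((LinearMap.lsmul k A).comp
    (counit (R := k) ∘ₗ LinearMap.mulRight k g)).flip ((baseFrobenius k A).nakayama x)
  simp only [LinearMap.flip_apply, LinearMap.comp_apply, LinearMap.lsmul_apply,
    LinearMap.mulRight_apply, FrobeniusSeparability.nakayamaInv_nakayama] at h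
  simp only [piRbar_apply, Finset.sum_mul, smul_mul_assoc, ← mul_assoc, h]

end WeakBialgebra

section comonoid

open CategoryTheory MonoidalCategory EnvBimod WeakBialgebra

variable (k : Type u) (A : Type v) [Field k] [Ring A] [Algebra k A] [Coalgebra k A]
  [WeakBialgebra k A]

/-- The bimodule `a` on the vector space `A`, with the actions
`(x ⊗ y) · h · (x' ⊗ y') = x ⊓̅ᴸ(y) h x' ⊓̅ᴸ(y')`. -/
noncomputable def weakBialgebraObj : EnvBimod (baseFrobenius k A) :=
  ofActions (V := A) (LinearMap.mul k A ∘ₗ (baseAlgebra k A).val.toLinearMap)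
    (LinearMap.mul k A ∘ₗ piLbar k ∘ₗ (baseAlgebra k A).val.toLinearMap)
    ((LinearMap.mul k A).flip ∘ₗ (baseAlgebra k A).val.toLinearMap)
    ((LinearMap.mul k A).flip ∘ₗ piLbar k ∘ₗ (baseAlgebra k A).val.toLinearMap)
    (fun m => by simp)
    (fun m => by simp [piLbar_one])
    (fun m => by simp)
    (fun m => by simp [piLbar_one])
    (fun x y m => by simp [mul_assoc])
    (fun x y m => by simp [piLbar_mul_base, mul_assoc])
    (fun x y m => by simp [mul_assoc])
    (fun x y m => by simp [piLbar_mul_base, mul_assoc])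
    (fun x y m => by simp [← mul_assoc, base_mul_piLbar])
    (fun x y m => by simp [mul_assoc, base_mul_piLbar])
    (fun x y m => by simp [mul_assoc])
    (fun x y m => by simp [mul_assoc])
    (fun x y m => by simp [mul_assoc])
    (fun x y m => by simp [mul_assoc])

/-- The identification of `A` with the vector space of the bimodule `a`. -/
noncomputable def toObj : A →ₗ[k] (weakBialgebraObj k A).carrier := (LinearMap.id : A →ₗ[k] A)

variable {A}

lemma weakBialgebraObj_l₁ (x : baseAlgebra k A) (h : A) :
    (weakBialgebraObj k A).l₁ x (toObj k A h) = toObj k A (x * h) := ofActions_l₁ x _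
lemma weakBialgebraObj_l₂ (x : baseAlgebra k A) (h : A) :
    (weakBialgebraObj k A).l₂ x (toObj k A h) = toObj k A (piLbar k (x : A) * h) :=
  ofActions_l₂ x _
lemma weakBialgebraObj_r₁ (x : baseAlgebra k A) (h : A) :
    (weakBialgebraObj k A).r₁ x (toObj k A h) = toObj k A (h * x) := ofActions_r₁ x _
lemma weakBialgebraObj_r₂ (x : baseAlgebra k A) (h : A) :
    (weakBialgebraObj k A).r₂ x (toObj k A h) = toObj k A (h * piLbar k (x : A)) :=
  ofActions_r₂ x _

lemma toObj_surjective (m : (weakBialgebraObj k A).carrier) : ∃ h, toObj k A h = m := ⟨m, rfl⟩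

variable (A) in
/-- The linear map out of `a` given by a linear map out of `A`. -/
noncomputable def objLift {V : Type*} [AddCommGroup V] [Module k V] (f : A →ₗ[k] V) :
    (weakBialgebraObj k A).carrier →ₗ[k] V := f

@[simp] lemma objLift_toObj {V : Type*} [AddCommGroup V] [Module k V] (f : A →ₗ[k] V) (h : A) :
    objLift k A f (toObj k A h) = f h := rfl

lemma obj_hom_ext {M : EnvBimod (baseFrobenius k A)} {f g : weakBialgebraObj k A ⟶ M}
    (h : ∀ a, f.lin (toObj k A a) = g.lin (toObj k A a)) : f = g := hom_ext h

variable (A) in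
/-- The unit `η : j → a`, `p ⊗ q ↦ p ⊓̅ᴸ(q)`. -/
noncomputable def weakBialgebraUnit : bulletUnit (baseFrobenius k A) ⟶ weakBialgebraObj k A :=
  homMk (jLift (((LinearMap.mul k A).compl₁₂ (baseAlgebra k A).val.toLinearMap
      (piLbar k ∘ₗ (baseAlgebra k A).val.toLinearMap)).compr₂ (toObj k A)))
    (fun x => jt_ext₃ fun p q => by
      simp [bulletUnit_l₁, weakBialgebraObj_l₁, mul_assoc])
    (fun x => jt_ext₃ fun p q => by
      simp only [bulletUnit_l₂, jLift_jt, LinearMap.compr₂_apply, LinearMap.compl₁₂_apply,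
        LinearMap.mul_apply', LinearMap.comp_apply, AlgHom.toLinearMap_apply, Subalgebra.coe_val,
        weakBialgebraObj_l₂, MulMemClass.coe_mul, piLbar_mul_base]
      rw [← mul_assoc, base_mul_piLbar, mul_assoc])
    (fun x => jt_ext₃ fun p q => by
      simp only [bulletUnit_r₁, jLift_jt, LinearMap.compr₂_apply, LinearMap.compl₁₂_apply,
        LinearMap.mul_apply', LinearMap.comp_apply, AlgHom.toLinearMap_apply, Subalgebra.coe_val,
        weakBialgebraObj_r₁, MulMemClass.coe_mul]
      rw [mul_assoc, base_mul_piLbar, mul_assoc])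
    (fun x => jt_ext₃ fun p q => by
      simp [bulletUnit_r₂, weakBialgebraObj_r₂, piLbar_mul_base, mul_assoc])

lemma weakBialgebraUnit_jt (p q : baseAlgebra k A) :
    (weakBialgebraUnit k A).lin (jt _ p q) = toObj k A (p * piLbar k (q : A)) :=
  jLift_jt _ p q

lemma comul_base_mul (x : baseAlgebra k A) (h : A) : Coalgebra.comul (R := k) (x * h) =
    (1 ⊗ₜ (x : A)) * Coalgebra.comul (R := k) h := by
  rw [comul_mul, comul_base', mul_assoc, comul_one_mul]

lemma comul_mul_base (x : baseAlgebra k A) (h : A) : Coalgebra.comul (R := k) (h * x) =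
    Coalgebra.comul (R := k) h * (1 ⊗ₜ (x : A)) := by
  rw [comul_mul, comul_base, ← mul_assoc, comul_mul_one]

lemma comul_piLbar_mul (g h : A) : Coalgebra.comul (R := k) (piLbar k g * h) =
    (piLbar k g ⊗ₜ 1) * Coalgebra.comul (R := k) h := by
  rw [comul_mul, comul_piLbar, mul_assoc, comul_one_mul]

lemma comul_mul_piLbar (g h : A) : Coalgebra.comul (R := k) (h * piLbar k g) =
    Coalgebra.comul (R := k) h * (piLbar k g ⊗ₜ 1) := by
  rw [comul_mul, comul_piLbar', ← mul_assoc, comul_mul_one]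

variable (A) in
/-- The canonical epimorphism `A ⊗ A ↠ A ∘ A`. -/
noncomputable def objQuot : A ⊗[k] A →ₗ[k]
    (circ (weakBialgebraObj k A) (weakBialgebraObj k A)).carrier :=
  quot (weakBialgebraObj k A) (weakBialgebraObj k A) ∘ₗ TensorProduct.map (toObj k A) (toObj k A)

lemma objQuot_tmul (g h : A) : objQuot k A (g ⊗ₜ h) = tm (toObj k A g) (toObj k A h) := rfl

lemma objQuot_l₁ (x : baseAlgebra k A) (t : A ⊗[k] A) :
    objQuot k A ((1 ⊗ₜ (x : A)) * t) = (circ _ _).l₁ x (objQuot k A t) := by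
  induction t with
  | zero => simp
  | add a b ha hb => simp only [mul_add, map_add, ha, hb]
  | tmul g h =>
    simp only [Algebra.TensorProduct.tmul_mul_tmul, one_mul, objQuot_tmul, circ_l₁,
      weakBialgebraObj_l₁]

lemma objQuot_l₂ (x : baseAlgebra k A) (t : A ⊗[k] A) :
    objQuot k A ((piLbar k (x : A) ⊗ₜ 1) * t) = (circ _ _).l₂ x (objQuot k A t) := by
  induction t with
  | zero => simp
  | add a b ha hb => simp only [mul_add, map_add, ha, hb]
  | tmul g h =>
    simp only [Algebra.TensorProduct.tmul_mul_tmul, one_mul, objQuot_tmul, circ_l₂,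
      weakBialgebraObj_l₂]

lemma objQuot_r₁ (x : baseAlgebra k A) (t : A ⊗[k] A) :
    objQuot k A (t * (1 ⊗ₜ (x : A))) = (circ _ _).r₁ x (objQuot k A t) := by
  induction t with
  | zero => simp
  | add a b ha hb => simp only [add_mul, map_add, ha, hb]
  | tmul g h =>
    simp only [Algebra.TensorProduct.tmul_mul_tmul, mul_one, objQuot_tmul, circ_r₁,
      weakBialgebraObj_r₁]

lemma objQuot_r₂ (x : baseAlgebra k A) (t : A ⊗[k] A) :
    objQuot k A (t * (piLbar k (x : A) ⊗ₜ 1)) = (circ _ _).r₂ x (objQuot k A t) := by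
  induction t with
  | zero => simp
  | add a b ha hb => simp only [add_mul, map_add, ha, hb]
  | tmul g h =>
    simp only [Algebra.TensorProduct.tmul_mul_tmul, mul_one, objQuot_tmul, circ_r₂,
      weakBialgebraObj_r₂]

variable (A) in
/-- The comultiplication `δ : a → a ∘ a`, the composite of `Δ : A → A ⊗ A` and the canonical
epimorphism `A ⊗ A ↠ A ∘ A`. -/
noncomputable def weakBialgebraComul :
    weakBialgebraObj k A ⟶ circ (weakBialgebraObj k A) (weakBialgebraObj k A) :=
  homMk (objLift k A (objQuot k A ∘ₗ Coalgebra.comul))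
    (fun x m => by
      obtain ⟨h, rfl⟩ := toObj_surjective k m
      rw [weakBialgebraObj_l₁, objLift_toObj, objLift_toObj, LinearMap.comp_apply,
        LinearMap.comp_apply, comul_base_mul, objQuot_l₁])
    (fun x m => by
      obtain ⟨h, rfl⟩ := toObj_surjective k m
      rw [weakBialgebraObj_l₂, objLift_toObj, objLift_toObj, LinearMap.comp_apply,
        LinearMap.comp_apply, comul_piLbar_mul, objQuot_l₂])
    (fun x m => by
      obtain ⟨h, rfl⟩ := toObj_surjective k m
      rw [weakBialgebraObj_r₁, objLift_toObj, objLift_toObj, LinearMap.comp_apply,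
        LinearMap.comp_apply, comul_mul_base, objQuot_r₁])
    (fun x m => by
      obtain ⟨h, rfl⟩ := toObj_surjective k m
      rw [weakBialgebraObj_r₂, objLift_toObj, objLift_toObj, LinearMap.comp_apply,
        LinearMap.comp_apply, comul_mul_piLbar, objQuot_r₂])

lemma weakBialgebraComul_toObj (h : A) :
    (weakBialgebraComul k A).lin (toObj k A h) = objQuot k A (Coalgebra.comul h) := rfl

variable (A) in
/-- The map `g ⊗ h ↦ ⊓ᴿ(g) ⊗ ⊓̅ᴿ(h)` with values in `i`. -/
noncomputable def toUnit : A ⊗[k] A →ₗ[k] (circUnit (baseFrobenius k A)).carrier :=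
  TensorProduct.lift ((utLin (baseFrobenius k A)).compl₁₂ (toBase k A) (toBaseBar k A))

lemma toUnit_tmul (g h : A) : toUnit k A (g ⊗ₜ h) =
    ut (baseFrobenius k A) (toBase k A g) (toBaseBar k A h) := rfl

/-- `⊓ᴿ(h₁) ⊗ ⊓̅ᴿ(h₂) = 1₁ ⊗ ⊓̅ᴿ(h 1₂)`. -/
lemma toUnit_comul (h : A) : toUnit k A (Coalgebra.comul h) =
    ∑ i ∈ oneIdx k A, ut (baseFrobenius k A) (toBase k A i.1) (toBaseBar k A (h * i.2)) := by
  have e : ∀ t : A ⊗[k] A, toUnit k A ((piR k).rTensor A t) = toUnit k A t := by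
    intro t
    induction t with
    | zero => simp
    | add a b ha hb => simp only [map_add, ha, hb]
    | tmul a b =>
      rw [LinearMap.rTensor_tmul, toUnit_tmul, toUnit_tmul]
      congr 1
      exact Subtype.ext (piR_piR k a)
  rw [← e, rTensor_piR, comul_one_eq]
  simp [Finset.mul_sum, toUnit_tmul]

variable (A) in
/-- The counit `ε : a → i`, `h ↦ ⊓ᴿ(h₁) ⊗ ⊓̅ᴿ(h₂)`. -/
noncomputable def weakBialgebraCounit :
    weakBialgebraObj k A ⟶ circUnit (baseFrobenius k A) :=
  homMk (objLift k A (toUnit k A ∘ₗ Coalgebra.comul))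
    (fun x m => by
      obtain ⟨h, rfl⟩ := toObj_surjective k m
      rw [weakBialgebraObj_l₁, objLift_toObj, objLift_toObj, LinearMap.comp_apply,
        LinearMap.comp_apply, toUnit_comul, toUnit_comul]
      simp only [map_sum, circUnit_l₁]
      refine Finset.sum_congr rfl fun i _ => ?_
      congr 1
      apply Subtype.ext
      simp [mul_assoc, piRbar_base_mul])
    (fun x m => by
      obtain ⟨h, rfl⟩ := toObj_surjective k m
      rw [weakBialgebraObj_l₂, objLift_toObj, objLift_toObj, LinearMap.comp_apply,
        LinearMap.comp_apply, toUnit_comul, toUnit_comul]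
      simp only [map_sum, circUnit_l₂]
      refine Finset.sum_congr rfl fun i _ => ?_
      congr 1
      apply Subtype.ext
      simp [mul_assoc, piRbar_piLbar_mul])
    (fun x m => by
      obtain ⟨h, rfl⟩ := toObj_surjective k m
      rw [weakBialgebraObj_r₁, objLift_toObj, objLift_toObj, LinearMap.comp_apply,
        LinearMap.comp_apply, toUnit_comul, toUnit_comul]
      simp only [map_sum, circUnit_r₁]
      have h1 := sum_piLbar k ((utLin (baseFrobenius k A)).compl₁₂ (toBase k A)
        (toBaseBar k A ∘ₗ LinearMap.mulLeft k (h * x)))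
      have h2 := sum_piLbar k ((utLin (baseFrobenius k A)).compl₁₂ (toBase k A)
        (toBaseBar k A ∘ₗ LinearMap.mulRight k (x : A) ∘ₗ LinearMap.mulLeft k h))
      have h3 := sum_mul_base k ((utLin (baseFrobenius k A)).compl₁₂ (toBase k A)
        (toBaseBar k A ∘ₗ LinearMap.mulLeft k h)) x
      simp only [LinearMap.compl₁₂_apply, LinearMap.comp_apply, LinearMap.mulLeft_apply,
        LinearMap.mulRight_apply, utLin_apply] at h1 h2 h3
      have e1 : ∀ g, toBase k A (g * x) = toBase k A g * x := fun g =>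
        Subtype.ext (piR_mul_base k g x)
      have e2 : ∀ g, toBaseBar k A (h * x * piLbar k g) = toBaseBar k A (h * piLbar k g * x) :=
        fun g => by rw [mul_assoc, base_mul_piLbar, mul_assoc]
      have e3 : ∀ g, toBaseBar k A (h * g * x) = toBaseBar k A
          (h * (g * piLbar k ((baseFrobenius k A).nakayamaInv x : A))) := fun g =>
        Subtype.ext ((piRbar_mul_base k (h * g) x).trans (by rw [mul_assoc]; rfl))
      simp only [e1, e2, e3] at h1 h2 h3
      rw [← h1, h3, ← h2])
    (fun x m => by
      obtain ⟨h, rfl⟩ := toObj_surjective k m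
      rw [weakBialgebraObj_r₂, objLift_toObj, objLift_toObj, LinearMap.comp_apply,
        LinearMap.comp_apply, comul_mul_piLbar]
      generalize (Coalgebra.comul (R := k) h) = t
      induction t with
      | zero => simp
      | add a b ha hb => simp only [add_mul, map_add, ha, hb]
      | tmul g h =>
        rw [Algebra.TensorProduct.tmul_mul_tmul, mul_one, toUnit_tmul, toUnit_tmul, circUnit_r₂]
        congr 1
        apply Subtype.ext
        simp [piR_mul_piLbar_base])

lemma weakBialgebraCounit_toObj (h : A) :
    (weakBialgebraCounit k A).lin (toObj k A h) = toUnit k A (Coalgebra.comul h) := rfl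

lemma piL_piRbar (h : A) : piL k (piRbar k h) = piL k h := by
  have h1 := sum_piR k ((LinearMap.lsmul k A).comp (counit (R := k) ∘ₗ
    LinearMap.mulRight k (piRbar k h)))
  have h2 := sum_piR k ((LinearMap.lsmul k A).comp (counit (R := k) ∘ₗ LinearMap.mulRight k h))
  simp only [LinearMap.comp_apply, LinearMap.lsmul_apply, LinearMap.mulRight_apply] at h1 h2
  rw [piL_apply, piL_apply, ← h1, ← h2]
  refine Finset.sum_congr rfl fun i _ => ?_
  rw [← coe_toBase, ← piRbar_base_mul, counit_piRbar]

/-- `⊓ᴸ(h₁) h₂ = h`. -/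
lemma mul_piL_comul (h : A) :
    LinearMap.mul' k A ((piL k).rTensor A (Coalgebra.comul (R := k) h)) = h := by
  obtain ⟨S, hS⟩ := TensorProduct.exists_finset (Coalgebra.comul (R := k) h)
  have h1 := Coalgebra.rTensor_counit_comul (R := k) h
  rw [← comul_one_mul, comul_one_eq, hS] at h1
  have h2 := congrArg (TensorProduct.lid k A) h1
  simp only [Finset.sum_mul, Finset.mul_sum, Algebra.TensorProduct.tmul_mul_tmul, map_sum,
    LinearMap.rTensor_tmul, TensorProduct.lid_tmul, one_smul] at h2
  rw [hS]
  simp only [map_sum, LinearMap.rTensor_tmul, LinearMap.mul'_apply, piL_apply, Finset.sum_mul,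
    smul_mul_assoc]
  exact h2

variable (A) in
lemma sum_snd_mul_piLbar : ∑ i ∈ oneIdx k A, i.2 * piLbar k i.1 = 1 := by
  have h1 := sum_piR k (((LinearMap.mul k A).flip).comp (piLbar k))
  have h2 := sum_piLbar k (((LinearMap.mul k A).flip).comp (piLbar k ∘ₗ piR k))
  simp only [LinearMap.comp_apply, LinearMap.flip_apply, LinearMap.mul_apply'] at h1 h2
  rw [← h1, ← h2]
  have h3 : ∀ i : A × A, piLbar k i.2 * piLbar k (piR k i.1) =
      piLbar k (piR k i.1 * piR k (piLbar k i.2)) := by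
    intro i
    have := piLbar_mul_base k (toBase k A i.1) (toBase k A (piLbar k i.2))
    rw [coe_toBase, coe_toBase, piLbar_piR_of k (comul_piLbar k i.2)] at this
    exact this.symm
  have h4 := sum_piLbar k ((LinearMap.mul k A).compl₁₂ (piR k) (piR k))
  simp only [LinearMap.compl₁₂_apply, LinearMap.mul_apply'] at h4
  simp only [h3]
  rw [← map_sum, h4]
  have h5 := (baseFrobenius k A).sum_mul
  have h6 := sum_baseFrobenius k (LinearMap.mul k (baseAlgebra k A))
  simp only [LinearMap.mul_apply'] at h6
  rw [h6] at h5
  have h7 := congrArg (baseAlgebra k A).val h5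
  simp only [map_sum, map_mul, Subalgebra.coe_val, coe_toBase, map_one] at h7
  rw [h7, piLbar_one]

lemma tm_ut_left (p q : baseAlgebra k A) (g : A) :
    tm (ut (baseFrobenius k A) p q) (toObj k A g) =
      tm (ut (baseFrobenius k A) 1 1) (toObj k A (piL k (q : A) * g * piLbar k (p : A))) := by
  have h : ut (baseFrobenius k A) p q = (circUnit (baseFrobenius k A)).l₁ q
      ((circUnit (baseFrobenius k A)).r₁ p (ut (baseFrobenius k A) 1 1)) := by
    rw [circUnit_r₁, circUnit_l₁, one_mul, mul_one]
  rw [h, tm_l₁, tm_r₁, r₂_l₂, weakBialgebraObj_r₂, weakBialgebraObj_l₂, piLbar_nakayamaInv,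
    mul_assoc]

lemma tm_ut_right (p q : baseAlgebra k A) (g : A) :
    tm (toObj k A g) (ut (baseFrobenius k A) p q) =
      tm (toObj k A (q * (g * p))) (ut (baseFrobenius k A) 1 1) := by
  rw [← weakBialgebraObj_l₁, ← weakBialgebraObj_r₁, tm_l₁, tm_r₁, r₂_l₂, circUnit_r₂, circUnit_l₂,
    FrobeniusSeparability.nakayama_nakayamaInv, one_mul, mul_one]

/-- The comonoid `(a, δ, ε)` in `(bim(R ⊗ Rᵒᵖ), ∘, i)`. -/
noncomputable instance : ComonObj (weakBialgebraObj k A) where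
  counit := weakBialgebraCounit k A
  comul := weakBialgebraComul k A
  counit_comul := obj_hom_ext k fun h => by
    rw [comp_lin, weakBialgebraComul_toObj, leftUnitor_inv_lin]
    have key : ∀ t : A ⊗[k] A,
        (weakBialgebraCounit k A ▷ weakBialgebraObj k A).lin (objQuot k A t) =
        tm (ut (baseFrobenius k A) 1 1) (toObj k A (∑ i ∈ oneIdx k A,
          LinearMap.mul' k A ((piL k).rTensor A (t * (i.2 ⊗ₜ 1))) * piLbar k i.1)) := by
      intro t
      induction t with
      | zero => simp [tm_zero_right]
      | add a b ha hb =>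
        simp only [add_mul, map_add, ha, hb, Finset.sum_add_distrib, tm_add_right]
      | tmul g h =>
        rw [objQuot_tmul, whiskerRight_tm, weakBialgebraCounit_toObj, toUnit_comul, tm_sum_left,
          Finset.sum_congr rfl fun i _ => tm_ut_left k _ _ h, ← tm_sum_right, ← map_sum]
        simp only [coe_toBase, coe_toBaseBar, piL_piRbar, Algebra.TensorProduct.tmul_mul_tmul,
          mul_one, LinearMap.rTensor_tmul, LinearMap.mul'_apply]
        have h1 := sum_piR k ((LinearMap.mul k A).flip.compl₁₂ (piLbar k)
          (LinearMap.mulRight k h ∘ₗ piL k ∘ₗ LinearMap.mulLeft k g))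
        simp only [LinearMap.compl₁₂_apply, LinearMap.comp_apply, LinearMap.mulLeft_apply,
          LinearMap.mulRight_apply, LinearMap.flip_apply, LinearMap.mul_apply'] at h1
        rw [h1]
    rw [key]
    let B : A →ₗ[k] A →ₗ[k] A := ((LinearMap.mul k A).flip).compl₁₂ (piLbar k)
      (LinearMap.mul' k A ∘ₗ (piL k).rTensor A ∘ₗ
        LinearMap.mulLeft k (Coalgebra.comul (R := k) h) ∘ₗ (TensorProduct.mk k A A).flip 1)
    have hB : ∀ u v, B u v = LinearMap.mul' k A ((piL k).rTensor A
      (Coalgebra.comul (R := k) h * (v ⊗ₜ 1))) * piLbar k u := fun _ _ => rfl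
    have h1 := sum_piLbar k B
    simp only [hB] at h1
    rw [← h1]
    simp only [← comul_mul_piLbar, mul_piL_comul]
    have h2 := sum_piLbar k (((LinearMap.mul k A).flip).compl₁₂ (piLbar k)
      (LinearMap.mulLeft k h))
    simp only [LinearMap.compl₁₂_apply, LinearMap.mulLeft_apply, LinearMap.flip_apply,
      LinearMap.mul_apply'] at h2
    rw [h2]
    simp only [mul_assoc]
    rw [← Finset.mul_sum, sum_snd_mul_piLbar, mul_one]
  comul_counit := obj_hom_ext k fun h => by
    rw [comp_lin, weakBialgebraComul_toObj, rightUnitor_inv_lin]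
    have key : ∀ t : A ⊗[k] A,
        (weakBialgebraObj k A ◁ weakBialgebraCounit k A).lin (objQuot k A t) =
        tm (toObj k A (TensorProduct.rid k A ((Coalgebra.counit (R := k)).lTensor A
          (Coalgebra.comul (R := k) (1 : A) * t * Coalgebra.comul (R := k) (1 : A)))))
          (ut (baseFrobenius k A) 1 1) := by
      intro t
      induction t with
      | zero => simp [tm_zero_left]
      | add a b ha hb => simp only [mul_add, add_mul, map_add, ha, hb, tm_add_left]
      | tmul g h =>
        rw [objQuot_tmul, whiskerLeft_tm, weakBialgebraCounit_toObj, toUnit_comul, tm_sum_right,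
          Finset.sum_congr rfl fun i _ => tm_ut_right k _ _ g, ← tm_sum_left, ← map_sum]
        simp only [coe_toBase, coe_toBaseBar]
        have h1 := sum_piR k ((LinearMap.mul k A).flip.compl₁₂ (LinearMap.mulLeft k g)
          (piRbar k ∘ₗ LinearMap.mulLeft k h))
        simp only [LinearMap.compl₁₂_apply, LinearMap.comp_apply, LinearMap.mulLeft_apply,
          LinearMap.flip_apply, LinearMap.mul_apply'] at h1
        rw [h1, comul_one_eq]
        simp only [Finset.sum_mul, Finset.mul_sum, Algebra.TensorProduct.tmul_mul_tmul, map_sum,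
          LinearMap.lTensor_tmul, TensorProduct.rid_tmul, piRbar_apply, smul_mul_assoc, mul_assoc]
    rw [key, comul_one_mul, comul_mul_one, Coalgebra.lTensor_counit_comul]
    simp
  comul_assoc := obj_hom_ext k fun h => by
    let Q : A ⊗[k] (A ⊗[k] A) →ₗ[k] (circ (weakBialgebraObj k A)
        (circ (weakBialgebraObj k A) (weakBialgebraObj k A))).carrier :=
      quot _ _ ∘ₗ TensorProduct.map (toObj k A) (objQuot k A)
    have key₁ : ∀ t : A ⊗[k] A, (weakBialgebraObj k A ◁ weakBialgebraComul k A).lin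
        (objQuot k A t) = Q ((Coalgebra.comul (R := k)).lTensor A t) := by
      intro t
      induction t with
      | zero => simp
      | add a b ha hb => simp only [map_add, ha, hb]
      | tmul g h =>
        rw [objQuot_tmul, whiskerLeft_tm, weakBialgebraComul_toObj]
        rfl
    have key₃ : ∀ (t : A ⊗[k] A) (h : A), (α_ (weakBialgebraObj k A) (weakBialgebraObj k A)
        (weakBialgebraObj k A)).hom.lin (tm (objQuot k A t) (toObj k A h)) =
        Q (TensorProduct.assoc k A A A (t ⊗ₜ h)) := by
      intro t h
      induction t with
      | zero => simp [tm_zero_left]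
      | add a b ha hb => simp only [map_add, ha, hb, TensorProduct.add_tmul, tm_add_left]
      | tmul a b => exact associator_hom_tm _ _ _
    have key₂ : ∀ t : A ⊗[k] A, (α_ (weakBialgebraObj k A) (weakBialgebraObj k A)
        (weakBialgebraObj k A)).hom.lin ((weakBialgebraComul k A ▷ weakBialgebraObj k A).lin
        (objQuot k A t)) = Q (TensorProduct.assoc k A A A
          ((Coalgebra.comul (R := k)).rTensor A t)) := by
      intro t
      induction t with
      | zero => simp
      | add a b ha hb => simp only [map_add, ha, hb]
      | tmul g h =>
        rw [objQuot_tmul, whiskerRight_tm, weakBialgebraComul_toObj, key₃]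
        rfl
    rw [comp_lin, comp_lin, comp_lin, weakBialgebraComul_toObj, key₁, key₂,
      Coalgebra.coassoc_apply]

end comonoid

section functionals

open Coalgebra

variable (k : Type u) (A : Type v) [Field k] [Ring A] [Algebra k A] [Coalgebra k A]

/-- A `k`-coalgebra is coseparable if its comultiplication admits a retraction `r : A ⊗ A → A`
that is a bicomodule homomorphism: `Δ r(g ⊗ h) = g₁ ⊗ r(g₂ ⊗ h) = r(g ⊗ h₁) ⊗ h₂`. -/
def IsCoseparableCoalgebra : Prop :=
  ∃ r : A ⊗[k] A →ₗ[k] A, r ∘ₗ comul = LinearMap.id ∧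
    comul ∘ₗ r = r.lTensor A ∘ₗ (TensorProduct.assoc k A A A).toLinearMap ∘ₗ
      (comul (R := k)).rTensor A ∧
    comul ∘ₗ r = r.rTensor A ∘ₗ (TensorProduct.assoc k A A A).symm.toLinearMap ∘ₗ
      (comul (R := k)).lTensor A

variable {k A}

/-- `h₁ τ(h₂) = ⊓ᴸ(h₁) τ(h₂)` for all `h`, and `τ ∘ ⊓ᴸ = ε`. -/
structure IsNormalizedLeftCointegralFunctional (τ : A →ₗ[k] k) : Prop where
  cointegral : ∀ h : A, TensorProduct.rid k A (τ.lTensor A (comul (R := k) h)) =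
    TensorProduct.rid k A (TensorProduct.map (piL k) τ (comul (R := k) h))
  normalized : τ ∘ₗ piL k = counit

/-- `τ(h₁) h₂ = τ(h₁) ⊓ᴿ(h₂)` for all `h`, and `τ ∘ ⊓ᴿ = ε`. -/
structure IsNormalizedRightCointegralFunctional (τ : A →ₗ[k] k) : Prop where
  cointegral : ∀ h : A, TensorProduct.lid k A (τ.rTensor A (comul (R := k) h)) =
    TensorProduct.lid k A (TensorProduct.map τ (piR k) (comul (R := k) h))
  normalized : τ ∘ₗ piR k = counit

end functionals

end coseparability

/-!
A functional `τ` on `A` is a left cointegral when `h₁ τ(h₂)` always lies in the image of `⊓ᴸ`, and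
it is normalized when `τ ∘ ⊓ᴸ = ε`. All the assertions are compared with the existence of such a
functional, or of its mirror image on the right.

For the coalgebra, a bicomodule retraction of `Δ` is the same as a bilinear form `Φ` with
`h₁ Φ(h₂, g) = Φ(h, g₁) g₂` and `Φ(h₁, h₂) = ε(h)` (`isCoseparableCoalgebra_iff`). From such a form
one gets the functional `τ(h) = Φ(h 1₁, 1₂)`; conversely `Φ(h, g) = τ(h S(g))`. The only place where
the antipode enters is this converse (and its bimodule version), and there it has to satisfy
`S(h₁) ⊓ᴸ(h₂) = S(h) = ⊓ᴿ(h₁) S(h₂)` as well. A given antipode `σ` need not do so, but the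
convolution product `S = σ * id * σ` does (`exists_isRegularAntipode`).

A functional can be made balanced over the base algebra `R` by averaging it over the separability
element, `τ(h) = ∑ τ'(eᵢ h fᵢ)` (`exists_balanced`). Balancedness is what makes the formulas
`r(h ∘ g) = h₁ τ(h₂ S(g))` and `θ(h ∘ (p ⊗ q)) = p ⊗ ⊓ᴿ((hq)₁ τ((hq)₂))` well defined on the
product `∘` of bimodules: a linear map on `M ⊗ N` that is balanced over `R` descends to `M ∘ N`
(`EnvBimod.comp_incl_tm`).

In the other direction, the inclusion of `a ∘ a` in `A ⊗ A` sends `g ∘ h` to `Δ(1) (g ⊗ h) Δ(1)`, so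
that colinearity of `r` gives `Δ(ρ(h)) = h₁ ⊗ ρ(h₂) = ρ(h) 1₁ ⊗ 1₂` for `ρ(h) = r(h ∘ 1)`, and
`ε ∘ ρ` is a normalized left cointegral. Similarly, colinearity of a left cointegral
`θ : a ∘ j → j` over `j` forces `θ(h ∘ (1 ⊗ 1)) = 1 ⊗ w(h)`, colinearity over `a` gives
`⊓̅ᴸ(w(h)) = h₁ w(h₂)`, and the functional is `ε ∘ w`.
-/

/-! ### Linear expressions -/

section linearity

variable {k : Type*} [Field k] {A U V W : Type*} [Ring A] [Algebra k A]
  [AddCommGroup U] [Module k U] [AddCommGroup V] [Module k V] [AddCommGroup W] [Module k W]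

-- Sweedler sums are manipulated as multilinear expressions in the tensor legs, whose linearity in
-- each variable is left to `fun_prop`.
attribute [fun_prop] IsLinearMap

@[fun_prop] lemma isLinearMap_id : IsLinearMap k (fun x : V => x) :=
  ⟨fun _ _ => rfl, fun _ _ => rfl⟩

@[fun_prop] lemma isLinearMap_comp {f : V → W} {g : U → V} (hf : IsLinearMap k f)
    (hg : IsLinearMap k g) : IsLinearMap k (fun x => f (g x)) :=
  ⟨fun x y => by rw [hg.map_add, hf.map_add], fun c x => by rw [hg.map_smul, hf.map_smul]⟩

@[fun_prop] lemma isLinearMap_coe (f : V →ₗ[k] W) : IsLinearMap k (fun x => f x) := f.isLinear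

@[fun_prop] lemma isLinearMap_coe_left (B : V →ₗ[k] W →ₗ[k] U) (w : W) {g : A → V}
    (hg : IsLinearMap k g) : IsLinearMap k (fun x => B (g x) w) :=
  ⟨fun x y => by simp [hg.map_add], fun c x => by simp [hg.map_smul]⟩

@[fun_prop] lemma isLinearMap_mul_left (a : A) {g : V → A} (hg : IsLinearMap k g) :
    IsLinearMap k (fun x => a * g x) :=
  ⟨fun x y => by rw [hg.map_add, mul_add], fun c x => by rw [hg.map_smul, mul_smul_comm]⟩

@[fun_prop] lemma isLinearMap_mul_right (a : A) {g : V → A} (hg : IsLinearMap k g) :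
    IsLinearMap k (fun x => g x * a) :=
  ⟨fun x y => by rw [hg.map_add, add_mul], fun c x => by rw [hg.map_smul, smul_mul_assoc]⟩

@[fun_prop] lemma isLinearMap_smul_left (v : V) {g : W → k} (hg : IsLinearMap k g) :
    IsLinearMap k (fun x => g x • v) :=
  ⟨fun x y => by rw [hg.map_add, add_smul], fun c x => by
    rw [hg.map_smul, smul_eq_mul, mul_smul]⟩

@[fun_prop] lemma isLinearMap_smul_right (c : k) {g : W → V} (hg : IsLinearMap k g) :
    IsLinearMap k (fun x => c • g x) :=
  ⟨fun x y => by rw [hg.map_add, smul_add], fun d x => by rw [hg.map_smul, smul_comm]⟩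

@[fun_prop] lemma isLinearMap_tmul_left (w : W) {g : U → V} (hg : IsLinearMap k g) :
    IsLinearMap k (fun x => g x ⊗ₜ[k] w) :=
  ⟨fun x y => by rw [hg.map_add, TensorProduct.add_tmul], fun c x => by
    rw [hg.map_smul, TensorProduct.smul_tmul']⟩

@[fun_prop] lemma isLinearMap_tmul_right (v : V) {g : U → W} (hg : IsLinearMap k g) :
    IsLinearMap k (fun x => v ⊗ₜ[k] g x) :=
  ⟨fun x y => by rw [hg.map_add, TensorProduct.tmul_add], fun c x => by
    rw [hg.map_smul, TensorProduct.tmul_smul]⟩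

@[fun_prop] lemma isLinearMap_sum {ι : Type*} (s : Finset ι) {g : ι → U → V}
    (hg : ∀ i, IsLinearMap k (g i)) : IsLinearMap k (fun x => ∑ i ∈ s, g i x) :=
  ⟨fun x y => by simp only [(hg _).map_add, Finset.sum_add_distrib], fun c x => by
    simp only [(hg _).map_smul, Finset.smul_sum]⟩

/-- A bilinear expression extends to the tensor product. -/
lemma exists_linearMap_tmul (f : U → V → W)
    (hl : ∀ b, IsLinearMap k (fun a => f a b) := by intros; fun_prop)
    (hr : ∀ a, IsLinearMap k (fun b => f a b) := by intros; fun_prop) :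
    ∃ F : U ⊗[k] V →ₗ[k] W, ∀ a b, F (a ⊗ₜ b) = f a b :=
  ⟨TensorProduct.lift (LinearMap.mk₂ k f (fun a b c => (hl c).map_add a b)
    (fun c a b => (hl b).map_smul c a) (fun a b c => (hr a).map_add b c)
    (fun c a b => (hr a).map_smul c b)), fun _ _ => rfl⟩

/-- A trilinear expression extends to the tensor product in its last two arguments. -/
lemma exists_linearMap_tmul₃ {U' : Type*} [AddCommGroup U'] [Module k U'] (f : U' → U → V → W)
    (h₁ : ∀ b c, IsLinearMap k (fun a => f a b c) := by intros; fun_prop)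
    (h₂ : ∀ a c, IsLinearMap k (fun b => f a b c) := by intros; fun_prop)
    (h₃ : ∀ a b, IsLinearMap k (fun c => f a b c) := by intros; fun_prop) :
    ∃ F : U' →ₗ[k] U ⊗[k] V →ₗ[k] W, ∀ a b c, F a (b ⊗ₜ c) = f a b c := by
  choose F hF using fun a => exists_linearMap_tmul (k := k) (f a) (h₂ a) (h₃ a)
  have hlin : ∀ t : U ⊗[k] V, IsLinearMap k (fun a => F a t) := by
    intro t
    induction t with
    | zero => simp only [map_zero]; exact ⟨by simp, by simp⟩
    | add x y hx hy =>
      simp only [map_add]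
      exact ⟨fun a b => by rw [hx.map_add, hy.map_add]; abel,
        fun c a => by rw [hx.map_smul, hy.map_smul, smul_add]⟩
    | tmul b c => simp only [hF]; exact h₁ b c
  exact ⟨⟨⟨F, fun a b => LinearMap.ext fun t => (hlin t).map_add a b⟩,
    fun c a => LinearMap.ext fun t => (hlin t).map_smul c a⟩, hF⟩

end linearity

/-! ### Sweedler sums in weak bialgebras -/

section sweedler

open Coalgebra

variable (k : Type u) {A : Type v} [Field k] [Ring A] [Algebra k A] [Coalgebra k A]

/-- A finite set of pairs `(h₁, h₂)` with `Δ(h) = ∑ h₁ ⊗ h₂`. -/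
noncomputable def comulIdx (h : A) : Finset (A × A) :=
  (TensorProduct.exists_finset (comul (R := k) h)).choose

lemma comul_eq_sum (h : A) : comul (R := k) h = ∑ p ∈ comulIdx k h, p.1 ⊗ₜ[k] p.2 :=
  (TensorProduct.exists_finset (comul (R := k) h)).choose_spec

variable {V : Type*} [AddCommGroup V] [Module k V]

lemma sum_comulIdx (F : A ⊗[k] A →ₗ[k] V) (h : A) :
    ∑ p ∈ comulIdx k h, F (p.1 ⊗ₜ p.2) = F (comul h) := by
  rw [comul_eq_sum, map_sum]

lemma sum_counit_smul_snd (h : A) : ∑ p ∈ comulIdx k h, counit (R := k) p.1 • p.2 = h := by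
  have := congrArg (TensorProduct.lid k A) (Coalgebra.rTensor_counit_comul (R := k) h)
  rw [comul_eq_sum] at this
  simpa using this

lemma sum_counit_smul_fst (h : A) : ∑ p ∈ comulIdx k h, counit (R := k) p.2 • p.1 = h := by
  have := congrArg (TensorProduct.rid k A) (Coalgebra.lTensor_counit_comul (R := k) h)
  rw [comul_eq_sum] at this
  simpa using this

/-- `(h₁)₁ ⊗ (h₁)₂ ⊗ h₂ = h₁ ⊗ (h₂)₁ ⊗ (h₂)₂`, for trilinear expressions. -/
lemma sum_comulIdx_coassoc (h : A) (f : A → A → A → V)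
    (h₁ : ∀ b c, IsLinearMap k (fun a => f a b c) := by intros; fun_prop)
    (h₂ : ∀ a c, IsLinearMap k (fun b => f a b c) := by intros; fun_prop)
    (h₃ : ∀ a b, IsLinearMap k (fun c => f a b c) := by intros; fun_prop) :
    ∑ p ∈ comulIdx k h, ∑ q ∈ comulIdx k p.1, f q.1 q.2 p.2 =
      ∑ p ∈ comulIdx k h, ∑ q ∈ comulIdx k p.2, f p.1 q.1 q.2 := by
  obtain ⟨F, hF⟩ := exists_linearMap_tmul₃ (k := k) f h₁ h₂ h₃
  have h := congrArg (TensorProduct.lift F) (Coalgebra.coassoc_apply (R := k) h)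
  rw [comul_eq_sum] at h
  simp only [map_sum, LinearMap.rTensor_tmul, LinearMap.lTensor_tmul, comul_eq_sum,
    TensorProduct.sum_tmul, TensorProduct.tmul_sum, TensorProduct.assoc_tmul,
    TensorProduct.lift.tmul, hF] at h
  exact h

namespace WeakBialgebra

/-- A bilinear expression in `h₁`, `h₂` can be computed from any expression of `Δ(h)`. -/
lemma sum_comulIdx_eq (f : A → A → V) {h : A} {ι : Type*} {s : Finset ι} {a b : ι → A}
    (e : comul (R := k) h = ∑ i ∈ s, a i ⊗ₜ[k] b i)
    (hl : ∀ b, IsLinearMap k (fun a => f a b) := by intros; fun_prop)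
    (hr : ∀ a, IsLinearMap k (fun b => f a b) := by intros; fun_prop) :
    ∑ p ∈ comulIdx k h, f p.1 p.2 = ∑ i ∈ s, f (a i) (b i) := by
  obtain ⟨F, hF⟩ := exists_linearMap_tmul (k := k) f hl hr
  simp only [← hF]
  rw [sum_comulIdx, e, map_sum]

lemma sum_comulIdx_one (f : A → A → V)
    (hl : ∀ b, IsLinearMap k (fun a => f a b) := by intros; fun_prop)
    (hr : ∀ a, IsLinearMap k (fun b => f a b) := by intros; fun_prop) :
    ∑ p ∈ comulIdx k (1 : A), f p.1 p.2 = ∑ i ∈ oneIdx k A, f i.1 i.2 :=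
  sum_comulIdx_eq k f (comul_one_eq k A) hl hr

variable [WeakBialgebra k A]

lemma sum_comulIdx_mul (f : A → A → V) (g h : A)
    (hl : ∀ b, IsLinearMap k (fun a => f a b) := by intros; fun_prop)
    (hr : ∀ a, IsLinearMap k (fun b => f a b) := by intros; fun_prop) :
    ∑ p ∈ comulIdx k (g * h), f p.1 p.2 =
      ∑ p ∈ comulIdx k g, ∑ q ∈ comulIdx k h, f (p.1 * q.1) (p.2 * q.2) := by
  rw [← Finset.sum_product' (f := fun p q : A × A => f (p.1 * q.1) (p.2 * q.2))]
  refine sum_comulIdx_eq k f ?_ hl hr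
  rw [comul_mul, comul_eq_sum k g, comul_eq_sum k h, Finset.sum_mul_sum, ← Finset.sum_product']
  simp

/-- `Δ(1₁) ⊗ 1₂ = 1₁ ⊗ 1₂ 1'₁ ⊗ 1'₂`. -/
lemma sum_oneIdx_comul_fst (f : A → A → A → V)
    (h₁ : ∀ b c, IsLinearMap k (fun a => f a b c) := by intros; fun_prop)
    (h₂ : ∀ a c, IsLinearMap k (fun b => f a b c) := by intros; fun_prop)
    (h₃ : ∀ a b, IsLinearMap k (fun c => f a b c) := by intros; fun_prop) :
    ∑ i ∈ oneIdx k A, ∑ q ∈ comulIdx k i.1, f q.1 q.2 i.2 =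
      ∑ i ∈ oneIdx k A, ∑ j ∈ oneIdx k A, f i.1 (i.2 * j.1) j.2 := by
  obtain ⟨F, hF⟩ := exists_linearMap_tmul₃ (k := k) (fun c a b => f a b c)
    (fun a b => h₃ a b) (fun c b => h₁ b c) (fun c a => h₂ a c)
  simpa [comul_eq_sum, LinearMap.sum_apply, hF] using sum_comul_fst k F.flip

/-- `1₁ ⊗ Δ(1₂) = 1₁ ⊗ 1₂ 1'₁ ⊗ 1'₂`. -/
lemma sum_oneIdx_comul_snd (f : A → A → A → V)
    (h₁ : ∀ b c, IsLinearMap k (fun a => f a b c) := by intros; fun_prop)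
    (h₂ : ∀ a c, IsLinearMap k (fun b => f a b c) := by intros; fun_prop)
    (h₃ : ∀ a b, IsLinearMap k (fun c => f a b c) := by intros; fun_prop) :
    ∑ i ∈ oneIdx k A, ∑ q ∈ comulIdx k i.2, f i.1 q.1 q.2 =
      ∑ i ∈ oneIdx k A, ∑ j ∈ oneIdx k A, f i.1 (i.2 * j.1) j.2 := by
  obtain ⟨F, hF⟩ := exists_linearMap_tmul₃ (k := k) f h₁ h₂ h₃
  simpa [comul_eq_sum, hF] using sum_comul_snd k F

/-- `Δ(x h) = h₁ ⊗ x h₂` for `x` in the base algebra. -/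
lemma sum_comulIdx_base_mul (f : A → A → V) (x : baseAlgebra k A) (h : A)
    (hl : ∀ b, IsLinearMap k (fun a => f a b) := by intros; fun_prop)
    (hr : ∀ a, IsLinearMap k (fun b => f a b) := by intros; fun_prop) :
    ∑ p ∈ comulIdx k (x * h), f p.1 p.2 = ∑ p ∈ comulIdx k h, f p.1 (x * p.2) :=
  sum_comulIdx_eq k f (by
    rw [comul_base_mul, comul_eq_sum, Finset.mul_sum]
    simp only [Algebra.TensorProduct.tmul_mul_tmul, one_mul]) hl hr

/-- `Δ(h x) = h₁ ⊗ h₂ x` for `x` in the base algebra. -/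
lemma sum_comulIdx_mul_base (f : A → A → V) (x : baseAlgebra k A) (h : A)
    (hl : ∀ b, IsLinearMap k (fun a => f a b) := by intros; fun_prop)
    (hr : ∀ a, IsLinearMap k (fun b => f a b) := by intros; fun_prop) :
    ∑ p ∈ comulIdx k (h * x), f p.1 p.2 = ∑ p ∈ comulIdx k h, f p.1 (p.2 * x) :=
  sum_comulIdx_eq k f (by
    rw [comul_mul_base, comul_eq_sum, Finset.sum_mul]
    simp only [Algebra.TensorProduct.tmul_mul_tmul, mul_one]) hl hr

/-- `Δ(y h) = y h₁ ⊗ h₂` for `y` in the image of `⊓̅ᴸ`. -/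
lemma sum_comulIdx_piLbar_mul (f : A → A → V) (g h : A)
    (hl : ∀ b, IsLinearMap k (fun a => f a b) := by intros; fun_prop)
    (hr : ∀ a, IsLinearMap k (fun b => f a b) := by intros; fun_prop) :
    ∑ p ∈ comulIdx k (piLbar k g * h), f p.1 p.2 =
      ∑ p ∈ comulIdx k h, f (piLbar k g * p.1) p.2 :=
  sum_comulIdx_eq k f (by
    rw [comul_piLbar_mul, comul_eq_sum, Finset.mul_sum]
    simp only [Algebra.TensorProduct.tmul_mul_tmul, one_mul]) hl hr

/-- `Δ(h y) = h₁ y ⊗ h₂` for `y` in the image of `⊓̅ᴸ`. -/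
lemma sum_comulIdx_mul_piLbar (f : A → A → V) (g h : A)
    (hl : ∀ b, IsLinearMap k (fun a => f a b) := by intros; fun_prop)
    (hr : ∀ a, IsLinearMap k (fun b => f a b) := by intros; fun_prop) :
    ∑ p ∈ comulIdx k (h * piLbar k g), f p.1 p.2 =
      ∑ p ∈ comulIdx k h, f (p.1 * piLbar k g) p.2 :=
  sum_comulIdx_eq k f (by
    rw [comul_mul_piLbar, comul_eq_sum, Finset.sum_mul]
    simp only [Algebra.TensorProduct.tmul_mul_tmul, mul_one]) hl hr

/-- `x h₁ ⊗ h₂ = h₁ ⊗ ⊓̅ᴸ(x) h₂` for `x` in the base algebra. -/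
lemma sum_comulIdx_base_mul_fst (f : A → A → V) (x : baseAlgebra k A) (h : A)
    (hl : ∀ b, IsLinearMap k (fun a => f a b) := by intros; fun_prop)
    (hr : ∀ a, IsLinearMap k (fun b => f a b) := by intros; fun_prop) :
    ∑ p ∈ comulIdx k h, f (x * p.1) p.2 =
      ∑ p ∈ comulIdx k h, f p.1 (piLbar k (x : A) * p.2) := by
  obtain ⟨F, hF⟩ := exists_linearMap_tmul (k := k) f hl hr
  have e : ((x : A) ⊗ₜ 1) * comul (R := k) h = (1 ⊗ₜ piLbar k (x : A)) * comul (R := k) h := by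
    rw [← comul_one_mul, ← mul_assoc, ← mul_assoc, base_tmul_mul]
  have := congrArg F e
  rw [comul_eq_sum] at this
  simpa [Finset.mul_sum, hF] using this

/-- `ε(h g₁) g₂ = ⊓̅ᴸ(h) g`. -/
lemma sum_counit_mul_fst_smul (h g : A) :
    ∑ p ∈ comulIdx k g, counit (R := k) (h * p.1) • p.2 = piLbar k h * g := by
  have := piLbar_mul k h g
  rw [comul_eq_sum] at this
  simpa using this

/-- `g₁ ε(g₂ h) = g ⊓̅ᴿ(h)`. -/
lemma sum_counit_snd_mul_smul (g h : A) :
    ∑ p ∈ comulIdx k g, counit (R := k) (p.2 * h) • p.1 = g * piRbar k h := by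
  have := mul_piRbar k g h
  rw [comul_eq_sum] at this
  simpa using this

/-- `h₁ ⊓ᴿ(h₂) = h`. -/
lemma sum_mul_piR (h : A) : ∑ p ∈ comulIdx k h, p.1 * piR k p.2 = h := by
  have := Coalgebra.lTensor_counit_comul (R := k) h
  rw [← comul_mul_one, comul_eq_sum, comul_one_eq] at this
  replace this := congrArg (TensorProduct.rid k A) this
  simp only [Finset.sum_mul, Finset.mul_sum, Algebra.TensorProduct.tmul_mul_tmul, map_sum,
    LinearMap.lTensor_tmul, TensorProduct.rid_tmul, one_smul] at this
  simp only [piR_apply, Finset.mul_sum, mul_smul_comm]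
  rw [Finset.sum_comm]
  exact this

/-- `⊓ᴸ(h₁) h₂ = h`. -/
lemma sum_piL_mul (h : A) : ∑ p ∈ comulIdx k h, piL k p.1 * p.2 = h := by
  have := mul_piL_comul k h
  rw [comul_eq_sum] at this
  simpa using this

/-- `h₂ ⊓̅ᴸ(h₁) = h`. -/
lemma sum_mul_piLbar (h : A) : ∑ p ∈ comulIdx k h, p.2 * piLbar k p.1 = h := by
  have := Coalgebra.rTensor_counit_comul (R := k) h
  rw [← comul_mul_one, comul_eq_sum, comul_one_eq] at this
  replace this := congrArg (TensorProduct.lid k A) this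
  simp only [Finset.sum_mul, Finset.mul_sum, Algebra.TensorProduct.tmul_mul_tmul, map_sum,
    LinearMap.rTensor_tmul, TensorProduct.lid_tmul, one_smul] at this
  simp only [piLbar_apply, Finset.mul_sum, mul_smul_comm]
  rw [Finset.sum_comm]
  exact this

lemma counit_piR_mul (a c : A) : counit (R := k) (piR k a * c) = counit (R := k) (a * c) := by
  rw [counit_mul_one' k a c, piR_apply]
  simp [Finset.sum_mul]

lemma counit_piLbar_mul (a c : A) :
    counit (R := k) (piLbar k a * c) = counit (R := k) (a * c) := by
  rw [counit_mul_one k a c, piLbar_apply]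
  simp [Finset.sum_mul]

lemma counit_piLbar (a : A) : counit (R := k) (piLbar k a) = counit (R := k) a := by
  simpa using counit_piLbar_mul k a 1

lemma counit_piL (a : A) : counit (R := k) (piL k a) = counit (R := k) a := by
  simpa using counit_mul_piL k 1 a

lemma piL_piLbar (h : A) : piL k (piLbar k h) = piLbar k h := by
  change TensorProduct.lid k A ((counit (R := k)).rTensor A
    (comul (R := k) (1 : A) * (piLbar k h ⊗ₜ 1))) = piLbar k h
  rw [← comul_piLbar', Coalgebra.rTensor_counit_comul]
  simp

lemma piLbar_piR_piL (h : A) : piLbar k (piR k (piL k h)) = piL k h :=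
  piLbar_piR_of k (comul_piL k h)

/-- `⊓̅ᴿ` fixes the base algebra. -/
lemma piRbar_base (x : baseAlgebra k A) : piRbar k (x : A) = x := by
  have e : piRbar k (1 : A) = 1 := by
    rw [piRbar_apply]; simpa using sum_counit_right k A
  simpa [e] using piRbar_base_mul k x 1

lemma base_mul_piL (x : baseAlgebra k A) (h : A) : (x : A) * piL k h = piL k h * x := by
  rw [← piLbar_piR_piL, base_mul_piLbar]

/-- Replace `1₁` by `⊓ᴿ(1₁)`. -/
lemma sum_piR_fst (f : A → A → V)
    (hl : ∀ b, IsLinearMap k (fun a => f a b) := by intros; fun_prop)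
    (hr : ∀ a, IsLinearMap k (fun b => f a b) := by intros; fun_prop) :
    ∑ i ∈ oneIdx k A, f (piR k i.1) i.2 = ∑ i ∈ oneIdx k A, f i.1 i.2 :=
  sum_piR k (LinearMap.mk₂ k f (fun a b c => (hl c).map_add a b)
    (fun c a b => (hl b).map_smul c a) (fun a b c => (hr a).map_add b c)
    (fun c a b => (hr a).map_smul c b))

/-- Replace `1₂` by `⊓̅ᴸ(1₂)`. -/
lemma sum_piLbar_snd (f : A → A → V)
    (hl : ∀ b, IsLinearMap k (fun a => f a b) := by intros; fun_prop)
    (hr : ∀ a, IsLinearMap k (fun b => f a b) := by intros; fun_prop) :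
    ∑ i ∈ oneIdx k A, f i.1 (piLbar k i.2) = ∑ i ∈ oneIdx k A, f i.1 i.2 :=
  sum_piLbar k (LinearMap.mk₂ k f (fun a b c => (hl c).map_add a b)
    (fun c a b => (hl b).map_smul c a) (fun a b c => (hr a).map_add b c)
    (fun c a b => (hr a).map_smul c b))

/-- Replace `1₂` by `⊓ᴸ(1₂)`. -/
lemma sum_piL_snd (f : A → A → V)
    (hl : ∀ b, IsLinearMap k (fun a => f a b) := by intros; fun_prop)
    (hr : ∀ a, IsLinearMap k (fun b => f a b) := by intros; fun_prop) :
    ∑ i ∈ oneIdx k A, f i.1 (piL k i.2) = ∑ i ∈ oneIdx k A, f i.1 i.2 := by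
  rw [← sum_piLbar_snd k f, ← sum_piLbar_snd k (fun a b => f a (piL k b))]
  simp only [piL_piLbar]

end WeakBialgebra
end sweedler

/-! ### Coseparable coalgebras and cointegral functionals -/

section functionals

open Coalgebra WeakBialgebra

variable (k : Type u) {A : Type v} [Field k] [Ring A] [Algebra k A] [Coalgebra k A]

/-- A coalgebra is coseparable if and only if it carries a bilinear form `Φ` with
`h₁ Φ(h₂, g) = Φ(h, g₁) g₂` and `Φ(h₁, h₂) = ε(h)`. The two are related by
`r(h ⊗ g) = h₁ Φ(h₂, g)` and `Φ = ε ∘ r`. -/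
lemma isCoseparableCoalgebra_iff : IsCoseparableCoalgebra k A ↔ ∃ Φ : A ⊗[k] A →ₗ[k] k,
    (∀ h g : A, ∑ p ∈ comulIdx k h, Φ (p.2 ⊗ₜ g) • p.1 =
      ∑ q ∈ comulIdx k g, Φ (h ⊗ₜ q.1) • q.2) ∧
    ∀ h : A, ∑ p ∈ comulIdx k h, Φ (p.1 ⊗ₜ p.2) = counit (R := k) h := by
  constructor
  · rintro ⟨r, hr, hl, hr'⟩
    refine ⟨counit (R := k) ∘ₗ r, fun h g => ?_, fun h => ?_⟩
    · have e₁ := congrArg (fun t => TensorProduct.rid k A ((counit (R := k)).lTensor A t))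
        (LinearMap.congr_fun hl (h ⊗ₜ g))
      have e₂ := congrArg (fun t => TensorProduct.lid k A ((counit (R := k)).rTensor A t))
        (LinearMap.congr_fun hr' (h ⊗ₜ g))
      simp only [LinearMap.comp_apply, Coalgebra.lTensor_counit_comul, TensorProduct.rid_tmul,
        Coalgebra.rTensor_counit_comul, TensorProduct.lid_tmul, one_smul, LinearMap.rTensor_tmul,
        LinearMap.lTensor_tmul] at e₁ e₂
      rw [comul_eq_sum] at e₁ e₂
      simpa [TensorProduct.sum_tmul, TensorProduct.tmul_sum] using e₁.symm.trans e₂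
    · rw [sum_comulIdx]
      exact congrArg (counit (R := k)) (LinearMap.congr_fun hr h)
  rintro ⟨Φ, h₁, h₂⟩
  let r : A ⊗[k] A →ₗ[k] A := (TensorProduct.rid k A).toLinearMap ∘ₗ Φ.lTensor A ∘ₗ
    (TensorProduct.assoc k A A A).toLinearMap ∘ₗ (comul (R := k)).rTensor A
  have r₁ : ∀ h g : A, r (h ⊗ₜ g) = ∑ p ∈ comulIdx k h, Φ (p.2 ⊗ₜ g) • p.1 := by
    intro h g
    simp [r, comul_eq_sum, TensorProduct.sum_tmul]
  have r₂ : ∀ h g : A, r (h ⊗ₜ g) = ∑ q ∈ comulIdx k g, Φ (h ⊗ₜ q.1) • q.2 := by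
    intro h g
    rw [r₁, h₁]
  refine ⟨r, ?_, ?_, ?_⟩
  · ext h
    simp only [LinearMap.comp_apply, LinearMap.id_apply]
    rw [comul_eq_sum, map_sum]
    simp only [r₁]
    rw [sum_comulIdx_coassoc k h (fun a b c => Φ (b ⊗ₜ c) • a)]
    simp only [← Finset.sum_smul, h₂, sum_counit_smul_fst]
  · apply TensorProduct.ext'
    intro h g
    simp only [LinearMap.comp_apply, LinearEquiv.coe_coe, LinearMap.rTensor_tmul, r₁, map_sum,
      map_smul]
    rw [comul_eq_sum k h]
    simp only [TensorProduct.sum_tmul, map_sum, TensorProduct.assoc_tmul, LinearMap.lTensor_tmul,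
      r₁, TensorProduct.tmul_sum, TensorProduct.tmul_smul]
    rw [← sum_comulIdx_coassoc k h (fun a b c => Φ (c ⊗ₜ g) • a ⊗ₜ[k] b)]
    simp only [comul_eq_sum, Finset.smul_sum]
  · apply TensorProduct.ext'
    intro h g
    simp only [LinearMap.comp_apply, LinearEquiv.coe_coe, LinearMap.lTensor_tmul, r₂, map_sum,
      map_smul]
    rw [comul_eq_sum k g]
    simp only [TensorProduct.tmul_sum, map_sum, TensorProduct.assoc_symm_tmul,
      LinearMap.rTensor_tmul, r₂, TensorProduct.sum_tmul]
    rw [sum_comulIdx_coassoc k g (fun a b c => (Φ (h ⊗ₜ a) • b) ⊗ₜ[k] c)]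
    simp only [comul_eq_sum, Finset.smul_sum, TensorProduct.smul_tmul']

variable {k}

/-- The map `h ↦ h₁ τ(h₂)`. -/
noncomputable def hitLeft (τ : A →ₗ[k] k) : A →ₗ[k] A :=
  (TensorProduct.rid k A).toLinearMap ∘ₗ τ.lTensor A ∘ₗ comul

/-- The map `h ↦ τ(h₁) h₂`. -/
noncomputable def hitRight (τ : A →ₗ[k] k) : A →ₗ[k] A :=
  (TensorProduct.lid k A).toLinearMap ∘ₗ τ.rTensor A ∘ₗ comul

lemma hitLeft_apply (τ : A →ₗ[k] k) (h : A) :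
    hitLeft τ h = ∑ p ∈ comulIdx k h, τ p.2 • p.1 := by
  simp [hitLeft, comul_eq_sum]

lemma hitRight_apply (τ : A →ₗ[k] k) (h : A) :
    hitRight τ h = ∑ p ∈ comulIdx k h, τ p.1 • p.2 := by
  simp [hitRight, comul_eq_sum]

lemma counit_hitLeft (τ : A →ₗ[k] k) (h : A) : counit (R := k) (hitLeft τ h) = τ h := by
  rw [hitLeft_apply]
  conv_rhs => rw [← sum_counit_smul_snd k h]
  simp [mul_comm]

lemma counit_hitRight (τ : A →ₗ[k] k) (h : A) : counit (R := k) (hitRight τ h) = τ h := by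
  rw [hitRight_apply]
  conv_rhs => rw [← sum_counit_smul_fst k h]
  simp [mul_comm]

section hit

variable [WeakBialgebra k A]

variable (τ : A →ₗ[k] k)

lemma hitLeft_piLbar_mul (g h : A) : hitLeft τ (piLbar k g * h) = piLbar k g * hitLeft τ h := by
  rw [hitLeft_apply, hitLeft_apply, sum_comulIdx_piLbar_mul k (fun a b => τ b • a)]
  simp [Finset.mul_sum]

lemma hitLeft_mul_piLbar (g h : A) : hitLeft τ (h * piLbar k g) = hitLeft τ h * piLbar k g := by
  rw [hitLeft_apply, hitLeft_apply, sum_comulIdx_mul_piLbar k (fun a b => τ b • a)]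
  simp [Finset.sum_mul]

lemma hitRight_base_mul (x : baseAlgebra k A) (h : A) :
    hitRight τ (x * h) = x * hitRight τ h := by
  rw [hitRight_apply, hitRight_apply, sum_comulIdx_base_mul k (fun a b => τ a • b)]
  simp [Finset.mul_sum]

lemma hitRight_mul_base (x : baseAlgebra k A) (h : A) :
    hitRight τ (h * x) = hitRight τ h * x := by
  rw [hitRight_apply, hitRight_apply, sum_comulIdx_mul_base k (fun a b => τ a • b)]
  simp [Finset.sum_mul]

end hit

/-- The cointegral condition says that `h₁ τ(h₂)` is fixed by `⊓ᴸ`. -/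
lemma isNormalizedLeftCointegralFunctional_iff (τ : A →ₗ[k] k) :
    IsNormalizedLeftCointegralFunctional τ ↔
      (∀ h, piL k (hitLeft τ h) = hitLeft τ h) ∧ ∀ h, τ (piL k h) = counit (R := k) h := by
  have e : ∀ h, TensorProduct.rid k A (TensorProduct.map (piL k) τ (comul (R := k) h)) =
      piL k (hitLeft τ h) := by
    intro h
    rw [hitLeft_apply, comul_eq_sum]
    simp
  constructor
  · rintro ⟨h₁, h₂⟩
    exact ⟨fun h => (e h).symm.trans (h₁ h).symm, fun h => LinearMap.congr_fun h₂ h⟩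
  · rintro ⟨h₁, h₂⟩
    exact ⟨fun h => (h₁ h).symm.trans (e h).symm, LinearMap.ext h₂⟩

/-- The cointegral condition says that `τ(h₁) h₂` is fixed by `⊓ᴿ`. -/
lemma isNormalizedRightCointegralFunctional_iff (τ : A →ₗ[k] k) :
    IsNormalizedRightCointegralFunctional τ ↔
      (∀ h, piR k (hitRight τ h) = hitRight τ h) ∧ ∀ h, τ (piR k h) = counit (R := k) h := by
  have e : ∀ h, TensorProduct.lid k A (TensorProduct.map τ (piR k) (comul (R := k) h)) =
      piR k (hitRight τ h) := by
    intro h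
    rw [hitRight_apply, comul_eq_sum]
    simp
  constructor
  · rintro ⟨h₁, h₂⟩
    exact ⟨fun h => (e h).symm.trans (h₁ h).symm, fun h => LinearMap.congr_fun h₂ h⟩
  · rintro ⟨h₁, h₂⟩
    exact ⟨fun h => (h₁ h).symm.trans (e h).symm, LinearMap.ext h₂⟩

section coseparable

variable [WeakBialgebra k A]

/-- `τ(h) = Φ(h 1₁, 1₂)` for a form `Φ` witnessing coseparability. -/
lemma IsCoseparableCoalgebra.exists_left (H : IsCoseparableCoalgebra k A) :
    ∃ τ : A →ₗ[k] k, IsNormalizedLeftCointegralFunctional τ := by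
  obtain ⟨Φ, hΦ, hε⟩ := (isCoseparableCoalgebra_iff k).1 H
  let τ : A →ₗ[k] k := ∑ i ∈ oneIdx k A,
    Φ ∘ₗ (TensorProduct.mk k A A).flip i.2 ∘ₗ LinearMap.mulRight k i.1
  have hτ : ∀ h, τ h = ∑ i ∈ oneIdx k A, Φ ((h * i.1) ⊗ₜ i.2) := by
    intro h; simp [τ, LinearMap.sum_apply]
  -- `h₁ τ(h₂) = (h 1₁)₁ Φ((h 1₁)₂, 1₂) = Φ(h 1₁, 1₂) 1₃`
  have hX : ∀ h, hitLeft τ h =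
      ∑ i ∈ oneIdx k A, ∑ j ∈ oneIdx k A, Φ ((h * i.1) ⊗ₜ (i.2 * j.1)) • j.2 := by
    intro h
    rw [← sum_oneIdx_comul_snd k (fun a b c => Φ ((h * a) ⊗ₜ b) • c)]
    simp only [← hΦ]
    rw [Finset.sum_congr rfl fun i _ => sum_comulIdx_mul k (fun a b => Φ (b ⊗ₜ i.2) • a) h i.1,
      Finset.sum_comm]
    rw [Finset.sum_congr rfl fun p _ => sum_oneIdx_comul_fst k
      (fun a b c => Φ ((p.2 * b) ⊗ₜ c) • (p.1 * a))]
    have e := sum_comulIdx_mul k (fun a b => ∑ j ∈ oneIdx k A, Φ ((b * j.1) ⊗ₜ j.2) • a) h 1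
    rw [mul_one] at e
    rw [hitLeft_apply]
    simp only [hτ, Finset.sum_smul]
    rw [e]
    refine Finset.sum_congr rfl fun p _ => ?_
    rw [sum_comulIdx_one k (fun a b =>
      ∑ j ∈ oneIdx k A, Φ ((p.2 * b * j.1) ⊗ₜ j.2) • (p.1 * a))]
    simp only [mul_assoc]
  refine ⟨τ, (isNormalizedLeftCointegralFunctional_iff _).2 ⟨fun h => ?_, fun h => ?_⟩⟩
  · simp only [hX, map_sum, map_smul]
    refine Finset.sum_congr rfl fun i _ => ?_
    exact sum_piL_snd k (fun a b => Φ ((h * i.1) ⊗ₜ (i.2 * a)) • b)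
  · rw [hτ, ← counit_piL, ← hε]
    refine (sum_comulIdx_eq k (fun a b => Φ (a ⊗ₜ b)) ?_).symm
    rw [comul_piL, comul_one_eq]
    simp [Finset.mul_sum]

/-- `τ(h) = Φ(1₁, 1₂ h)` for a form `Φ` witnessing coseparability. -/
lemma IsCoseparableCoalgebra.exists_right (H : IsCoseparableCoalgebra k A) :
    ∃ τ : A →ₗ[k] k, IsNormalizedRightCointegralFunctional τ := by
  obtain ⟨Φ, hΦ, hε⟩ := (isCoseparableCoalgebra_iff k).1 H
  let τ : A →ₗ[k] k := ∑ i ∈ oneIdx k A,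
    Φ ∘ₗ TensorProduct.mk k A A i.1 ∘ₗ LinearMap.mulLeft k i.2
  have hτ : ∀ h, τ h = ∑ i ∈ oneIdx k A, Φ (i.1 ⊗ₜ (i.2 * h)) := by
    intro h; simp [τ, LinearMap.sum_apply]
  -- `τ(h₁) h₂ = Φ(1₁, (1₂ h)₁) (1₂ h)₂ = 1₁ Φ(1₂, 1₃ h)`
  have hY : ∀ h, hitRight τ h =
      ∑ i ∈ oneIdx k A, ∑ j ∈ oneIdx k A, Φ ((i.2 * j.1) ⊗ₜ (j.2 * h)) • i.1 := by
    intro h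
    rw [← sum_oneIdx_comul_fst k (fun a b c => Φ (b ⊗ₜ (c * h)) • a)]
    simp only [hΦ]
    rw [Finset.sum_congr rfl fun i _ => sum_comulIdx_mul k (fun a b => Φ (i.1 ⊗ₜ a) • b) i.2 h,
      sum_oneIdx_comul_snd k (fun a b c => ∑ q ∈ comulIdx k h, Φ (a ⊗ₜ (b * q.1)) • (c * q.2))]
    have e := sum_comulIdx_mul k (fun a b => ∑ i ∈ oneIdx k A, Φ (i.1 ⊗ₜ (i.2 * a)) • b) 1 h
    rw [one_mul] at e
    rw [hitRight_apply]
    simp only [hτ, Finset.sum_smul]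
    rw [e, sum_comulIdx_one k (fun a b => ∑ q ∈ comulIdx k h,
      ∑ i ∈ oneIdx k A, Φ (i.1 ⊗ₜ (i.2 * (a * q.1))) • (b * q.2)),
      Finset.sum_congr rfl fun j _ => Finset.sum_comm, Finset.sum_comm]
    simp only [mul_assoc]
  refine ⟨τ, (isNormalizedRightCointegralFunctional_iff _).2 ⟨fun h => ?_, fun h => ?_⟩⟩
  · simp only [hY, map_sum, map_smul]
    rw [Finset.sum_comm]
    conv_rhs => rw [Finset.sum_comm]
    refine Finset.sum_congr rfl fun j _ => ?_
    exact sum_piR_fst k (fun a b => Φ ((b * j.1) ⊗ₜ (j.2 * h)) • a)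
  · rw [hτ, ← counit_piR, ← hε]
    refine (sum_comulIdx_eq k (fun a b => Φ (a ⊗ₜ b)) ?_).symm
    rw [comul_piR, comul_one_eq]
    simp [Finset.sum_mul]

end coseparable
end functionals

/-! ### From cointegral functionals to coseparability -/

section antipode

open Coalgebra WeakBialgebra

variable (k : Type u) {A : Type v} [Field k] [Ring A] [Algebra k A] [Coalgebra k A]

/-- An antipode `S` that is stable under convolution with `⊓ᴿ = S * id` on the left and with
`⊓ᴸ = id * S` on the right. -/
structure IsRegularAntipode (S : A →ₗ[k] A) : Prop where
  sum_mul_antipode : ∀ h, ∑ p ∈ comulIdx k h, p.1 * S p.2 = piL k h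
  sum_antipode_mul : ∀ h, ∑ p ∈ comulIdx k h, S p.1 * p.2 = piR k h
  sum_piR_mul_antipode : ∀ h, ∑ p ∈ comulIdx k h, piR k p.1 * S p.2 = S h
  sum_antipode_mul_piL : ∀ h, ∑ p ∈ comulIdx k h, S p.1 * piL k p.2 = S h

open WithConv in
variable (A) in
/-- The convolution product `σ * id * σ` is a regular antipode. -/
lemma exists_isRegularAntipode [WeakHopfAlgebra k A] :
    ∃ S : A →ₗ[k] A, IsRegularAntipode k S := by
  have conv : ∀ (f g : WithConv (A →ₗ[k] A)) (h : A),
      (f * g) h = ∑ p ∈ comulIdx k h, f p.1 * g p.2 := by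
    intro f g h
    rw [LinearMap.convMul_apply, comul_eq_sum]
    simp
  let s : WithConv (A →ₗ[k] A) := toConv (WeakHopfAlgebra.antipode (k := k))
  let e : WithConv (A →ₗ[k] A) := toConv LinearMap.id
  let r : WithConv (A →ₗ[k] A) := toConv (piR k)
  let l : WithConv (A →ₗ[k] A) := toConv (piL k)
  have h₁ : e * s = l := by
    ext h
    have := LinearMap.congr_fun (WeakHopfAlgebra.mul_lTensor_antipode (k := k) (A := A)) h
    simp only [LinearMap.comp_apply] at this
    rw [conv]
    rw [comul_eq_sum] at this
    simp only [map_sum, LinearMap.lTensor_tmul, LinearMap.mul'_apply] at this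
    exact this
  have h₂ : s * e = r := by
    ext h
    have := LinearMap.congr_fun (WeakHopfAlgebra.mul_rTensor_antipode (k := k) (A := A)) h
    simp only [LinearMap.comp_apply] at this
    rw [conv]
    rw [comul_eq_sum] at this
    simp only [map_sum, LinearMap.rTensor_tmul, LinearMap.mul'_apply] at this
    exact this
  have h₃ : e * r = e := by
    ext h
    rw [conv]
    exact sum_mul_piR k h
  have h₄ : l * e = e := by
    ext h
    rw [conv]
    exact sum_piL_mul k h
  have c₁ : e * (s * e * s) = l := by rw [h₂, ← mul_assoc, h₃, h₁]
  have c₂ : s * e * s * e = r := by rw [mul_assoc s, h₁, mul_assoc, h₄, h₂]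
  have c₃ : r * (s * e * s) = s * e * s := by
    rw [← h₂, mul_assoc s e (s * e * s), c₁, mul_assoc, h₁]
  have c₄ : s * e * s * l = s * e * s := by
    rw [← c₁, ← mul_assoc, c₂, c₃]
  refine ⟨(s * e * s).ofConv, fun h => ?_, fun h => ?_, fun h => ?_, fun h => ?_⟩
  · exact (conv e (s * e * s) h).symm.trans (congrArg (fun f : WithConv (A →ₗ[k] A) => f h) c₁)
  · exact (conv (s * e * s) e h).symm.trans (congrArg (fun f : WithConv (A →ₗ[k] A) => f h) c₂)
  · exact (conv r (s * e * s) h).symm.trans (congrArg (fun f : WithConv (A →ₗ[k] A) => f h) c₃)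
  · exact (conv (s * e * s) l h).symm.trans (congrArg (fun f : WithConv (A →ₗ[k] A) => f h) c₄)

lemma isLinearMap_sum_comulIdx {V : Type*} [AddCommGroup V] [Module k V] (f : A → A → V)
    (hl : ∀ b, IsLinearMap k (fun a => f a b) := by intros; fun_prop)
    (hr : ∀ a, IsLinearMap k (fun b => f a b) := by intros; fun_prop) :
    IsLinearMap k (fun h => ∑ p ∈ comulIdx k h, f p.1 p.2) := by
  obtain ⟨F, hF⟩ := exists_linearMap_tmul (k := k) f hl hr
  simp only [← hF, sum_comulIdx]
  exact (F ∘ₗ comul).isLinear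

variable [WeakBialgebra k A]

lemma WeakBialgebra.piLbar_piLbar (h : A) : piLbar k (piLbar k h) = piLbar k h := by
  change TensorProduct.lid k A ((counit (R := k)).rTensor A
    ((piLbar k h ⊗ₜ 1) * comul (R := k) (1 : A))) = piLbar k h
  rw [← comul_piLbar, Coalgebra.rTensor_counit_comul]
  simp

lemma WeakBialgebra.piLbar_piL (h : A) : piLbar k (piL k h) = piL k h := by
  rw [← piLbar_piR_piL, piLbar_piLbar]

lemma WeakBialgebra.piR_piLbar_mul' (x g : A) : piR k (piLbar k x * g) = piR k (x * g) := by
  simp only [piR_apply, mul_assoc, counit_piLbar_mul]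

namespace IsRegularAntipode

variable {k} {S : A →ₗ[k] A} (hS : IsRegularAntipode k S)

include hS

/-- `S(g ⊓̅ᴸ(x)) = x S(g)`. -/
lemma map_mul_piLbar (x : baseAlgebra k A) (g : A) : S (g * piLbar k (x : A)) = x * S g := by
  rw [← hS.sum_piR_mul_antipode, sum_comulIdx_mul_piLbar k (fun a b => piR k a * S b)]
  simp only [piR_mul_piLbar_base, mul_assoc]
  rw [← Finset.mul_sum, hS.sum_piR_mul_antipode]

/-- `S(⊓̅ᴸ(x) g) = S(g) x`. -/
lemma map_piLbar_mul (x : baseAlgebra k A) (g : A) : S (piLbar k (x : A) * g) = S g * x := by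
  rw [← hS.sum_piR_mul_antipode, sum_comulIdx_piLbar_mul k (fun a b => piR k a * S b)]
  simp only [piR_piLbar_mul']
  simp only [← hS.sum_antipode_mul]
  simp only [sum_comulIdx_base_mul k (fun a b => S a * b) x, Finset.sum_mul]
  rw [sum_comulIdx_coassoc k g (fun a b c => S a * (x * b) * S c)]
  simp only [mul_assoc]
  simp only [← Finset.mul_sum, hS.sum_mul_antipode, base_mul_piL]
  simp only [← mul_assoc]
  rw [← Finset.sum_mul, hS.sum_antipode_mul_piL]

end IsRegularAntipode

section left

variable {k} {τ : A →ₗ[k] k} (hτ : IsNormalizedLeftCointegralFunctional τ)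

include hτ

omit [WeakBialgebra k A] in
lemma IsNormalizedLeftCointegralFunctional.piL_hitLeft (h : A) :
    piL k (hitLeft τ h) = hitLeft τ h :=
  ((isNormalizedLeftCointegralFunctional_iff τ).1 hτ).1 h

omit [WeakBialgebra k A] in
lemma IsNormalizedLeftCointegralFunctional.apply_piL (h : A) :
    τ (piL k h) = counit (R := k) h :=
  ((isNormalizedLeftCointegralFunctional_iff τ).1 hτ).2 h

lemma IsNormalizedLeftCointegralFunctional.piLbar_hitLeft (h : A) :
    piLbar k (hitLeft τ h) = hitLeft τ h := by
  rw [← hτ.piL_hitLeft, piLbar_piL]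

omit hτ in
lemma apply_mul_piL_eq_counit (h g : A) :
    τ (h * piL k g) = counit (R := k) (hitLeft τ h * g) := by
  rw [← counit_hitLeft, ← piLbar_piL, hitLeft_mul_piLbar, piLbar_piL, counit_mul_piL]

variable {S : A →ₗ[k] A} (hS : IsRegularAntipode k S)

include hS

/-- Both sides of the identity are equal to `X(h S(g₁)) g₂` where `X(h) = h₁ τ(h₂)`. -/
lemma IsNormalizedLeftCointegralFunctional.sum_antipode (h g : A) :
    ∑ p ∈ comulIdx k h, τ (p.2 * S g) • p.1 = ∑ q ∈ comulIdx k g, τ (h * S q.1) • q.2 := by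
  trans ∑ q ∈ comulIdx k g, hitLeft τ (h * S q.1) * q.2
  · -- the left-hand side as a bilinear function of `h` and `g`
    let L : A → A → A := fun h g => ∑ p ∈ comulIdx k h, τ (p.2 * S g) • p.1
    have L₁ : ∀ g, IsLinearMap k (fun h => L h g) := fun g =>
      isLinearMap_sum_comulIdx k (fun a b => τ (b * S g) • a)
    have L₂ : ∀ h, IsLinearMap k (fun g => L h g) := fun h => by simp only [L]; fun_prop
    have key : ∀ h g : A, hitLeft τ h * g = ∑ b ∈ comulIdx k g, L (h * b.1) b.2 := by
      intro h g
      have e₁ : ∀ a : A, a * g = ∑ p ∈ comulIdx k a, ∑ q ∈ comulIdx k g,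
          counit (R := k) (p.2 * q.2) • (p.1 * q.1) := by
        intro a
        rw [← sum_comulIdx_mul k (fun a b => counit (R := k) b • a), sum_counit_smul_fst]
      have e₂ : hitLeft τ h * g = ∑ p ∈ comulIdx k h, ∑ b ∈ comulIdx k g,
          τ (p.2 * piL k b.2) • (p.1 * b.1) := by
        rw [hitLeft_apply, Finset.sum_mul]
        simp only [smul_mul_assoc]
        simp only [e₁, Finset.smul_sum]
        rw [sum_comulIdx_coassoc k h (fun a b c => ∑ q ∈ comulIdx k g,
          τ c • counit (R := k) (b * q.2) • (a * q.1))]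
        simp only [apply_mul_piL_eq_counit]
        refine Finset.sum_congr rfl fun p _ => ?_
        rw [Finset.sum_comm]
        refine Finset.sum_congr rfl fun q _ => ?_
        simp [hitLeft_apply, Finset.sum_mul, Finset.sum_smul, smul_smul]
      rw [e₂]
      simp only [L]
      simp only [fun b => sum_comulIdx_mul k (fun a c => τ (c * S b) • a)]
      conv_rhs => rw [Finset.sum_comm]
      refine Finset.sum_congr rfl fun p _ => ?_
      rw [sum_comulIdx_coassoc k g (fun a b c => τ (p.2 * b * S c) • (p.1 * a))]
      simp only [mul_assoc, ← Finset.sum_smul, ← map_sum, ← Finset.mul_sum, hS.sum_mul_antipode]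
    simp only [key]
    rw [← sum_comulIdx_coassoc k g (fun a b c => L (h * S a * b) c)
      (fun b c => isLinearMap_comp (f := fun z => L z c) (L₁ c) (by fun_prop))
      (fun a c => isLinearMap_comp (f := fun z => L z c) (L₁ c) (by fun_prop))
      (fun a b => L₂ _)]
    have e : ∀ q : A × A, ∑ b ∈ comulIdx k q.1, L (h * S b.1 * b.2) q.2 =
        L (h * piR k q.1) q.2 := by
      intro q
      rw [← hS.sum_antipode_mul, Finset.mul_sum]
      simp only [← mul_assoc]
      exact (map_sum (L₁ q.2).mk' _ _).symm
    simp only [e, L]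
    simp only [← coe_toBase, fun b => sum_comulIdx_mul_base k (fun a c => τ (c * S b) • a)]
    rw [Finset.sum_comm]
    simp only [coe_toBase, mul_assoc, ← Finset.sum_smul, ← map_sum, ← Finset.mul_sum,
      hS.sum_piR_mul_antipode]
  · have e : ∀ q : A × A, τ (h * S q.1) • q.2 = ∑ r ∈ comulIdx k q.1,
        counit (R := k) (hitLeft τ (h * S r.1) * r.2) • q.2 := by
      intro q
      rw [← hS.sum_antipode_mul_piL, Finset.mul_sum, map_sum, Finset.sum_smul]
      simp only [← mul_assoc, apply_mul_piL_eq_counit]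
    simp only [e]
    rw [sum_comulIdx_coassoc k g
      (fun a b c => counit (R := k) (hitLeft τ (h * S a) * b) • c)]
    simp only [sum_counit_mul_fst_smul, hτ.piLbar_hitLeft]

omit [WeakBialgebra k A] in
lemma IsNormalizedLeftCointegralFunctional.sum_apply_antipode (h : A) :
    ∑ p ∈ comulIdx k h, τ (p.1 * S p.2) = counit (R := k) h := by
  rw [← map_sum, hS.sum_mul_antipode, hτ.apply_piL]

/-- The bilinear form is `Φ(h, g) = τ(h S(g))`. -/
lemma IsNormalizedLeftCointegralFunctional.isCoseparableCoalgebra : IsCoseparableCoalgebra k A :=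
  (isCoseparableCoalgebra_iff k).2 ⟨τ ∘ₗ LinearMap.mul' k A ∘ₗ S.lTensor A,
    fun h g => by simpa using hτ.sum_antipode hS h g,
    fun h => by simpa using hτ.sum_apply_antipode hS h⟩

end left

section right

variable {k} {τ : A →ₗ[k] k} (hτ : IsNormalizedRightCointegralFunctional τ)

include hτ

omit [WeakBialgebra k A] in
lemma IsNormalizedRightCointegralFunctional.piR_hitRight (h : A) :
    piR k (hitRight τ h) = hitRight τ h :=
  ((isNormalizedRightCointegralFunctional_iff τ).1 hτ).1 h

omit [WeakBialgebra k A] in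
lemma IsNormalizedRightCointegralFunctional.apply_piR (h : A) :
    τ (piR k h) = counit (R := k) h :=
  ((isNormalizedRightCointegralFunctional_iff τ).1 hτ).2 h

lemma IsNormalizedRightCointegralFunctional.piRbar_hitRight (h : A) :
    piRbar k (hitRight τ h) = hitRight τ h := by
  rw [← hτ.piR_hitRight, ← coe_toBase, piRbar_base]

omit hτ in
lemma apply_piR_mul_eq_counit (h g : A) :
    τ (piR k h * g) = counit (R := k) (h * hitRight τ g) := by
  rw [← counit_hitRight, ← coe_toBase, hitRight_base_mul, coe_toBase, counit_piR_mul]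

variable {S : A →ₗ[k] A} (hS : IsRegularAntipode k S)

include hS

/-- Both sides of the identity are equal to `h₁ Y(S(h₂) g)` where `Y(h) = τ(h₁) h₂`. -/
lemma IsNormalizedRightCointegralFunctional.sum_antipode (h g : A) :
    ∑ p ∈ comulIdx k h, τ (S p.2 * g) • p.1 = ∑ q ∈ comulIdx k g, τ (S h * q.1) • q.2 := by
  trans ∑ p ∈ comulIdx k h, p.1 * hitRight τ (S p.2 * g)
  · have e : ∀ p : A × A, τ (S p.2 * g) • p.1 = ∑ r ∈ comulIdx k p.2,
        counit (R := k) (r.1 * hitRight τ (S r.2 * g)) • p.1 := by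
      intro p
      rw [← hS.sum_piR_mul_antipode, Finset.sum_mul, map_sum, Finset.sum_smul]
      simp only [mul_assoc, apply_piR_mul_eq_counit]
    simp only [e]
    rw [← sum_comulIdx_coassoc k h
      (fun a b c => counit (R := k) (b * hitRight τ (S c * g)) • a)]
    simp only [sum_counit_snd_mul_smul, hτ.piRbar_hitRight]
  · -- the right-hand side as a bilinear function of `h` and `g`
    let L : A → A → A := fun h g => ∑ q ∈ comulIdx k g, τ (S h * q.1) • q.2
    have L₁ : ∀ h, IsLinearMap k (fun g => L h g) := fun h =>
      isLinearMap_sum_comulIdx k (fun a b => τ (S h * a) • b)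
    have L₂ : ∀ g, IsLinearMap k (fun h => L h g) := fun h => by simp only [L]; fun_prop
    have key : ∀ h g : A, h * hitRight τ g = ∑ b ∈ comulIdx k h, L b.1 (b.2 * g) := by
      intro h g
      have e₁ : ∀ a : A, h * a = ∑ p ∈ comulIdx k a, ∑ q ∈ comulIdx k h,
          counit (R := k) (q.1 * p.1) • (q.2 * p.2) := by
        intro a
        rw [Finset.sum_comm, ← sum_comulIdx_mul k (fun a b => counit (R := k) a • b),
          sum_counit_smul_snd]
      have e₂ : h * hitRight τ g = ∑ p ∈ comulIdx k g, ∑ b ∈ comulIdx k h,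
          τ (piR k b.1 * p.1) • (b.2 * p.2) := by
        rw [hitRight_apply, Finset.mul_sum]
        simp only [mul_smul_comm]
        simp only [e₁, Finset.smul_sum]
        rw [← sum_comulIdx_coassoc k g (fun a b c => ∑ q ∈ comulIdx k h,
          τ a • counit (R := k) (q.1 * b) • (q.2 * c))]
        simp only [apply_piR_mul_eq_counit]
        refine Finset.sum_congr rfl fun p _ => ?_
        rw [Finset.sum_comm]
        refine Finset.sum_congr rfl fun q _ => ?_
        simp [hitRight_apply, Finset.mul_sum, Finset.sum_smul, smul_smul]
      rw [e₂]
      simp only [L]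
      simp only [fun b => sum_comulIdx_mul k (fun a c => τ (S b * a) • c)]
      conv_rhs =>
        enter [2, b]
        rw [Finset.sum_comm]
      conv_rhs => rw [Finset.sum_comm]
      refine Finset.sum_congr rfl fun p _ => ?_
      rw [← sum_comulIdx_coassoc k h (fun a b c => τ (S a * (b * p.1)) • (c * p.2))]
      simp only [← mul_assoc, ← Finset.sum_smul, ← map_sum, ← Finset.sum_mul, hS.sum_antipode_mul]
    simp only [key]
    rw [sum_comulIdx_coassoc k h (fun a b c => L a (b * (S c * g)))
      (fun b c => L₂ _)
      (fun a c => isLinearMap_comp (f := fun z => L a z) (L₁ a) (by fun_prop))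
      (fun a b => isLinearMap_comp (f := fun z => L a z) (L₁ a) (by fun_prop))]
    have e : ∀ q : A × A, ∑ b ∈ comulIdx k q.2, L q.1 (b.1 * (S b.2 * g)) =
        L q.1 (piL k q.2 * g) := by
      intro q
      rw [← hS.sum_mul_antipode, Finset.sum_mul]
      simp only [mul_assoc]
      exact (map_sum (L₁ q.1).mk' _ _).symm
    have e' : ∀ q : A × A, L q.1 (piL k q.2 * g) =
        ∑ p ∈ comulIdx k g, τ (S q.1 * (piL k q.2 * p.1)) • p.2 := by
      intro q
      simp only [L]
      rw [← piLbar_piL, sum_comulIdx_piLbar_mul k (fun a c => τ (S q.1 * a) • c)]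
    simp only [e, e']
    rw [Finset.sum_comm]
    simp only [← mul_assoc, ← Finset.sum_smul, ← map_sum, ← Finset.sum_mul,
      hS.sum_antipode_mul_piL]

/-- The bilinear form is `Φ(h, g) = τ(S(h) g)`. -/
lemma IsNormalizedRightCointegralFunctional.isCoseparableCoalgebra :
    IsCoseparableCoalgebra k A :=
  (isCoseparableCoalgebra_iff k).2 ⟨τ ∘ₗ LinearMap.mul' k A ∘ₗ S.rTensor A,
    fun h g => by simpa using hτ.sum_antipode hS h g,
    fun h => by
      have := hτ.apply_piR h
      rw [← hS.sum_antipode_mul, map_sum] at this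
      simpa using this⟩

end right

end antipode

/-! ### Balanced cointegral functionals -/

section averaging

open Coalgebra WeakBialgebra

variable {k : Type u} {A : Type v} [Field k] [Ring A] [Algebra k A] [Coalgebra k A]
  [WeakBialgebra k A]

lemma WeakBialgebra.piR_piL_eq_nakayamaInv (x : baseAlgebra k A) :
    piR k (piL k (x : A)) = (baseFrobenius k A).nakayamaInv x := by
  rw [← piLbar_nakayamaInv, piR_piLbar_base]

/-- Averaging over the separability element, `τ(h) = ∑ τ'(eᵢ h fᵢ)`, makes a normalized left
cointegral functional balanced. -/
lemma IsNormalizedLeftCointegralFunctional.exists_balanced {τ' : A →ₗ[k] k}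
    (hτ' : IsNormalizedLeftCointegralFunctional τ') :
    ∃ τ : A →ₗ[k] k, IsNormalizedLeftCointegralFunctional τ ∧
      ∀ x ∈ baseAlgebra k A, ∀ h : A, τ (x * h) = τ (h * piR k (piL k x)) := by
  let F := baseFrobenius k A
  let τ : A →ₗ[k] k := ∑ i ∈ F.idx,
    τ' ∘ₗ LinearMap.mulLeft k (i.1 : A) ∘ₗ LinearMap.mulRight k (i.2 : A)
  have hτ : ∀ h, τ h = ∑ i ∈ F.idx, τ' (i.1 * (h * i.2)) := by
    intro h; simp [τ, LinearMap.sum_apply]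
  have hX : ∀ h, hitLeft τ h = ∑ i ∈ F.idx, hitLeft τ' (i.1 * (h * i.2)) := by
    intro h
    simp only [hitLeft_apply, hτ, Finset.sum_smul]
    rw [Finset.sum_comm]
    refine Finset.sum_congr rfl fun i _ => ?_
    rw [sum_comulIdx_base_mul k (fun a b => τ' b • a),
      sum_comulIdx_mul_base k (fun a b => τ' (i.1 * b) • a)]
  refine ⟨τ, (isNormalizedLeftCointegralFunctional_iff _).2 ⟨fun h => ?_, fun h => ?_⟩, ?_⟩
  · simp only [hX, map_sum, hτ'.piL_hitLeft]
  · have e := congrArg (fun z : baseAlgebra k A => τ' (piL k h * (z : A))) F.sum_mul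
    simp only [AddSubmonoidClass.coe_finsetSum, MulMemClass.coe_mul, OneMemClass.coe_one,
      mul_one, Finset.mul_sum, map_sum, hτ'.apply_piL] at e
    rw [hτ, ← e]
    simp only [← mul_assoc, base_mul_piL]
  · intro x hx h
    have e := F.sum_nakayamaInv (LinearMap.mk₂ k (fun a b : baseAlgebra k A => τ' (a * (h * b)))
      (fun a b c => by simp [add_mul]) (fun c a b => by simp)
      (fun a b c => by simp [mul_add]) (fun c a b => by simp)) ⟨x, hx⟩
    simp only [LinearMap.mk₂_apply, MulMemClass.coe_mul] at e
    have hx' := piR_piL_eq_nakayamaInv (k := k) ⟨x, hx⟩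
    simp only at hx'
    rw [hτ, hτ, hx']
    simpa only [mul_assoc] using e

/-- Averaging over the image of the separability element under `⊓̅ᴸ`,
`τ(h) = ∑ τ'(⊓̅ᴸ(fᵢ) h ⊓̅ᴸ(eᵢ))`, makes a normalized right cointegral functional balanced. -/
lemma IsNormalizedRightCointegralFunctional.exists_balanced {τ' : A →ₗ[k] k}
    (hτ' : IsNormalizedRightCointegralFunctional τ') :
    ∃ τ : A →ₗ[k] k, IsNormalizedRightCointegralFunctional τ ∧
      ∀ x ∈ baseAlgebra k A, ∀ h : A, τ (h * piLbar k x) = τ (piL k x * h) := by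
  let F := baseFrobenius k A
  let τ : A →ₗ[k] k := ∑ i ∈ F.idx, τ' ∘ₗ LinearMap.mulLeft k (piLbar k (i.2 : A)) ∘ₗ
    LinearMap.mulRight k (piLbar k (i.1 : A))
  have hτ : ∀ h, τ h = ∑ i ∈ F.idx, τ' (piLbar k (i.2 : A) * (h * piLbar k (i.1 : A))) := by
    intro h; simp [τ, LinearMap.sum_apply]
  have hY : ∀ h, hitRight τ h =
      ∑ i ∈ F.idx, hitRight τ' (piLbar k (i.2 : A) * (h * piLbar k (i.1 : A))) := by
    intro h
    simp only [hitRight_apply, hτ, Finset.sum_smul]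
    rw [Finset.sum_comm]
    refine Finset.sum_congr rfl fun i _ => ?_
    rw [sum_comulIdx_piLbar_mul k (fun a b => τ' a • b),
      sum_comulIdx_mul_piLbar k (fun a b => τ' (piLbar k (i.2 : A) * a) • b)]
  refine ⟨τ, (isNormalizedRightCointegralFunctional_iff _).2 ⟨fun h => ?_, fun h => ?_⟩, ?_⟩
  · simp only [hY, map_sum, hτ'.piR_hitRight]
  · have e := congrArg (fun z : baseAlgebra k A => τ' (piR k h * piLbar k (z : A))) F.sum_mul
    simp only [AddSubmonoidClass.coe_finsetSum, MulMemClass.coe_mul, OneMemClass.coe_one,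
      piLbar_one, mul_one, Finset.mul_sum, map_sum, hτ'.apply_piR, piLbar_mul_base] at e
    rw [hτ, ← e]
    refine Finset.sum_congr rfl fun i _ => ?_
    rw [← mul_assoc, ← piR_mul_piLbar, mul_assoc]
  · intro x hx h
    have e := F.sum_nakayamaInv (LinearMap.mk₂ k
      (fun a b : baseAlgebra k A => τ' (piLbar k (b : A) * (h * piLbar k (a : A))))
      (fun a b c => by simp [mul_add]) (fun c a b => by simp)
      (fun a b c => by simp [add_mul]) (fun c a b => by simp)) ⟨x, hx⟩
    simp only [LinearMap.mk₂_apply, MulMemClass.coe_mul, piLbar_mul_base] at e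
    have hx' := piLbar_nakayamaInv (k := k) ⟨x, hx⟩
    simp only at hx'
    rw [hτ, hτ, ← hx']
    have m : ∀ a : baseAlgebra k A, piLbar k ((a : A) * x) = piLbar k x * piLbar k (a : A) :=
      fun a => piLbar_mul_base k a ⟨x, hx⟩
    simpa only [mul_assoc, m] using e

end averaging

/-! ### Descent to the product of bimodules and coseparability of the comonoid `a` -/

namespace EnvBimod

section descent

variable {k : Type u} {R : Type v} [Field k] [Ring R] [Algebra k R]
  {F : FrobeniusSeparability k R} {M N : EnvBimod F} {V : Type*} [AddCommGroup V] [Module k V]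

/-- A balanced linear map on `M ⊗ N` factors through `M ∘ N`: it suffices to restrict it. -/
lemma comp_incl_tm (f : M.carrier ⊗[k] N.carrier →ₗ[k] V)
    (hl : ∀ x m n, f (M.l₁ x m ⊗ₜ n) = f (m ⊗ₜ N.l₂ (F.nakayamaInv x) n))
    (hr : ∀ x m n, f (M.r₁ x m ⊗ₜ n) = f (m ⊗ₜ N.r₂ x n)) (m : M.carrier) (n : N.carrier) :
    (f ∘ₗ incl M N) (tm m n) = f (m ⊗ₜ n) := by
  have e : ∀ i j : R × R, f (M.l₁ i.1 (M.r₁ j.1 m) ⊗ₜ[k] N.l₂ i.2 (N.r₂ j.2 n)) =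
      f (m ⊗ₜ[k] N.l₂Lin (i.2 * F.nakayamaInv i.1) (N.r₂Lin (j.1 * j.2) n)) := by
    intro i j
    rw [hl, hr]
    simp [l₂_mul, r₂_mul, r₂_l₂]
  rw [LinearMap.comp_apply, incl_tm, map_sum]
  simp only [map_sum, e]
  simp only [← map_sum, ← TensorProduct.tmul_sum, ← LinearMap.sum_apply, F.sum_mul,
    F.sum_snd_mul_nakayamaInv]
  simp

lemma tm_smul_left (c : k) (m : M.carrier) (n : N.carrier) : tm (c • m) n = c • tm m n := by
  rw [tm, ← TensorProduct.smul_tmul', map_smul, tm]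

lemma tm_smul_right (c : k) (m : M.carrier) (n : N.carrier) : tm m (c • n) = c • tm m n := by
  simp [tm]

@[fun_prop] lemma isLinearMap_tm_left (n : N.carrier) {g : V → M.carrier}
    (hg : IsLinearMap k g) : IsLinearMap k (fun x => tm (g x) n) :=
  ⟨fun x y => by rw [hg.map_add, tm_add_left], fun c x => by rw [hg.map_smul, tm_smul_left]⟩

@[fun_prop] lemma isLinearMap_tm_right (m : M.carrier) {g : V → N.carrier}
    (hg : IsLinearMap k g) : IsLinearMap k (fun x => tm m (g x)) :=
  ⟨fun x y => by rw [hg.map_add, tm_add_right], fun c x => by rw [hg.map_smul, tm_smul_right]⟩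

open CategoryTheory MonoidalCategory

lemma associator_inv_tm {M N P : EnvBimod F} (m : M.carrier) (n : N.carrier) (p : P.carrier) :
    (α_ M N P).inv.lin (tm m (tm n p)) = tm (tm m n) p := assocInvLin_tm m n p

end descent

end EnvBimod

section comonoid

open CategoryTheory MonoidalCategory EnvBimod WeakBialgebra Coalgebra

variable {k : Type u} {A : Type v} [Field k] [Ring A] [Algebra k A] [Coalgebra k A]
  [WeakBialgebra k A]

lemma comul_weakBialgebraObj_toObj (h : A) :
    (ComonObj.comul (X := weakBialgebraObj k A)).lin (toObj k A h) =
      ∑ p ∈ comulIdx k h, tm (toObj k A p.1) (toObj k A p.2) := by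
  refine (weakBialgebraComul_toObj k h).trans ?_
  rw [comul_eq_sum, map_sum]
  rfl

lemma comul_bulletUnit_jt (p q : baseAlgebra k A) :
    (ComonObj.comul (X := bulletUnit (baseFrobenius k A))).lin (jt _ p q) =
      tm (jt _ 1 q) (jt _ p 1) := bulletUnitComul_jt p q

/-- The inclusion of `a ∘ a` in `A ⊗ A` sends `g ∘ h` to `Δ(1) (g ⊗ h) Δ(1)`. -/
lemma incl_tm_toObj (g h : A) :
    incl (weakBialgebraObj k A) (weakBialgebraObj k A) (tm (toObj k A g) (toObj k A h)) =
      TensorProduct.map (toObj k A) (toObj k A)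
        (comul (R := k) (1 : A) * (g ⊗ₜ h) * comul (R := k) (1 : A)) := by
  -- the separability element of the base algebra becomes `Δ(1)` under `id ⊗ ⊓̅ᴸ`
  have key : ∀ f : A → A → (weakBialgebraObj k A).carrier ⊗[k] (weakBialgebraObj k A).carrier,
      (∀ b, IsLinearMap k (fun a => f a b)) → (∀ a, IsLinearMap k (fun b => f a b)) →
      ∑ i ∈ (baseFrobenius k A).idx, f i.1 (piLbar k (i.2 : A)) = ∑ i ∈ oneIdx k A, f i.1 i.2 := by
    intro f hl hr
    have e := sum_baseFrobenius k (LinearMap.mk₂ k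
      (fun a b : baseAlgebra k A => f a (piLbar k (b : A)))
      (fun a b c => (hl _).map_add a b) (fun c a b => (hl _).map_smul c a)
      (fun a b c => by simp [(hr _).map_add]) (fun c a b => by simp [(hr _).map_smul]))
    simp only [LinearMap.mk₂_apply, coe_toBase] at e
    rw [e, sum_piR_fst k (fun a b => f a (piLbar k (piR k b)))
      (fun b => hl _) (fun a => isLinearMap_comp (hr a) (by fun_prop)),
      ← sum_piLbar_snd k (fun a b => f a (piLbar k (piR k b)))
      (fun b => hl _) (fun a => isLinearMap_comp (hr a) (by fun_prop))]
    simp only [fun b => piLbar_piR_of k (comul_piLbar k b)]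
    exact sum_piLbar_snd k f hl hr
  rw [incl_tm]
  simp only [weakBialgebraObj_r₁, weakBialgebraObj_r₂, weakBialgebraObj_l₁, weakBialgebraObj_l₂]
  rw [key (fun a b => ∑ j ∈ (baseFrobenius k A).idx, toObj k A (a * (g * (j.1 : A))) ⊗ₜ[k]
    toObj k A (b * (h * piLbar k (j.2 : A)))) (by intros; fun_prop) (by intros; fun_prop)]
  rw [Finset.sum_congr rfl fun i _ => key (fun a b => toObj k A (i.1 * (g * a)) ⊗ₜ[k]
    toObj k A (i.2 * (h * b))) (by intros; fun_prop) (by intros; fun_prop)]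
  rw [comul_one_eq]
  simp [Finset.sum_mul, Finset.mul_sum, mul_assoc]
  rw [Finset.sum_comm]

/-- The retraction is `r(h ∘ g) = h₁ τ(h₂ S(g)) = τ(h S(g₁)) g₂`: the first expression shows that it
is well defined on `a ∘ a`, left colinear and linear for the actions on the first factor, the second
one gives the remaining linearity and right colinearity. -/
lemma IsNormalizedLeftCointegralFunctional.isCoseparableComonoid {S : A →ₗ[k] A}
    (hS : IsRegularAntipode k S) {τ : A →ₗ[k] k} (hτ : IsNormalizedLeftCointegralFunctional τ)
    (hb : ∀ x ∈ WeakBialgebra.baseAlgebra k A, ∀ h : A, τ (x * h) = τ (h * piR k (piL k x))) :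
    IsCoseparableComonoid (weakBialgebraObj k A) := by
  obtain ⟨f, hf⟩ : ∃ f : (weakBialgebraObj k A).carrier ⊗[k] (weakBialgebraObj k A).carrier →ₗ[k]
      (weakBialgebraObj k A).carrier, ∀ h g : A, f (toObj k A h ⊗ₜ toObj k A g) =
        toObj k A (∑ p ∈ comulIdx k h, τ (p.2 * S g) • p.1) :=
    exists_linearMap_tmul (fun h g : A => ∑ p ∈ comulIdx k h, τ (p.2 * S g) • p.1)
      (fun g => isLinearMap_sum_comulIdx k (fun a b => τ (b * S g) • a)) (fun h => by fun_prop)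
  have hf' : ∀ h g : A, f (toObj k A h ⊗ₜ toObj k A g) =
        toObj k A (∑ q ∈ comulIdx k g, τ (h * S q.1) • q.2) := by
    intro h g
    rw [hf, hτ.sum_antipode hS]
  let r : (circ (weakBialgebraObj k A) (weakBialgebraObj k A)).carrier →ₗ[k]
    (weakBialgebraObj k A).carrier := f ∘ₗ incl _ _
  have hr : ∀ h g : A, r (tm (toObj k A h) (toObj k A g)) = f (toObj k A h ⊗ₜ toObj k A g) := by
    intro h g
    refine comp_incl_tm f ?_ ?_ _ _
    · intro x m n
      obtain ⟨h, rfl⟩ := toObj_surjective k m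
      obtain ⟨g, rfl⟩ := toObj_surjective k n
      rw [weakBialgebraObj_l₁, weakBialgebraObj_l₂, hf, hf, hS.map_piLbar_mul,
        sum_comulIdx_base_mul k (fun a b => τ (b * S g) • a)]
      simp only [mul_assoc, hb x x.2, piR_piL_eq_nakayamaInv]
    · intro x m n
      obtain ⟨h, rfl⟩ := toObj_surjective k m
      obtain ⟨g, rfl⟩ := toObj_surjective k n
      rw [weakBialgebraObj_r₁, weakBialgebraObj_r₂, hf, hf, hS.map_mul_piLbar,
        sum_comulIdx_mul_base k (fun a b => τ (b * S g) • a)]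
      simp only [mul_assoc]
  let ρ : circ (weakBialgebraObj k A) (weakBialgebraObj k A) ⟶ weakBialgebraObj k A :=
    homMk r
      (fun x => tm_ext₃ fun m n => by
        obtain ⟨h, rfl⟩ := toObj_surjective k m
        obtain ⟨g, rfl⟩ := toObj_surjective k n
        rw [circ_l₁, weakBialgebraObj_l₁, hr, hr, hf', hf', weakBialgebraObj_l₁,
          sum_comulIdx_base_mul k (fun a b => τ (h * S a) • b)]
        simp only [Finset.mul_sum, mul_smul_comm])
      (fun x => tm_ext₃ fun m n => by
        obtain ⟨h, rfl⟩ := toObj_surjective k m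
        obtain ⟨g, rfl⟩ := toObj_surjective k n
        rw [circ_l₂, weakBialgebraObj_l₂, hr, hr, hf, hf, weakBialgebraObj_l₂,
          sum_comulIdx_piLbar_mul k (fun a b => τ (b * S g) • a)]
        simp only [Finset.mul_sum, mul_smul_comm])
      (fun x => tm_ext₃ fun m n => by
        obtain ⟨h, rfl⟩ := toObj_surjective k m
        obtain ⟨g, rfl⟩ := toObj_surjective k n
        rw [circ_r₁, weakBialgebraObj_r₁, hr, hr, hf', hf', weakBialgebraObj_r₁,
          sum_comulIdx_mul_base k (fun a b => τ (h * S a) • b)]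
        simp only [Finset.sum_mul, smul_mul_assoc])
      (fun x => tm_ext₃ fun m n => by
        obtain ⟨h, rfl⟩ := toObj_surjective k m
        obtain ⟨g, rfl⟩ := toObj_surjective k n
        rw [circ_r₂, weakBialgebraObj_r₂, hr, hr, hf, hf, weakBialgebraObj_r₂,
          sum_comulIdx_mul_piLbar k (fun a b => τ (b * S g) • a)]
        simp only [Finset.sum_mul, smul_mul_assoc])
  have hρ : ∀ h g : A, ρ.lin (tm (toObj k A h) (toObj k A g)) =
      f (toObj k A h ⊗ₜ toObj k A g) := hr
  refine ⟨ρ, obj_hom_ext k fun h => ?_, circ_hom_ext fun m n => ?_, circ_hom_ext fun m n => ?_⟩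
  · rw [comp_lin, comul_weakBialgebraObj_toObj, map_sum]
    simp only [hρ, hf, ← map_sum, id_lin]
    congr 1
    rw [sum_comulIdx_coassoc k h (fun a b c => τ (b * S c) • a)]
    simp only [← Finset.sum_smul, hτ.sum_apply_antipode hS, sum_counit_smul_fst]
  · obtain ⟨h, rfl⟩ := toObj_surjective k m
    obtain ⟨g, rfl⟩ := toObj_surjective k n
    simp only [comp_lin]
    rw [hρ, whiskerRight_tm, comul_weakBialgebraObj_toObj, tm_sum_left]
    simp only [map_sum, associator_hom_tm, whiskerLeft_tm, hρ, hf, map_smul,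
      comul_weakBialgebraObj_toObj, tm_sum_right, tm_smul_right, Finset.smul_sum]
    exact sum_comulIdx_coassoc k h
      (fun a b c => τ (c * S g) • tm (toObj k A a) (toObj k A b))
  · obtain ⟨h, rfl⟩ := toObj_surjective k m
    obtain ⟨g, rfl⟩ := toObj_surjective k n
    simp only [comp_lin]
    rw [hρ, whiskerLeft_tm, comul_weakBialgebraObj_toObj, tm_sum_right]
    simp only [map_sum, associator_inv_tm, whiskerRight_tm, hρ, hf', map_smul,
      comul_weakBialgebraObj_toObj, tm_sum_left, tm_smul_left, Finset.smul_sum]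
    exact (sum_comulIdx_coassoc k g
      (fun a b c => τ (h * S a) • tm (toObj k A b) (toObj k A c))).symm

end comonoid

/-! ### From coseparability of the comonoid `a` to cointegral functionals -/

namespace EnvBimod

variable {k : Type u} {R : Type v} [Field k] [Ring R] [Algebra k R]
  {F : FrobeniusSeparability k R} {M N P : EnvBimod F} (f : circ M N ⟶ P) (x : R)
  (m : M.carrier) (n : N.carrier)

lemma map_tm_l₁ : f.lin (tm m (N.l₁ x n)) = P.l₁ x (f.lin (tm m n)) := by
  rw [← circ_l₁, map_l₁]

lemma map_tm_l₂ : f.lin (tm (M.l₂ x m) n) = P.l₂ x (f.lin (tm m n)) := by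
  rw [← circ_l₂, map_l₂]

lemma map_tm_r₁ : f.lin (tm m (N.r₁ x n)) = P.r₁ x (f.lin (tm m n)) := by
  rw [← circ_r₁, map_r₁]

lemma map_tm_r₂ : f.lin (tm (M.r₂ x m) n) = P.r₂ x (f.lin (tm m n)) := by
  rw [← circ_r₂, map_r₂]

end EnvBimod

section comonoid

open CategoryTheory MonoidalCategory EnvBimod WeakBialgebra Coalgebra

variable {k : Type u} {A : Type v} [Field k] [Ring A] [Algebra k A] [Coalgebra k A]
  [WeakBialgebra k A]

variable (k A) in
lemma comul_one_eq_sum_piLbar :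
    comul (R := k) (1 : A) = ∑ i ∈ oneIdx k A, i.1 ⊗ₜ[k] piLbar k i.2 := by
  conv_lhs => rw [← one_lTensor_piLbar, comul_one_eq]
  simp

variable (k A) in
lemma comul_one_eq_sum_piR :
    comul (R := k) (1 : A) = ∑ i ∈ oneIdx k A, piR k i.1 ⊗ₜ[k] i.2 := by
  conv_lhs => rw [← one_rTensor_piR, comul_one_eq]
  simp

lemma piLbar_toBase_piLbar (h : A) : piLbar k (toBase k A (piLbar k h) : A) = piLbar k h :=
  piLbar_piR_of k (comul_piLbar k h)

/-- The functional is `τ(h) = ε(r(h ∘ 1))`. -/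
lemma IsCoseparableComonoid.exists_left (H : IsCoseparableComonoid (weakBialgebraObj k A)) :
    ∃ τ : A →ₗ[k] k, IsNormalizedLeftCointegralFunctional τ := by
  obtain ⟨r, hr, hl, hr'⟩ := H
  let N : (weakBialgebraObj k A).carrier →ₗ[k] A := objLift k A LinearMap.id
  let ν : (circ (weakBialgebraObj k A) (weakBialgebraObj k A)).carrier →ₗ[k] A ⊗[k] A :=
    TensorProduct.map N N ∘ₗ incl _ _
  have hν : ∀ g h : A, ν (tm (toObj k A g) (toObj k A h)) =
      comul (R := k) (1 : A) * (g ⊗ₜ h) * comul (R := k) (1 : A) := by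
    intro g h
    rw [LinearMap.comp_apply, incl_tm_toObj, ← LinearMap.comp_apply, ← TensorProduct.map_comp]
    have e : N ∘ₗ toObj k A = LinearMap.id := rfl
    rw [e, TensorProduct.map_id, LinearMap.id_apply]
  have hν' : ∀ h : A, ν ((ComonObj.comul (X := weakBialgebraObj k A)).lin (toObj k A h)) =
      comul h := by
    intro h
    rw [comul_weakBialgebraObj_toObj, map_sum]
    simp only [hν]
    rw [← Finset.sum_mul, ← Finset.mul_sum, ← comul_eq_sum, comul_one_mul, comul_mul_one]
  let B : A →ₗ[k] A →ₗ[k] A :=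
    ((tmLin _ _).compl₁₂ (toObj k A) (toObj k A)).compr₂ (N ∘ₗ r.lin)
  have hB : ∀ h g, r.lin (tm (toObj k A h) (toObj k A g)) = toObj k A (B h g) := fun _ _ => rfl
  have B_l₁ : ∀ (x : baseAlgebra k A) (h g : A), B h (x * g) = x * B h g := by
    intro x h g
    have e := map_tm_l₁ r x (toObj k A h) (toObj k A g)
    rwa [weakBialgebraObj_l₁, hB, hB, weakBialgebraObj_l₁] at e
  have B_r₁ : ∀ (x : baseAlgebra k A) (h g : A), B h (g * x) = B h g * x := by
    intro x h g
    have e := map_tm_r₁ r x (toObj k A h) (toObj k A g)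
    rwa [weakBialgebraObj_r₁, hB, hB, weakBialgebraObj_r₁] at e
  have B_l₂ : ∀ y h g : A, B (piLbar k y * h) g = piLbar k y * B h g := by
    intro y h g
    have e := map_tm_l₂ r (toBase k A (piLbar k y)) (toObj k A h) (toObj k A g)
    rwa [weakBialgebraObj_l₂, hB, hB, weakBialgebraObj_l₂, piLbar_toBase_piLbar] at e
  have B_r₂ : ∀ y h g : A, B (h * piLbar k y) g = B h g * piLbar k y := by
    intro y h g
    have e := map_tm_r₂ r (toBase k A (piLbar k y)) (toObj k A h) (toObj k A g)
    rwa [weakBialgebraObj_r₂, hB, hB, weakBialgebraObj_r₂, piLbar_toBase_piLbar] at e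
  let ρ : A →ₗ[k] A := B.flip 1
  have hρ : ∀ h, B h 1 = ρ h := fun _ => rfl
  -- `Δ(ρ(h)) = h₁ ⊗ ρ(h₂)`, as `ρ` commutes with the multiplications by the legs of `Δ(1)`
  have c₁ : ∀ h, comul (R := k) (ρ h) = ρ.lTensor A (comul h) := by
    intro h
    have e := congrArg (fun f => ν (f.lin (tm (toObj k A h) (toObj k A 1)))) hl
    simp only [comp_lin, hB, hν'] at e
    rw [whiskerRight_tm, comul_weakBialgebraObj_toObj, tm_sum_left] at e
    simp only [map_sum, associator_hom_tm, whiskerLeft_tm, hB, hν, hρ] at e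
    rw [e, ← Finset.sum_mul, ← Finset.mul_sum]
    have key : ∀ t, comul (R := k) (1 : A) * ρ.lTensor A t * comul (R := k) (1 : A) =
        ρ.lTensor A (comul (R := k) (1 : A) * t * comul (R := k) (1 : A)) := by
      intro t
      rw [comul_one_eq_sum_piLbar]
      induction t with
      | zero => simp
      | add a b ha hb => simp only [mul_add, add_mul, map_add, ha, hb]
      | tmul a b =>
        simp only [Finset.sum_mul, Finset.mul_sum, map_sum, LinearMap.lTensor_tmul,
          Algebra.TensorProduct.tmul_mul_tmul, ← hρ, B_l₂, B_r₂]
    have e' : ∑ p ∈ comulIdx k h, p.1 ⊗ₜ[k] ρ p.2 = ρ.lTensor A (comul h) := by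
      rw [comul_eq_sum, map_sum]
      rfl
    rw [e', key, comul_one_mul, comul_mul_one]
  -- `Δ(ρ(h)) = ρ(h) 1₁ ⊗ 1₂`
  have c₂ : ∀ h, comul (R := k) (ρ h) = (ρ h ⊗ₜ 1) * comul (R := k) (1 : A) := by
    intro h
    have e := congrArg (fun f => ν (f.lin (tm (toObj k A h) (toObj k A 1)))) hr'
    simp only [comp_lin, hB, hν'] at e
    rw [whiskerLeft_tm, comul_weakBialgebraObj_toObj, tm_sum_right] at e
    simp only [map_sum, associator_inv_tm, whiskerRight_tm, hB, hν, hρ] at e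
    rw [e, ← Finset.sum_mul, ← Finset.mul_sum]
    have e' : ∑ p ∈ comulIdx k (1 : A), B h p.1 ⊗ₜ[k] p.2 = (B h).rTensor A (comul 1) := by
      rw [comul_eq_sum, map_sum]
      rfl
    have e'' : (B h).rTensor A (comul (1 : A)) = (ρ h ⊗ₜ 1) * comul (R := k) (1 : A) := by
      rw [comul_one_eq_sum_piR, map_sum, Finset.mul_sum]
      refine Finset.sum_congr rfl fun i _ => ?_
      have := B_r₁ (toBase k A i.1) h 1
      rw [one_mul, hρ, coe_toBase] at this
      rw [LinearMap.rTensor_tmul, this, Algebra.TensorProduct.tmul_mul_tmul, one_mul]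
    have key : ∀ t, comul (R := k) (1 : A) * (B h).rTensor A t =
        (B h).rTensor A (comul (R := k) (1 : A) * t) := by
      intro t
      rw [comul_one_eq_sum_piR]
      induction t with
      | zero => simp
      | add a b ha hb => simp only [mul_add, map_add, ha, hb]
      | tmul a b =>
        simp only [Finset.sum_mul, map_sum, LinearMap.rTensor_tmul,
          Algebra.TensorProduct.tmul_mul_tmul, ← coe_toBase, B_l₁]
    rw [e', key, comul_one_mul, e'', mul_assoc, comul_one_mul]
  have hX : ∀ h, hitLeft (counit (R := k) ∘ₗ ρ) h = ρ h := by
    intro h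
    have e := congrArg (fun t => TensorProduct.rid k A ((counit (R := k)).lTensor A t)) (c₁ h)
    simp only [Coalgebra.lTensor_counit_comul, TensorProduct.rid_tmul, one_smul] at e
    rw [e, hitLeft_apply, comul_eq_sum]
    simp
  have hL : ∀ h, piL k (ρ h) = ρ h := by
    intro h
    rw [← piLbar_piR_of k (c₂ h), piL_piLbar]
  refine ⟨counit (R := k) ∘ₗ ρ, (isNormalizedLeftCointegralFunctional_iff _).2
    ⟨fun h => by rw [hX, hL], fun h => ?_⟩⟩
  -- `y₁ ∘ y₂ = y ∘ 1` for `y = ⊓ᴸ(h)`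
  have e := congrArg (fun f => f.lin (toObj k A (piL k h))) hr
  simp only [comp_lin, id_lin] at e
  have e₁ : (ComonObj.comul (X := weakBialgebraObj k A)).lin (toObj k A (piL k h)) =
      tm (toObj k A (piL k h)) (toObj k A 1) := by
    rw [comul_weakBialgebraObj_toObj, sum_comulIdx_eq k (s := oneIdx k A)
      (a := fun i => piL k h * piR k i.1) (b := fun i => i.2)
      (fun a b => tm (toObj k A a) (toObj k A b))]
    · have : ∀ i : A × A, tm (toObj k A (piL k h * piR k i.1)) (toObj k A i.2) =
          tm (toObj k A (piL k h)) (toObj k A (i.2 * piLbar k (piR k i.1))) := by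
        intro i
        have := tm_r₁ (toBase k A i.1) (toObj k A (piL k h)) (toObj k A i.2)
        rwa [weakBialgebraObj_r₁, weakBialgebraObj_r₂, coe_toBase] at this
      simp only [this]
      rw [sum_piR_fst k (fun a b => tm (toObj k A (piL k h)) (toObj k A (b * piLbar k a))),
        ← tm_sum_right, ← map_sum, sum_snd_mul_piLbar]
    · rw [comul_piL, comul_one_eq_sum_piR, Finset.mul_sum]
      simp
  rw [e₁, hB, hρ] at e
  have e₂ : ρ (piL k h) = piL k h := e
  rw [LinearMap.comp_apply, e₂, counit_piL]

end comonoid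

/-! ### Left cointegrals for `a` -/

section cointegral

open CategoryTheory MonoidalCategory EnvBimod WeakBialgebra Coalgebra

variable {k : Type u} {A : Type v} [Field k] [Ring A] [Algebra k A] [Coalgebra k A]
  [WeakBialgebra k A]

omit [Coalgebra k A] [WeakBialgebra k A] in
@[fun_prop] lemma isLinearMap_subalgebra_coe {V : Type*} [AddCommGroup V] [Module k V]
    (B : Subalgebra k A) {g : V → B} (hg : IsLinearMap k g) :
    IsLinearMap k (fun x => (g x : A)) :=
  isLinearMap_comp (f := fun x : B => (x : A)) ⟨fun _ _ => rfl, fun _ _ => rfl⟩ hg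

/-- `h₁ ⊓ᴿ(h₂ τ(h₃)) = h₁ τ(h₂)`. -/
lemma sum_mul_piR_hitLeft (τ : A →ₗ[k] k) (h : A) :
    ∑ p ∈ comulIdx k h, p.1 * piR k (hitLeft τ p.2) = hitLeft τ h := by
  simp only [hitLeft_apply, map_sum, Finset.mul_sum, map_smul, mul_smul_comm]
  rw [← sum_comulIdx_coassoc k h (fun a b c => τ c • (a * piR k b))]
  simp only [← Finset.smul_sum, sum_mul_piR]

section ext

variable {V W V' : Type*} [AddCommGroup V] [Module k V] [AddCommGroup W] [Module k W]
  [AddCommGroup V'] [Module k V']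

lemma tm_jt_ext₃ {f₁ : V' →ₗ[k] V}
    {f₂ : (circ (weakBialgebraObj k A) (bulletUnit (baseFrobenius k A))).carrier →ₗ[k] V'}
    {g₁ : W →ₗ[k] V}
    {g₂ : (circ (weakBialgebraObj k A) (bulletUnit (baseFrobenius k A))).carrier →ₗ[k] W}
    (h : ∀ h p q, f₁ (f₂ (tm (toObj k A h) (jt _ p q))) = g₁ (g₂ (tm (toObj k A h) (jt _ p q)))) :
    ∀ t, f₁ (f₂ t) = g₁ (g₂ t) :=
  tm_ext₃ fun m n => jt_ext₃ (f₁ := f₁) (f₂ := f₂ ∘ₗ tmLin _ _ m) (g₁ := g₁)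
    (g₂ := g₂ ∘ₗ tmLin _ _ m) (fun p q => h m p q) n

lemma jt_tm_ext₃ {f₁ : V' →ₗ[k] V}
    {f₂ : (circ (bulletUnit (baseFrobenius k A)) (weakBialgebraObj k A)).carrier →ₗ[k] V'}
    {g₁ : W →ₗ[k] V}
    {g₂ : (circ (bulletUnit (baseFrobenius k A)) (weakBialgebraObj k A)).carrier →ₗ[k] W}
    (h : ∀ h p q, f₁ (f₂ (tm (jt _ p q) (toObj k A h))) = g₁ (g₂ (tm (jt _ p q) (toObj k A h)))) :
    ∀ t, f₁ (f₂ t) = g₁ (g₂ t) :=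
  tm_ext₃ fun m n => jt_ext₃ (f₁ := f₁) (f₂ := f₂ ∘ₗ (tmLin _ _).flip n) (g₁ := g₁)
    (g₂ := g₂ ∘ₗ (tmLin _ _).flip n) (fun p q => h n p q) m

lemma tm_jt_hom_ext {M : EnvBimod (baseFrobenius k A)}
    {f g : circ (weakBialgebraObj k A) (bulletUnit (baseFrobenius k A)) ⟶ M}
    (h : ∀ h p q, f.lin (tm (toObj k A h) (jt _ p q)) = g.lin (tm (toObj k A h) (jt _ p q))) :
    f = g :=
  hom_ext (tm_jt_ext₃ (f₁ := LinearMap.id) (g₁ := LinearMap.id) h)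

lemma jt_tm_hom_ext {M : EnvBimod (baseFrobenius k A)}
    {f g : circ (bulletUnit (baseFrobenius k A)) (weakBialgebraObj k A) ⟶ M}
    (h : ∀ h p q, f.lin (tm (jt _ p q) (toObj k A h)) = g.lin (tm (jt _ p q) (toObj k A h))) :
    f = g :=
  hom_ext (jt_tm_ext₃ (f₁ := LinearMap.id) (g₁ := LinearMap.id) h)

end ext

/-- The bimodule map `a ∘ j → j` is `h ∘ (p ⊗ q) ↦ p ⊗ w(hq)`, where `w(h) = ⊓ᴿ(h₁ τ(h₂))`. -/
lemma IsNormalizedLeftCointegralFunctional.exists_isNormalizedLeftCointegral {τ : A →ₗ[k] k}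
    (hτ : IsNormalizedLeftCointegralFunctional τ)
    (hb : ∀ x ∈ WeakBialgebra.baseAlgebra k A, ∀ h : A, τ (x * h) = τ (h * piR k (piL k x))) :
    ∃ θ, IsNormalizedLeftCointegral (weakBialgebraObj k A) (bulletUnit (baseFrobenius k A))
      (weakBialgebraUnit k A) θ := by
  let w : A →ₗ[k] baseAlgebra k A := toBase k A ∘ₗ hitLeft τ
  have hw : ∀ h, (w h : A) = piR k (hitLeft τ h) := fun _ => rfl
  have hw' : ∀ h, piLbar k (w h : A) = hitLeft τ h := by
    intro h
    rw [hw, ← hτ.piL_hitLeft, piLbar_piR_piL]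
  have w_base_mul : ∀ (x : baseAlgebra k A) (h : A),
      w (x * h) = w (h * ((baseFrobenius k A).nakayamaInv x : A)) := by
    intro x h
    refine congrArg (toBase k A) ?_
    rw [hitLeft_apply, hitLeft_apply, sum_comulIdx_base_mul k (fun a b => τ b • a),
      sum_comulIdx_mul_base k (fun a b => τ b • a)]
    simp only [hb x x.2, piR_piL_eq_nakayamaInv]
  have w_piLbar_mul : ∀ (x : baseAlgebra k A) (h : A), w (piLbar k (x : A) * h) = w h * x := by
    intro x h
    apply Subtype.ext
    rw [hw, hitLeft_piLbar_mul, ← hw', ← piLbar_mul_base, ← MulMemClass.coe_mul, piR_piLbar_base]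
  have w_mul_piLbar : ∀ (x : baseAlgebra k A) (h : A), w (h * piLbar k (x : A)) = x * w h := by
    intro x h
    apply Subtype.ext
    rw [hw, hitLeft_mul_piLbar, piR_mul_piLbar_base, MulMemClass.coe_mul, hw]
  have w_one : w 1 = 1 := by
    apply Subtype.ext
    rw [hw, hitLeft_apply, sum_comulIdx_one k (fun a b => τ b • a),
      ← sum_piL_snd k (fun a b => τ b • a)]
    simp only [hτ.apply_piL, sum_counit_right, piR_one, OneMemClass.coe_one]
  obtain ⟨F, hF⟩ := exists_linearMap_tmul₃ (k := k) (fun (h : A) (p q : baseAlgebra k A) =>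
    jtLin (baseFrobenius k A) p (w (h * q)))
  let f : (weakBialgebraObj k A).carrier ⊗[k] (bulletUnit (baseFrobenius k A)).carrier →ₗ[k]
    (bulletUnit (baseFrobenius k A)).carrier := TensorProduct.lift (objLift k A F)
  have hf : ∀ (h : A) (p q : baseAlgebra k A), f (toObj k A h ⊗ₜ jt _ p q) = jt _ p (w (h * q)) :=
    hF
  let t : (circ (weakBialgebraObj k A) (bulletUnit (baseFrobenius k A))).carrier →ₗ[k]
    (bulletUnit (baseFrobenius k A)).carrier := f ∘ₗ incl _ _
  have ht : ∀ (h : A) (p q : baseAlgebra k A),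
      t (tm (toObj k A h) (jt _ p q)) = jt _ p (w (h * q)) := by
    intro h p q
    rw [← hf]
    refine comp_incl_tm f ?_ ?_ _ _
    · intro x m n
      obtain ⟨h, rfl⟩ := toObj_surjective k m
      induction n using jt_induction with
      | h0 => simp
      | hadd a b ha hb => simp only [TensorProduct.tmul_add, map_add, ha, hb]
      | hc p q =>
        rw [weakBialgebraObj_l₁, bulletUnit_l₂, hf, hf, mul_assoc, w_base_mul, mul_assoc,
          MulMemClass.coe_mul]
    · intro x m n
      obtain ⟨h, rfl⟩ := toObj_surjective k m
      induction n using jt_induction with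
      | h0 => simp
      | hadd a b ha hb => simp only [TensorProduct.tmul_add, map_add, ha, hb]
      | hc p q =>
        rw [weakBialgebraObj_r₁, bulletUnit_r₂, hf, hf, mul_assoc, MulMemClass.coe_mul]
  let θ : circ (weakBialgebraObj k A) (bulletUnit (baseFrobenius k A)) ⟶
      bulletUnit (baseFrobenius k A) :=
    homMk t
      (fun x => tm_jt_ext₃ fun h p q => by
        rw [circ_l₁, bulletUnit_l₁, ht, ht, bulletUnit_l₁])
      (fun x => tm_jt_ext₃ fun h p q => by
        rw [circ_l₂, weakBialgebraObj_l₂, ht, ht, bulletUnit_l₂, mul_assoc, w_piLbar_mul])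
      (fun x => tm_jt_ext₃ fun h p q => by
        rw [circ_r₁, bulletUnit_r₁, ht, ht, bulletUnit_r₁])
      (fun x => tm_jt_ext₃ fun h p q => by
        rw [circ_r₂, weakBialgebraObj_r₂, ht, ht, bulletUnit_r₂, mul_assoc, ← base_mul_piLbar,
          ← mul_assoc, w_mul_piLbar])
  have hθ : ∀ (h : A) (p q : baseAlgebra k A),
      θ.lin (tm (toObj k A h) (jt _ p q)) = jt _ p (w (h * q)) := ht
  refine ⟨θ, tm_jt_hom_ext fun h p q => ?_, tm_jt_hom_ext fun h p q => ?_,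
    jt_hom_ext fun p q => ?_⟩
  · simp only [comp_lin]
    rw [hθ, whiskerRight_tm, comul_weakBialgebraObj_toObj, tm_sum_left, comul_bulletUnit_jt,
      whiskerRight_tm, weakBialgebraUnit_jt]
    simp only [map_sum, associator_hom_tm, whiskerLeft_tm, hθ]
    have e : ∀ g h : A, tm (toObj k A g) (jt (baseFrobenius k A) p (w h)) =
        tm (toObj k A (g * piR k (hitLeft τ h))) (jt _ p 1) := by
      intro g h
      rw [← hw, ← weakBialgebraObj_r₁, tm_r₁, bulletUnit_r₂, mul_one]
    simp only [e]
    rw [← tm_sum_left, ← map_sum, hw', OneMemClass.coe_one, one_mul, ← sum_mul_piR_hitLeft τ,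
      sum_comulIdx_mul_base k (fun a b => a * piR k (hitLeft τ b))]
  · simp only [comp_lin]
    rw [hθ, whiskerLeft_tm, comul_bulletUnit_jt, comul_bulletUnit_jt, associator_inv_tm,
      whiskerRight_tm, hθ]
  · simp only [comp_lin]
    rw [comul_bulletUnit_jt, whiskerRight_tm, weakBialgebraUnit_jt, hθ, id_lin]
    rw [OneMemClass.coe_one, mul_one, one_mul, ← mul_one (piLbar k (q : A)), w_piLbar_mul, w_one,
      one_mul]

/-- The left unit constraint `i ∘ j → j` sends every `n ∘ (1 ⊗ 1)` into `1 ⊗ R`. -/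
lemma exists_leftUnitHom_eq_jt (n : (circUnit (baseFrobenius k A)).carrier) :
    ∃ z, (leftUnitHom (bulletUnit (baseFrobenius k A))).lin (tm n (jt _ 1 1)) = jt _ 1 z := by
  induction n using ut_induction with
  | h0 => exact ⟨0, by simp [tm_zero_left, ← jtLin_apply]⟩
  | hadd a b ha hb =>
    obtain ⟨y, hy⟩ := ha
    obtain ⟨z, hz⟩ := hb
    exact ⟨y + z, by rw [tm_add_left, map_add, hy, hz]; simp [← jtLin_apply]⟩
  | hc p q => exact ⟨_, by rw [leftUnitHom_tm, bulletUnit_r₂, bulletUnit_l₂]⟩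

/-- By colinearity, `θ(h ∘ (1 ⊗ 1)) = 1 ⊗ w(h)` for a linear map `w : A → R`; the functional is
`ε ∘ w`. -/
lemma IsNormalizedLeftCointegral.exists_left {θ}
    (hθ : IsNormalizedLeftCointegral (weakBialgebraObj k A) (bulletUnit (baseFrobenius k A))
      (weakBialgebraUnit k A) θ) :
    ∃ τ : A →ₗ[k] k, IsNormalizedLeftCointegralFunctional τ := by
  let μ : (bulletUnit (baseFrobenius k A)).carrier →ₗ[k] baseAlgebra k A :=
    jLift (LinearMap.mul k _)
  have hμ : ∀ p q, μ (jt _ p q) = p * q := fun _ _ => rfl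
  let w : A →ₗ[k] baseAlgebra k A := μ ∘ₗ θ.lin ∘ₗ (tmLin _ _).flip (jt _ 1 1) ∘ₗ toObj k A
  have hw : ∀ h, w h = μ (θ.lin (tm (toObj k A h) (jt _ 1 1))) := fun _ => rfl
  -- right colinearity at `h ∘ (1 ⊗ 1)`, followed by the counit of the first factor `j`
  have θ_tm : ∀ h, θ.lin (tm (toObj k A h) (jt _ 1 1)) = jt _ 1 (w h) := by
    intro h
    obtain ⟨z, hz⟩ := exists_leftUnitHom_eq_jt ((ComonObj.counit (X := bulletUnit _)).lin
      (θ.lin (tm (toObj k A h) (jt (baseFrobenius k A) 1 1))))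
    have e₁ := congrArg (fun f => f.lin (tm (toObj k A h) (jt _ 1 1))) hθ.right_colinear
    simp only [comp_lin] at e₁
    rw [whiskerLeft_tm, comul_bulletUnit_jt, associator_inv_tm, whiskerRight_tm] at e₁
    have e₂ := congrArg (fun f => (leftUnitHom (bulletUnit _)).lin
      (f.lin (θ.lin (tm (toObj k A h) (jt _ 1 1)))))
      (ComonObj.counit_comul (X := bulletUnit (baseFrobenius k A)))
    simp only [comp_lin] at e₂
    rw [e₁, whiskerRight_tm, leftUnitor_inv_lin, leftUnitHom_tm, hz,
      FrobeniusSeparability.nakayamaInv_one, r₂_one, l₂_one] at e₂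
    rw [hw, ← e₂, hμ, one_mul]
  have w_piLbar_mul : ∀ (x : baseAlgebra k A) (h : A), w (piLbar k (x : A) * h) = w h * x := by
    intro x h
    rw [hw, ← weakBialgebraObj_l₂, map_tm_l₂, θ_tm, bulletUnit_l₂, hμ, one_mul]
  -- left colinearity at `h ∘ (1 ⊗ 1)`, evaluated by the restriction of `g ⊗ (p ⊗ q) ↦ ψ(pq) g` to
  -- `a ∘ j`, which maps `g ∘ (1 ⊗ 1)` to `∑ eᵢ g fᵢ`
  have w_eq : ∀ h, piLbar k (w h : A) = ∑ p ∈ comulIdx k h, p.1 * (w p.2 : A) := by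
    intro h
    let N : (weakBialgebraObj k A).carrier →ₗ[k] A := objLift k A LinearMap.id
    let ev : (circ (weakBialgebraObj k A) (bulletUnit (baseFrobenius k A))).carrier →ₗ[k] A :=
      TensorProduct.lift ((LinearMap.lsmul k A).flip.compl₁₂ N
        ((baseFrobenius k A).functional ∘ₗ μ)) ∘ₗ incl _ _
    have hev : ∀ g : A, ev (tm (toObj k A g) (jt _ 1 1)) =
        ∑ i ∈ (baseFrobenius k A).idx, (i.1 : A) * (g * (i.2 : A)) := by
      intro g
      simp only [ev, LinearMap.comp_apply, incl_tm, map_sum, bulletUnit_l₂, bulletUnit_r₂,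
        weakBialgebraObj_l₁, weakBialgebraObj_r₁, TensorProduct.lift.tmul]
      refine Finset.sum_congr rfl fun i _ => ?_
      conv_rhs => rw [← (baseFrobenius k A).sum_functional_mul_right i.2]
      simp only [AddSubmonoidClass.coe_finsetSum, Subalgebra.coe_smul, Finset.mul_sum,
        mul_smul_comm]
      refine Finset.sum_congr rfl fun j _ => ?_
      change (baseFrobenius k A).functional (1 * (j.2 * 1 * i.2)) • (_ : A) = _
      rw [one_mul, mul_one]
      rfl
    have sum_mul : ∀ z : A, ∑ i ∈ (baseFrobenius k A).idx, z * ((i.1 : A) * i.2) = z := by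
      intro z
      have e := congrArg (fun y : baseAlgebra k A => z * (y : A)) (baseFrobenius k A).sum_mul
      simpa [Finset.mul_sum] using e
    have e := congrArg (fun f => ev (f.lin (tm (toObj k A h) (jt _ 1 1)))) hθ.left_colinear
    simp only [comp_lin] at e
    rw [whiskerRight_tm, comul_weakBialgebraObj_toObj, tm_sum_left, θ_tm, comul_bulletUnit_jt,
      whiskerRight_tm, weakBialgebraUnit_jt, hev] at e
    have e₁ : ∀ g h : A, tm (toObj k A g) (jt (baseFrobenius k A) 1 (w h)) =
        tm (toObj k A (g * w h)) (jt _ 1 1) := by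
      intro g h
      rw [← weakBialgebraObj_r₁, tm_r₁, bulletUnit_r₂, mul_one]
    simp only [map_sum, associator_hom_tm, whiskerLeft_tm, θ_tm, e₁, hev] at e
    rw [Finset.sum_comm] at e
    simp only [OneMemClass.coe_one, one_mul, ← mul_assoc, base_mul_piLbar] at e
    simp only [mul_assoc, sum_mul] at e
    rw [e]
    have e₂ : ∀ i : baseAlgebra k A × baseAlgebra k A,
        ∑ p ∈ comulIdx k h, (i.1 : A) * (p.1 * (w p.2 * i.2)) =
          ∑ p ∈ comulIdx k h, p.1 * (w p.2 * ((i.1 : A) * i.2)) := by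
      intro i
      have := sum_comulIdx_base_mul_fst k (fun a b => a * (w b * (i.2 : A))) i.1 h
      simpa only [w_piLbar_mul, mul_assoc, MulMemClass.coe_mul] using this
    simp only [e₂]
    rw [Finset.sum_comm]
    simp only [← Finset.mul_sum, sum_mul]
  -- `h₁ ε(w(h₂)) = h₁ ε(h₂ w(h₃)) = (id ⊗ ε) Δ(⊓̅ᴸ(w(h)))`
  have hX : ∀ h, hitLeft (counit (R := k) ∘ₗ (baseAlgebra k A).val.toLinearMap ∘ₗ w) h =
      piLbar k (w h : A) := by
    intro h
    rw [w_eq]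
    have e : ∀ p : A × A, p.1 * (w p.2 : A) =
        ∑ q ∈ comulIdx k p.1, counit (R := k) (q.2 * (w p.2 : A)) • q.1 := by
      intro p
      rw [← sum_comulIdx_mul_base k (fun a b => counit (R := k) b • a), sum_counit_smul_fst]
    simp only [e]
    rw [sum_comulIdx_coassoc k h (fun a b c => counit (R := k) (b * (w c : A)) • a), hitLeft_apply]
    simp only [← Finset.sum_smul, ← map_sum, ← w_eq, counit_piLbar]
    rfl
  refine ⟨counit (R := k) ∘ₗ (baseAlgebra k A).val.toLinearMap ∘ₗ w,
    (isNormalizedLeftCointegralFunctional_iff _).2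
    ⟨fun h => by rw [hX, piL_piLbar], fun h => ?_⟩⟩
  have e := congrArg (fun f => μ (f.lin (jt _ 1 (toBase k A (piL k h))))) hθ.normalized
  simp only [comp_lin, id_lin] at e
  rw [comul_bulletUnit_jt, whiskerRight_tm, weakBialgebraUnit_jt, θ_tm, hμ, hμ, one_mul, one_mul,
    OneMemClass.coe_one, one_mul, coe_toBase, piLbar_piR_piL] at e
  change counit (R := k) (w (piL k h) : A) = _
  rw [e, coe_toBase, counit_piR, counit_piL]

end cointegral

/-! ### Right cointegrals for `a` -/

section cointegral

open CategoryTheory MonoidalCategory EnvBimod WeakBialgebra Coalgebra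

variable {k : Type u} {A : Type v} [Field k] [Ring A] [Algebra k A] [Coalgebra k A]
  [WeakBialgebra k A]

/-- `h₃ ⊓̅ᴸ(τ(h₁) h₂) = τ(h₁) h₂`. -/
lemma sum_mul_piLbar_hitRight (τ : A →ₗ[k] k) (h : A) :
    ∑ p ∈ comulIdx k h, p.2 * piLbar k (hitRight τ p.1) = hitRight τ h := by
  simp only [hitRight_apply, map_sum, Finset.mul_sum, map_smul, mul_smul_comm]
  rw [sum_comulIdx_coassoc k h (fun a b c => τ a • (c * piLbar k b))]
  simp only [← Finset.smul_sum, sum_mul_piLbar]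

/-- The bimodule map `j ∘ a → j` is `(p ⊗ q) ∘ h ↦ v(h ⊓̅ᴸ(p)) ⊗ q`, where `v(h) = τ(h₁) h₂`. -/
lemma IsNormalizedRightCointegralFunctional.exists_isNormalizedRightCointegral {τ : A →ₗ[k] k}
    (hτ : IsNormalizedRightCointegralFunctional τ)
    (hb : ∀ x ∈ WeakBialgebra.baseAlgebra k A, ∀ h : A, τ (h * piLbar k x) = τ (piL k x * h)) :
    ∃ θ, IsNormalizedRightCointegral (weakBialgebraObj k A) (bulletUnit (baseFrobenius k A))
      (weakBialgebraUnit k A) θ := by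
  let v : A →ₗ[k] baseAlgebra k A := toBase k A ∘ₗ hitRight τ
  have hv : ∀ h, (v h : A) = hitRight τ h := hτ.piR_hitRight
  have v_mul_piLbar : ∀ (x : baseAlgebra k A) (h : A),
      v (h * piLbar k (x : A)) = v (piLbar k ((baseFrobenius k A).nakayamaInv x : A) * h) := by
    intro x h
    refine congrArg (toBase k A) ?_
    rw [hitRight_apply, hitRight_apply, sum_comulIdx_mul_piLbar k (fun a b => τ a • b),
      sum_comulIdx_piLbar_mul k (fun a b => τ a • b)]
    simp only [hb x x.2, piLbar_nakayamaInv]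
  have v_base_mul : ∀ (x : baseAlgebra k A) (h : A), v (x * h) = x * v h := by
    intro x h
    apply Subtype.ext
    rw [hv, hitRight_base_mul, MulMemClass.coe_mul, hv]
  have v_mul_base : ∀ (x : baseAlgebra k A) (h : A), v (h * x) = v h * x := by
    intro x h
    apply Subtype.ext
    rw [hv, hitRight_mul_base, MulMemClass.coe_mul, hv]
  have v_one : v 1 = 1 := by
    apply Subtype.ext
    rw [hv, hitRight_apply, sum_comulIdx_one k (fun a b => τ a • b),
      ← sum_piR_fst k (fun a b => τ a • b)]
    simp only [hτ.apply_piR, sum_counit_left, OneMemClass.coe_one]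
  obtain ⟨F, hF⟩ := exists_linearMap_tmul₃ (k := k) (fun (h : A) (p q : baseAlgebra k A) =>
    jtLin (baseFrobenius k A) (v (h * piLbar k (p : A))) q)
  let f : (bulletUnit (baseFrobenius k A)).carrier ⊗[k] (weakBialgebraObj k A).carrier →ₗ[k]
    (bulletUnit (baseFrobenius k A)).carrier := TensorProduct.lift (objLift k A F).flip
  have hf : ∀ (h : A) (p q : baseAlgebra k A), f (jt _ p q ⊗ₜ toObj k A h) =
      jt _ (v (h * piLbar k (p : A))) q := hF
  let t : (circ (bulletUnit (baseFrobenius k A)) (weakBialgebraObj k A)).carrier →ₗ[k]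
    (bulletUnit (baseFrobenius k A)).carrier := f ∘ₗ incl _ _
  have ht : ∀ (h : A) (p q : baseAlgebra k A),
      t (tm (jt _ p q) (toObj k A h)) = jt _ (v (h * piLbar k (p : A))) q := by
    intro h p q
    rw [← hf]
    refine comp_incl_tm f ?_ ?_ _ _
    · intro x n m
      obtain ⟨h, rfl⟩ := toObj_surjective k m
      induction n using jt_induction with
      | h0 => simp
      | hadd a b ha hb => simp only [TensorProduct.add_tmul, map_add, ha, hb]
      | hc p q =>
        rw [weakBialgebraObj_l₂, bulletUnit_l₁, hf, hf, mul_assoc, ← v_mul_piLbar,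
          MulMemClass.coe_mul, piLbar_mul_base, mul_assoc]
    · intro x n m
      obtain ⟨h, rfl⟩ := toObj_surjective k m
      induction n using jt_induction with
      | h0 => simp
      | hadd a b ha hb => simp only [TensorProduct.add_tmul, map_add, ha, hb]
      | hc p q =>
        rw [weakBialgebraObj_r₂, bulletUnit_r₁, hf, hf, mul_assoc, MulMemClass.coe_mul,
          piLbar_mul_base]
  let θ : circ (bulletUnit (baseFrobenius k A)) (weakBialgebraObj k A) ⟶
      bulletUnit (baseFrobenius k A) :=
    homMk t
      (fun x => jt_tm_ext₃ fun h p q => by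
        rw [circ_l₁, weakBialgebraObj_l₁, ht, ht, bulletUnit_l₁, mul_assoc, v_base_mul])
      (fun x => jt_tm_ext₃ fun h p q => by
        rw [circ_l₂, bulletUnit_l₂, ht, ht, bulletUnit_l₂])
      (fun x => jt_tm_ext₃ fun h p q => by
        rw [circ_r₁, weakBialgebraObj_r₁, ht, ht, bulletUnit_r₁, mul_assoc, base_mul_piLbar,
          ← mul_assoc, v_mul_base])
      (fun x => jt_tm_ext₃ fun h p q => by
        rw [circ_r₂, bulletUnit_r₂, ht, ht, bulletUnit_r₂])
  have hθ : ∀ (h : A) (p q : baseAlgebra k A),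
      θ.lin (tm (jt _ p q) (toObj k A h)) = jt _ (v (h * piLbar k (p : A))) q := ht
  refine ⟨θ, jt_tm_hom_ext fun h p q => ?_, jt_tm_hom_ext fun h p q => ?_,
    jt_hom_ext fun p q => ?_⟩
  · simp only [comp_lin]
    rw [hθ, whiskerLeft_tm, comul_weakBialgebraObj_toObj, tm_sum_right, comul_bulletUnit_jt,
      whiskerLeft_tm, weakBialgebraUnit_jt]
    simp only [map_sum, associator_inv_tm, whiskerRight_tm, hθ]
    have e : ∀ g h : A, tm (jt (baseFrobenius k A) (v h) q) (toObj k A g) =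
        tm (jt _ 1 q) (toObj k A (g * piLbar k (hitRight τ h))) := by
      intro g h
      rw [← hv, ← weakBialgebraObj_r₂, ← tm_r₁, bulletUnit_r₁, one_mul]
    simp only [e]
    rw [← tm_sum_right, ← map_sum, hv, OneMemClass.coe_one, piLbar_one, mul_one,
      ← sum_mul_piLbar_hitRight τ,
      sum_comulIdx_mul_piLbar k (fun a b => b * piLbar k (hitRight τ a))]
  · simp only [comp_lin]
    rw [hθ, whiskerRight_tm, comul_bulletUnit_jt, comul_bulletUnit_jt, associator_hom_tm,
      whiskerLeft_tm, hθ]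
  · simp only [comp_lin]
    rw [comul_bulletUnit_jt, whiskerLeft_tm, weakBialgebraUnit_jt, hθ, id_lin]
    rw [OneMemClass.coe_one, piLbar_one, mul_one, v_base_mul, v_one, mul_one]

/-- The right unit constraint `j ∘ i → j` sends every `(1 ⊗ 1) ∘ n` into `R ⊗ 1`. -/
lemma exists_rightUnitHom_eq_jt (n : (circUnit (baseFrobenius k A)).carrier) :
    ∃ z, (rightUnitHom (bulletUnit (baseFrobenius k A))).lin (tm (jt _ 1 1) n) = jt _ z 1 := by
  induction n using ut_induction with
  | h0 => exact ⟨0, by simp [tm_zero_right, ← jtLin_apply]⟩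
  | hadd a b ha hb =>
    obtain ⟨y, hy⟩ := ha
    obtain ⟨z, hz⟩ := hb
    exact ⟨y + z, by rw [tm_add_right, map_add, hy, hz]; simp [← jtLin_apply]⟩
  | hc p q => exact ⟨_, by rw [rightUnitHom_tm, bulletUnit_r₁, bulletUnit_l₁]⟩

/-- By colinearity, `θ((1 ⊗ 1) ∘ h) = v(h) ⊗ 1` for a linear map `v : A → R`; the functional is
`ε ∘ v`. -/
lemma IsNormalizedRightCointegral.exists_right {θ}
    (hθ : IsNormalizedRightCointegral (weakBialgebraObj k A) (bulletUnit (baseFrobenius k A))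
      (weakBialgebraUnit k A) θ) :
    ∃ τ : A →ₗ[k] k, IsNormalizedRightCointegralFunctional τ := by
  let μ : (bulletUnit (baseFrobenius k A)).carrier →ₗ[k] baseAlgebra k A :=
    jLift (LinearMap.mul k _)
  have hμ : ∀ p q, μ (jt _ p q) = p * q := fun _ _ => rfl
  let v : A →ₗ[k] baseAlgebra k A := μ ∘ₗ θ.lin ∘ₗ tmLin _ _ (jt _ 1 1) ∘ₗ toObj k A
  have hv : ∀ h, v h = μ (θ.lin (tm (jt _ 1 1) (toObj k A h))) := fun _ => rfl
  -- left colinearity at `(1 ⊗ 1) ∘ h`, followed by the counit of the second factor `j`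
  have θ_tm : ∀ h, θ.lin (tm (jt _ 1 1) (toObj k A h)) = jt _ (v h) 1 := by
    intro h
    obtain ⟨z, hz⟩ := exists_rightUnitHom_eq_jt ((ComonObj.counit (X := bulletUnit _)).lin
      (θ.lin (tm (jt (baseFrobenius k A) 1 1) (toObj k A h))))
    have e₁ := congrArg (fun f => f.lin (tm (jt _ 1 1) (toObj k A h))) hθ.left_colinear
    simp only [comp_lin] at e₁
    rw [whiskerRight_tm, comul_bulletUnit_jt, associator_hom_tm, whiskerLeft_tm] at e₁
    have e₂ := congrArg (fun f => (rightUnitHom (bulletUnit _)).lin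
      (f.lin (θ.lin (tm (jt _ 1 1) (toObj k A h)))))
      (ComonObj.comul_counit (X := bulletUnit (baseFrobenius k A)))
    simp only [comp_lin] at e₂
    rw [e₁, whiskerLeft_tm, rightUnitor_inv_lin, rightUnitHom_tm, hz, r₁_one, l₁_one] at e₂
    rw [hv, ← e₂, hμ, mul_one]
  have v_base_mul : ∀ (x : baseAlgebra k A) (h : A), v (x * h) = x * v h := by
    intro x h
    rw [hv, ← weakBialgebraObj_l₁, map_tm_l₁, θ_tm, bulletUnit_l₁, hμ, mul_one]
  -- right colinearity at `(1 ⊗ 1) ∘ h`, evaluated by the restriction of `(p ⊗ q) ⊗ g ↦ ψ(pq) g` to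
  -- `j ∘ a`, which maps `(1 ⊗ 1) ∘ g` to `∑ ⊓̅ᴸ(fᵢ) g ⊓̅ᴸ(eᵢ)`
  have v_eq : ∀ h, (v h : A) = ∑ p ∈ comulIdx k h, p.2 * piLbar k (v p.1 : A) := by
    intro h
    let N : (weakBialgebraObj k A).carrier →ₗ[k] A := objLift k A LinearMap.id
    let ev : (circ (bulletUnit (baseFrobenius k A)) (weakBialgebraObj k A)).carrier →ₗ[k] A :=
      TensorProduct.lift ((LinearMap.lsmul k A).compl₁₂
        ((baseFrobenius k A).functional ∘ₗ μ) N) ∘ₗ incl _ _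
    have hev : ∀ g : A, ev (tm (jt _ 1 1) (toObj k A g)) =
        ∑ i ∈ (baseFrobenius k A).idx, piLbar k (i.2 : A) * (g * piLbar k (i.1 : A)) := by
      intro g
      simp only [ev, LinearMap.comp_apply, incl_tm, map_sum, bulletUnit_l₁, bulletUnit_r₁,
        weakBialgebraObj_l₂, weakBialgebraObj_r₂, TensorProduct.lift.tmul]
      refine Finset.sum_congr rfl fun i _ => ?_
      conv_rhs => rw [← (baseFrobenius k A).sum_functional_mul_left i.1]
      simp only [AddSubmonoidClass.coe_finsetSum, Subalgebra.coe_smul, Finset.mul_sum, map_sum,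
        map_smul, mul_smul_comm]
      refine Finset.sum_congr rfl fun j _ => ?_
      change (baseFrobenius k A).functional ((i.1 * (1 * j.1)) * 1) • (_ : A) = _
      rw [one_mul, mul_one]
      rfl
    have sum_mul : ∀ z : A, ∑ i ∈ (baseFrobenius k A).idx,
        z * (piLbar k (i.2 : A) * piLbar k (i.1 : A)) = z := by
      intro z
      have e := congrArg (fun y : baseAlgebra k A => z * piLbar k (y : A))
        (baseFrobenius k A).sum_mul
      simpa [Finset.mul_sum, piLbar_mul_base, piLbar_one] using e
    have e := congrArg (fun f => ev (f.lin (tm (jt _ 1 1) (toObj k A h)))) hθ.right_colinear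
    simp only [comp_lin] at e
    rw [whiskerLeft_tm, comul_weakBialgebraObj_toObj, tm_sum_right, θ_tm, comul_bulletUnit_jt,
      whiskerLeft_tm, weakBialgebraUnit_jt, hev] at e
    have e₁ : ∀ g h : A, tm (jt (baseFrobenius k A) (v h) 1) (toObj k A g) =
        tm (jt _ 1 1) (toObj k A (g * piLbar k (v h : A))) := by
      intro g h
      rw [← weakBialgebraObj_r₂, ← tm_r₁, bulletUnit_r₁, one_mul]
    simp only [map_sum, associator_inv_tm, whiskerRight_tm, θ_tm, e₁, hev] at e
    rw [Finset.sum_comm] at e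
    simp only [OneMemClass.coe_one, piLbar_one, mul_one, ← mul_assoc, ← base_mul_piLbar] at e
    simp only [mul_assoc, sum_mul] at e
    rw [e]
    have e₂ : ∀ i : baseAlgebra k A × baseAlgebra k A,
        ∑ p ∈ comulIdx k h, piLbar k (i.2 : A) * (p.2 * (piLbar k (v p.1 : A) * piLbar k (i.1 : A)))
          = ∑ p ∈ comulIdx k h, p.2 * (piLbar k (v p.1 : A) *
            (piLbar k (i.2 : A) * piLbar k (i.1 : A))) := by
      intro i
      have := sum_comulIdx_base_mul_fst k
        (fun a b => b * (piLbar k (v a : A) * piLbar k (i.1 : A))) i.2 h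
      simpa only [v_base_mul, mul_assoc, MulMemClass.coe_mul, piLbar_mul_base] using this.symm
    simp only [e₂]
    rw [Finset.sum_comm]
    simp only [← Finset.mul_sum, sum_mul]
  -- `ε(v(h₁)) h₂ = ε(h₂ ⊓̅ᴸ(v(h₁))) h₃ = (ε ⊗ id) Δ(v(h))`
  have hX : ∀ h, hitRight (counit (R := k) ∘ₗ (baseAlgebra k A).val.toLinearMap ∘ₗ v) h =
      (v h : A) := by
    intro h
    rw [v_eq]
    have e : ∀ p : A × A, p.2 * piLbar k (v p.1 : A) =
        ∑ q ∈ comulIdx k p.2, counit (R := k) (q.1 * piLbar k (v p.1 : A)) • q.2 := by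
      intro p
      rw [← sum_comulIdx_mul_piLbar k (fun a b => counit (R := k) a • b), sum_counit_smul_snd]
    simp only [e]
    rw [← sum_comulIdx_coassoc k h (fun a b c => counit (R := k) (b * piLbar k (v a : A)) • c),
      hitRight_apply]
    simp only [← Finset.sum_smul, ← map_sum, ← v_eq]
    rfl
  refine ⟨counit (R := k) ∘ₗ (baseAlgebra k A).val.toLinearMap ∘ₗ v,
    (isNormalizedRightCointegralFunctional_iff _).2
    ⟨fun h => by rw [hX, piR_base], fun h => ?_⟩⟩
  have e := congrArg (fun f => μ (f.lin (jt _ (toBase k A h) 1))) hθ.normalized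
  simp only [comp_lin, id_lin] at e
  rw [comul_bulletUnit_jt, whiskerLeft_tm, weakBialgebraUnit_jt, θ_tm, hμ, hμ, mul_one, mul_one,
    OneMemClass.coe_one, piLbar_one, mul_one, coe_toBase] at e
  change counit (R := k) (v (piR k h) : A) = _
  rw [e, coe_toBase, counit_piR]

end cointegral

theorem mainTheorem7 (k : Type u) (A : Type v) [Field k] [Ring A] [Algebra k A] [Coalgebra k A]
    [WeakHopfAlgebra k A] :
    List.TFAE [
      IsCoseparableCoalgebra k A,
      IsCoseparableComonoid (weakBialgebraObj k A),
      ∃ τ : A →ₗ[k] k, IsNormalizedLeftCointegralFunctional τ,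
      ∃ θ, IsNormalizedLeftCointegral (weakBialgebraObj k A)
        (EnvBimod.bulletUnit (WeakBialgebra.baseFrobenius k A)) (weakBialgebraUnit k A) θ,
      ∃ τ : A →ₗ[k] k, IsNormalizedLeftCointegralFunctional τ ∧
        ∀ x ∈ WeakBialgebra.baseAlgebra k A, ∀ h : A, τ (x * h) = τ (h * piR k (piL k x)),
      ∃ τ : A →ₗ[k] k, IsNormalizedRightCointegralFunctional τ,
      ∃ θ, IsNormalizedRightCointegral (weakBialgebraObj k A)
        (EnvBimod.bulletUnit (WeakBialgebra.baseFrobenius k A)) (weakBialgebraUnit k A) θ,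
      ∃ τ : A →ₗ[k] k, IsNormalizedRightCointegralFunctional τ ∧
        ∀ x ∈ WeakBialgebra.baseAlgebra k A, ∀ h : A, τ (h * piLbar k x) = τ (piL k x * h)] := by
  obtain ⟨S, hS⟩ := exists_isRegularAntipode k A
  tfae_have 1 → 3 := fun h => h.exists_left
  tfae_have 3 → 1 := fun ⟨_, hτ⟩ => hτ.isCoseparableCoalgebra hS
  tfae_have 3 → 5 := fun ⟨_, hτ⟩ => hτ.exists_balanced
  tfae_have 5 → 2 := fun ⟨_, hτ, hb⟩ => hτ.isCoseparableComonoid hS hb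
  tfae_have 2 → 3 := fun h => h.exists_left
  tfae_have 5 → 4 := fun ⟨_, hτ, hb⟩ => hτ.exists_isNormalizedLeftCointegral hb
  tfae_have 4 → 3 := fun ⟨_, hθ⟩ => hθ.exists_left
  tfae_have 1 → 6 := fun h => h.exists_right
  tfae_have 6 → 1 := fun ⟨_, hτ⟩ => hτ.isCoseparableCoalgebra hS
  tfae_have 6 → 8 := fun ⟨_, hτ⟩ => hτ.exists_balanced
  tfae_have 8 → 7 := fun ⟨_, hτ, hb⟩ => hτ.exists_isNormalizedRightCointegral hb
  tfae_have 7 → 6 := fun ⟨_, hθ⟩ => hθ.exists_right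
  tfae_finish
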